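/- Let $n\ge 1$ and let $(M,\theta)$ be a strictly pseudoconvex CR manifold of real dimension $2n+1$: a smooth manifold without boundary with Levi distribution $H(M)=\ker\theta$, an integrable complex structure $J$ on $H(M)$ ($[X,Y]-[JX,JY]\in\Gamma(H(M))$ and $[JX,Y]+[X,JY]=J([X,Y]-[JX,JY])$ for $X,Y\in\Gamma(H(M))$) and positive definite Levi form $G_\theta(X,Y)=-d\theta(JX,Y)$. Let $\xi$ be the Reeb field ($\theta(\xi)=1$, $d\theta(\xi,\cdot)=0$), $\nabla$ the Tanaka–Webster connection, $\Delta_b u=\operatorname{trace}_{G_\theta}\nabla du$ the sub-Laplacian, $|\nabla^Hu|^2=\sum_a (X_au)^2$ for a $G_\theta$-orthonormal frame $(X_a)_{a\le 2n}$ of $H(M)$, and $\vartheta_\theta=\frac1{2^n n!}\theta\wedge(d\theta)^n$ the volume form. Let $f:M\to\mathbb R^m$ be a $C^2$ semi-isometric map, i.e. $|df(X)|=|X|_{G_\theta}$ and $\langle df(X),df(\xi)\rangle=0$ for all $X\in H(M)$, and let $H_b(f)=\operatorname{trace}_{G_\theta}\beta_f$, with $\beta_f(X,Y)=X\cdot df(Y)-df(\nabla_XY)$,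 be its Levi tension. Let $\Omega\subset M$ be a relatively compact open set ($\Omega=M$ is allowed if $M$ is compact) and $V\in L^1_{loc}(\Omega)$ real valued. Consider $-\Delta_b+V$ in $\Omega$ with Dirichlet boundary conditions if $\Omega\ne M$, i.e. with form domain the closure of $C^2_c(\Omega)$ in the norm $\left(\int_\Omega (u^2+|\nabla^Hu|^2+|V|u^2)\,\vartheta_\theta\right)^{1/2}$. Assume that its spectrum is discrete and bounded from below; let $\lambda_1\le\lambda_2\le\cdots\to\infty$ be its eigenvalues and $\{u_j\}_{j\ge1}$ a complete orthonormal family in $L^2(\Omega,\vartheta_\theta)$ of eigenfunctions in the form domain, with $(-\Delta_b+V)u_j=\lambda_ju_j$ weakly. Then $$D_i=\int_\Omega\left(|H_b(f)|^2_{\mathbb R^m}-4V\right)u_i^2\,\vartheta_\theta$$ is well defined (the integrand is integrable) for every $i$ and, for every $k\ge1$ and $p\in\mathbb R$, $$\sum_{i}(\lambda_{k+1}-\lambda_i)^p\le\frac{\max\{2,p\}}{n}\sum_{i}(\lambda_{k+1}-\lambda_i)^{p-1}\left(\lambda_i+\tfrac14D_i\right),$$ where both sums run over the $i\le k$ with $\lambda_i<\lambda_{k+1}$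 (thus over all $i\le k$ if $\lambda_k<\lambda_{k+1}$; if $p>1$, the omitted terms vanish). Moreover, if $V$ is bounded below on $\Omega$, then $D_\infty=\sup_\Omega\left(|H_b(f)|^2_{\mathbb R^m}-4V\right)$ is finite and, for every $k\ge1$, $$\lambda_{k+1}\le\left(1+\frac2n\right)\frac1k\sum_{i=1}^k\lambda_i+\frac1{2n}D_\infty$$ and $$\lambda_{k+1}\le\left(1+\frac2n\right)k^{1/n}\lambda_1+\frac14\left(\left(1+\frac2n\right)k^{1/n}-1\right)D_\infty.$$ -/

import Mathlib

open scoped Manifold ContDiff Topology ENNReal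
open MeasureTheory Filter

noncomputable section

/-- The model space `ℝ^{2n+1}` of a real `(2n+1)`-dimensional manifold. -/
abbrev CRModel (n : ℕ) : Type := EuclideanSpace ℝ (Fin (2 * n + 1))

section Manifold

variable {n : ℕ} {M : Type*} [TopologicalSpace M] [ChartedSpace (CRModel n) M]
  [IsManifold 𝓘(ℝ, CRModel n) ∞ M]

/-- The tangent space `T_x M`. -/
abbrev CRTangent (n : ℕ) {M : Type*} [TopologicalSpace M] [ChartedSpace (CRModel n) M]
    (x : M) : Type := TangentSpace 𝓘(ℝ, CRModel n) x

/-- A smooth vector field on `M`. -/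
def IsSmoothField (X : (x : M) → CRTangent n x) : Prop :=
  ContMDiff 𝓘(ℝ, CRModel n) 𝓘(ℝ, CRModel n).tangent ∞
    (fun x ↦ (⟨x, X x⟩ : TangentBundle 𝓘(ℝ, CRModel n) M))

/-- The differential `df_x : T_x M → F` of a map with values in a normed space. -/
abbrev diffl {F : Type*} [NormedAddCommGroup F] [NormedSpace ℝ F] (f : M → F) (x : M) :
    CRTangent n x →L[ℝ] F :=
  mvfderiv 𝓘(ℝ, CRModel n) f x

/-- The Lie bracket `[X, Y]` of two vector fields. -/
abbrev bracket (X Y : (x : M) → CRTangent n x) : (x : M) → CRTangent n x :=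
  VectorField.mlieBracket 𝓘(ℝ, CRModel n) X Y

/-- A vector field with value `v` at `x`, smooth near `x` (constant in the preferred
trivialization of `TM` at `x`). Used to evaluate tensors, for which the choice is irrelevant. -/
abbrev extendVec {x : M} (v : CRTangent n x) : (y : M) → CRTangent n y :=
  FiberBundle.extend (CRModel n) v

/-- The exterior derivative of a 1-form at a point,
`dθ(X, Y) = X(θ(Y)) - Y(θ(X)) - θ([X, Y])`. -/
def extDerivOneForm (θ : (x : M) → CRTangent n x →L[ℝ] ℝ) (x : M) (v w : CRTangent n x) : ℝ :=
  diffl (fun y ↦ θ y (extendVec w y)) x v - diffl (fun y ↦ θ y (extendVec v y)) x w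
    - θ x (bracket (extendVec v) (extendVec w) x)

end Manifold

/-- A strictly pseudoconvex CR structure of CR dimension `n` on a manifold `M` of real dimension
`2n+1`, together with a compatible pseudo-Hermitian structure `θ` with positive definite Levi form.
The Levi distribution is `H = ker θ`. Only the restriction of `J` to `H` is meaningful: `J` is any
smooth field of endomorphisms of `TM` extending the complex structure of `H`. -/
structure StrictlyPseudoconvexCR (n : ℕ) (M : Type*) [TopologicalSpace M]
    [ChartedSpace (CRModel n) M] [IsManifold 𝓘(ℝ, CRModel n) ∞ M] where
  /-- the contact form -/
  θ : (x : M) → CRTangent n x →L[ℝ] ℝ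
  /-- the complex structure of the Levi distribution -/
  J : (x : M) → CRTangent n x →L[ℝ] CRTangent n x
  smooth_θ : ContMDiff 𝓘(ℝ, CRModel n)
    (𝓘(ℝ, CRModel n).prod 𝓘(ℝ, CRModel n →L[ℝ] ℝ)) ∞
    (fun x ↦ (⟨x, θ x⟩ : Bundle.TotalSpace (CRModel n →L[ℝ] ℝ)
      (fun x : M ↦ CRTangent n x →L[ℝ] Bundle.Trivial M ℝ x)))
  smooth_J : ContMDiff 𝓘(ℝ, CRModel n)
    (𝓘(ℝ, CRModel n).prod 𝓘(ℝ, CRModel n →L[ℝ] CRModel n)) ∞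
    (fun x ↦ (⟨x, J x⟩ : Bundle.TotalSpace (CRModel n →L[ℝ] CRModel n)
      (fun x : M ↦ CRTangent n x →L[ℝ] CRTangent n x)))
  θ_ne_zero : ∀ x, θ x ≠ 0
  J_horizontal : ∀ x v, θ x v = 0 → θ x (J x v) = 0
  J_sq : ∀ x v, θ x v = 0 → J x (J x v) = -v
  /-- `[X, Y] - [JX, JY]` is horizontal -/
  integrable_horizontal : ∀ X Y : (x : M) → CRTangent n x, IsSmoothField X → IsSmoothField Y →
    (∀ x, θ x (X x) = 0) → (∀ x, θ x (Y x) = 0) → ∀ x,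
      θ x (bracket X Y x - bracket (fun y ↦ J y (X y)) (fun y ↦ J y (Y y)) x) = 0
  /-- `[JX, Y] + [X, JY] = J([X, Y] - [JX, JY])` -/
  integrable_J : ∀ X Y : (x : M) → CRTangent n x, IsSmoothField X → IsSmoothField Y →
    (∀ x, θ x (X x) = 0) → (∀ x, θ x (Y x) = 0) → ∀ x,
      bracket (fun y ↦ J y (X y)) Y x + bracket X (fun y ↦ J y (Y y)) x
        = J x (bracket X Y x - bracket (fun y ↦ J y (X y)) (fun y ↦ J y (Y y)) x)
  /-- the Levi form `-dθ(J·,·)` is positive definite on `H` -/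
  levi_pos : ∀ x v, θ x v = 0 → v ≠ 0 → 0 < -extDerivOneForm θ x (J x v) v

namespace StrictlyPseudoconvexCR

variable {n : ℕ} {M : Type*} [TopologicalSpace M] [ChartedSpace (CRModel n) M]
  [IsManifold 𝓘(ℝ, CRModel n) ∞ M] (S : StrictlyPseudoconvexCR n M)

/-- The exterior derivative `dθ`. -/
def dθ (x : M) (v w : CRTangent n x) : ℝ := extDerivOneForm S.θ x v w

/-- The Levi form `G_θ(v, w) = -dθ(Jv, w)` (for horizontal `v`, `w`). -/
def levi (x : M) (v w : CRTangent n x) : ℝ := -S.dθ x (S.J x v) w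

/-- The Reeb vector field: the unique `ξ` with `θ(ξ) = 1` and `dθ(ξ, ·) = 0`. -/
def reeb (x : M) : CRTangent n x :=
  Classical.epsilon fun v ↦ S.θ x v = 1 ∧ ∀ w, S.dθ x v w = 0

/-- The projection `v ↦ v^H` onto `H` in the decomposition `TM = H ⊕ ℝξ`. -/
def horiz (x : M) (v : CRTangent n x) : CRTangent n x := v - S.θ x v • S.reeb x

/-- The Webster metric `g_θ(v, w) = G_θ(v^H, w^H) + θ(v) θ(w)`. -/
def webster (x : M) (v w : CRTangent n x) : ℝ :=
  S.levi x (S.horiz x v) (S.horiz x w) + S.θ x v * S.θ x w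

/-- The right-hand side of Koszul's formula for `g_θ(∇_X Y, Z)`. -/
def koszul (X Y Z : (x : M) → CRTangent n x) (x : M) : ℝ :=
  (1 / 2) * (diffl (fun y ↦ S.webster y (Y y) (Z y)) x (X x)
    + diffl (fun y ↦ S.webster y (X y) (Z y)) x (Y x)
    - diffl (fun y ↦ S.webster y (X y) (Y y)) x (Z x)
    + S.webster x (bracket X Y x) (Z x)
    - S.webster x (bracket X Z x) (Y x)
    - S.webster x (bracket Y Z x) (X x))

/-- The Levi-Civita connection of the Webster metric: `leviCivita Y x v` is the value at `x` of the
covariant derivative of the field `Y` in the direction `v ∈ T_x M`, i.e. the unique vector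
determined by Koszul's formula. -/
def leviCivita (Y : (x : M) → CRTangent n x) (x : M) (v : CRTangent n x) : CRTangent n x :=
  Classical.epsilon fun a ↦ ∀ z, S.webster x a z = S.koszul (extendVec v) Y (extendVec z) x

/-- The Tanaka-Webster connection `∇_v Y`. With `D` the Levi-Civita connection of the Webster
metric, it is the affine connection with
`∇_X Y = (D_X Y)^H` and `∇_ξ Y = D_ξ Y - (1/2) J Y` for `X`, `Y` horizontal, and `∇ξ = 0`; that is,
the unique affine connection for which `θ`, `dθ` and `J` are parallel and whose torsion satisfies
`T(X, Y) = -θ([X, Y]) ξ` and `T(ξ, JX) = -J T(ξ, X) ∈ H` for horizontal `X`, `Y`. -/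
def tanakaWebster (Y : (x : M) → CRTangent n x) (x : M) (v : CRTangent n x) : CRTangent n x :=
  let Yh : (y : M) → CRTangent n y := fun y ↦ S.horiz y (Y y)
  S.horiz x (S.leviCivita Yh x (S.horiz x v))
    + S.θ x v • (S.leviCivita Yh x (S.reeb x) - (1 / 2 : ℝ) • S.J x (Yh x))
    + diffl (fun y ↦ S.θ y (Y y)) x v • S.reeb x

/-- A `G_θ`-orthonormal basis of `H_x`. -/
def frame (x : M) : Fin (2 * n) → CRTangent n x :=
  Classical.epsilon fun e ↦ (∀ i, S.θ x (e i) = 0) ∧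
    ∀ i j, S.levi x (e i) (e j) = if i = j then 1 else 0

section Maps

variable {F : Type*} [NormedAddCommGroup F] [NormedSpace ℝ F]

/-- The form `β_f(X, Y) = X·(df(Y)) - df(∇_X Y)` of a map `f` into a Euclidean (normed) space,
where `∇` is the Tanaka-Webster connection; for a function `u` this is `∇du`. -/
def beta (f : M → F) (x : M) (v w : CRTangent n x) : F :=
  diffl (fun y ↦ diffl f y (extendVec w y)) x v - diffl f x (S.tanakaWebster (extendVec w) x v)

/-- The Levi tension `H_b(f) = trace_{G_θ} β_f`. -/
def tension (f : M → F) (x : M) : F := ∑ i, S.beta f x (S.frame x i) (S.frame x i)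

end Maps

/-- The sub-Laplacian `Δ_b u = trace_{G_θ} ∇du`. -/
def subLaplacian (u : M → ℝ) (x : M) : ℝ := S.tension u x

/-- `|∇^H u|²`, the squared `G_θ`-length of the horizontal gradient, i.e. the sum of the
squares of the derivatives of `u` along an orthonormal basis of `H`. -/
def gradSq (u : M → ℝ) (x : M) : ℝ := ∑ i, (diffl u x (S.frame x i)) ^ 2

/-- A map `f` into `ℝ^m` is semi-isometric if `|df(X)| = |X|_{G_θ}` and `⟨df(X), df(ξ)⟩ = 0` for
every horizontal `X`. -/
def IsSemiIsometric {m : ℕ} (f : M → EuclideanSpace ℝ (Fin m)) : Prop :=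
  ∀ (x : M) (v : CRTangent n x), S.θ x v = 0 →
    ‖diffl f x v‖ = √(S.levi x v v) ∧ inner ℝ (diffl f x v) (diffl f x (S.reeb x)) = 0

/-- The volume form `ϑ_θ = (1 / (2^n n!)) θ ∧ (dθ)^n` evaluated on `2n+1` tangent vectors, with
`(θ ∧ (dθ)^n)(v_0, …, v_{2n}) = 2^{-n} ∑_σ sgn(σ) θ(v_{σ 0}) ∏_i dθ(v_{σ(2i+1)}, v_{σ(2i+2)})`. -/
def volForm (x : M) (v : Fin (2 * n + 1) → CRTangent n x) : ℝ :=
  (1 / (2 ^ n * (n.factorial : ℝ))) * ((1 / 2 ^ n) *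
    ∑ σ : Equiv.Perm (Fin (2 * n + 1)), ((Equiv.Perm.sign σ : ℤ) : ℝ) *
      (S.θ x (v (σ 0)) *
        ∏ i : Fin n, S.dθ x (v (σ ⟨2 * i.1 + 1, by omega⟩)) (v (σ ⟨2 * i.1 + 2, by omega⟩))))

/-- The density of `ϑ_θ` in the chart `e` with respect to Lebesgue measure: the absolute value of
`ϑ_θ` on the coordinate vector fields. -/
def volDensity (e : OpenPartialHomeomorph M (CRModel n)) (y : CRModel n) : ℝ :=
  |S.volForm (e.symm y) fun i ↦
    (mfderiv 𝓘(ℝ, CRModel n) 𝓘(ℝ, CRModel n) e.symm y)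
      ((EuclideanSpace.basisFun (Fin (2 * n + 1)) ℝ) i)|

variable [MeasurableSpace M]

/-- The measure of the volume form on the domain of the chart `e` (zero elsewhere). -/
def chartVol (e : OpenPartialHomeomorph M (CRModel n)) : Measure M :=
  ((volume.restrict e.target).withDensity
    (fun y ↦ ENNReal.ofReal (S.volDensity e y))).map e.symm

/-- The measure on `M` of the volume form `ϑ_θ`: the least measure dominating the chart measures
(which agree on overlaps), that is, the measure restricting to `chartVol e` on each chart `e`. -/
def vol : Measure M := ⨆ e ∈ atlas (CRModel n) M, S.chartVol e

/-- Test functions on the open set `Ω`: `C²` functions with compact support in `Ω`. -/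
def IsTestFunction (n : ℕ) {M : Type*} [TopologicalSpace M] [ChartedSpace (CRModel n) M]
    (Ω : Set M) (φ : M → ℝ) : Prop :=
  ContMDiff 𝓘(ℝ, CRModel n) 𝓘(ℝ, ℝ) 2 φ ∧ HasCompactSupport φ ∧ tsupport φ ⊆ Ω

/-- The form domain of `-Δ_b + V` in `Ω` with Dirichlet boundary conditions: the closure of the
test functions with respect to the norm
`(∫_Ω u² + ∫_Ω |∇^H u|² + ∫_Ω |V| u²)^{1/2}`, realized in `L²(Ω)`. If `Ω = M` is compact, every
`C²` function is a test function and there is no boundary condition. -/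
def MemFormDomain (Ω : Set M) (V : M → ℝ) (u : M → ℝ) : Prop :=
  ∃ φ : ℕ → M → ℝ, (∀ k, IsTestFunction n Ω (φ k)) ∧
    Tendsto (fun k ↦ ∫⁻ x in Ω, ENNReal.ofReal ((φ k x - u x) ^ 2) ∂S.vol) atTop (𝓝 0) ∧
    Tendsto (fun k ↦ ∫⁻ x in Ω, ENNReal.ofReal (|V x| * (φ k x - u x) ^ 2) ∂S.vol)
      atTop (𝓝 0) ∧
    Tendsto (fun q : ℕ × ℕ ↦ ∫⁻ x in Ω, ENNReal.ofReal (S.gradSq (φ q.1 - φ q.2) x) ∂S.vol)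
      atTop (𝓝 0)

/-- `u` is an eigenfunction (or zero) of `-Δ_b + V` in `Ω`, with Dirichlet boundary conditions, for
the eigenvalue `l`: it lies in the form domain and satisfies `-Δ_b u + V u = l u` weakly. -/
def IsDirichletSolution (Ω : Set M) (V : M → ℝ) (l : ℝ) (u : M → ℝ) : Prop :=
  S.MemFormDomain Ω V u ∧
    ∀ φ : M → ℝ, IsTestFunction n Ω φ →
      ∫ x in Ω, u x * (-S.subLaplacian φ x + V x * φ x) ∂S.vol = l * ∫ x in Ω, u x * φ x ∂S.vol

/-- The spectrum of `-Δ_b + V` in `Ω` (with Dirichlet boundary conditions) is discrete and bounded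
from below, `lam 0 ≤ lam 1 ≤ …` is the nondecreasing sequence of its eigenvalues and
`u 0, u 1, …` is a complete orthonormal family of corresponding eigenfunctions in
`L²(Ω, ϑ_θ)`. -/
structure IsDirichletSpectrum (Ω : Set M) (V : M → ℝ) (lam : ℕ → ℝ)
    (u : HilbertBasis ℕ ℝ (Lp ℝ 2 (S.vol.restrict Ω))) : Prop where
  mono : Monotone lam
  discrete : Tendsto lam atTop atTop
  eigen : ∀ j, S.IsDirichletSolution Ω V (lam j) (u j : M → ℝ)

end StrictlyPseudoconvexCR

end

/-!
# Eigenvalue inequalities for the sub-Laplacian through semi-isometric maps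

Write `L = -Δ_b + V` and let `f β` be the components of a semi-isometric map `f` into a Euclidean
space. The eigenvalue inequalities come from the commutators of `L` with the multiplications by
the functions `f β`, namely `[L, f β] u = -(u Δ_b f β + 2 ⟨∇^H f β, ∇^H u⟩)`.

For an orthonormal basis of eigenfunctions `u j`, the coefficients of `[L, f β] u_i` are
`(λ_j - λ_i) ⟨f β u_i, u_j⟩`. By Parseval's identity, both `⟨[L, f β] u_i, f β u_i⟩` and
`‖[L, f β] u_i‖ ^ 2` are sums over `j` of powers of `λ_j - λ_i` times `⟨f β u_i, u_j⟩ ^ 2`.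
Weighting with powers of `λ_{k+1} - λ_i`, the terms with `λ_j ≥ λ_{k+1}` are estimated one by one,
and the others are symmetrized in `i` and `j`; what remains is an inequality between powers of two
positive numbers (`rpow_sub_rpow_mul_sub_le`), which produces the constant `max {2, p}`. This is
`sum_rpow_mul_inner_le`.

The geometry enters when these quantities are summed over `β`.

* As `df` is isometric on the Levi distribution, `∑ |∇^H f β| ^ 2 = 2n`
  (`sum_carre_component_self`), whence `∑ ⟨[L, f β] u_i, f β u_i⟩ = 2n`; also
  `∑ ⟨∇^H f β, ∇^H u⟩ ^ 2 = |∇^H u| ^ 2` (`sum_carre_component_mul`).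
* The Levi tension is orthogonal to the image of the Levi distribution (`inner_tension_diffl`).
  Indeed the metric induced by `f` and the Webster metric differ by a multiple of `θ ⊗ θ`, which
  vanishes to second order on directions horizontal at the given point, so that the Koszul formula
  for the Tanaka-Webster connection is that of the induced metric. The cross terms in
  `∑ ‖[L, f β] u_i‖ ^ 2` therefore cancel, and the sum is `4 λ_i + D_i`
  (`FormApprox.sum_integral_commutatorField_sq`).

The analysis rests on one integration by parts, `integral_carre_add`. In a chart, the volume form is
a constant multiple of the Riemannian density of the Webster metric (`volDensity_eq`), and `Δ_b u`
is the divergence of the horizontal gradient for this density (`divergence_coordGrad`): the only term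
which is not of Riemannian type involves derivatives of `θ` along the Reeb field, and it cancels
because `dθ(ξ, ·) = 0`. The expression of `Δ_b` in an arbitrary chart is `exists_coordFrame`.
Eigenfunctions lie only in the form domain, and the horizontal gradient of such a function `u` is
handled through the `L²` limits of `⟨∇^H f β, ∇^H φ_k⟩`, where the test functions `φ_k` converge to
`u` in the form norm (`FormApprox`).

When `V` is bounded below, `D_i ≤ D_∞`. The first bound is the case `p = 1`. For `p = 2` the numbers
`λ_i + D_∞ / 4` satisfy the quadratic inequality of Yang, for which the Riesz mean
`∑ (z - λ_i) ^ 2` grows at least like `z ^ (n + 2)` (`riesz_mul_pow_le`); together with the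
Cauchy-Schwarz inequality this gives the second bound (`le_rpow_mul_of_pos`).
-/

open scoped Manifold ContDiff Topology ENNReal
open MeasureTheory Filter

noncomputable section

set_option linter.unusedSectionVars false

/-! ### Coordinate fields of a chart -/

section ChartCalculus

variable {n : ℕ} {M : Type*} [TopologicalSpace M] [ChartedSpace (CRModel n) M]
  [IsManifold 𝓘(ℝ, CRModel n) ∞ M]

/-- The differential at `y` of the inverse of the chart `e`, which sends a vector of the model
space to the value at `e.symm y` of the corresponding coordinate field. -/
def chartDeriv (e : OpenPartialHomeomorph M (CRModel n)) (y : CRModel n) :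
    CRModel n →L[ℝ] CRTangent n (e.symm y) :=
  mfderiv 𝓘(ℝ, CRModel n) 𝓘(ℝ, CRModel n) e.symm y

/-- The coordinate expression, in the chart `e`, of a vector field. -/
def fieldRep (e : OpenPartialHomeomorph M (CRModel n)) (X : (x : M) → CRTangent n x)
    (y : CRModel n) : CRModel n :=
  (mfderiv 𝓘(ℝ, CRModel n) 𝓘(ℝ, CRModel n) e (e.symm y)) (X (e.symm y))

variable {e : OpenPartialHomeomorph M (CRModel n)} (he : e ∈ atlas (CRModel n) M)
include he

lemma mdifferentiable_of_mem_atlas_smooth : e.MDifferentiable 𝓘(ℝ, CRModel n) 𝓘(ℝ, CRModel n) :=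
  have : IsManifold 𝓘(ℝ, CRModel n) 1 M := .of_le (n := ∞) (by simp)
  mdifferentiable_of_mem_atlas he

lemma chartDeriv_mfderiv {y : CRModel n} (hy : y ∈ e.target) (v : CRTangent n (e.symm y)) :
    chartDeriv e y ((mfderiv 𝓘(ℝ, CRModel n) 𝓘(ℝ, CRModel n) e (e.symm y)) v) = v := by
  have h := (mdifferentiable_of_mem_atlas_smooth he).symm_comp_deriv (e.map_target hy)
  rw [e.right_inv hy] at h
  exact congrArg (fun L : CRTangent n (e.symm y) →L[ℝ] CRTangent n (e.symm y) ↦ L v) h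

lemma mfderiv_chartDeriv {y : CRModel n} (hy : y ∈ e.target) (v : CRModel n) :
    (mfderiv 𝓘(ℝ, CRModel n) 𝓘(ℝ, CRModel n) e (e.symm y)) (chartDeriv e y v) = v := by
  have h := (mdifferentiable_of_mem_atlas_smooth he).comp_symm_deriv hy
  exact congrArg (fun L : CRModel n →L[ℝ] CRModel n ↦ L v) h

lemma chartDeriv_injective {y : CRModel n} (hy : y ∈ e.target) :
    Function.Injective (chartDeriv e y) :=
  Function.LeftInverse.injective
    (g := fun v ↦ (mfderiv 𝓘(ℝ, CRModel n) 𝓘(ℝ, CRModel n) e (e.symm y)) v)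
    (mfderiv_chartDeriv he hy)

lemma chartDeriv_surjective {y : CRModel n} (hy : y ∈ e.target) :
    Function.Surjective (chartDeriv e y) :=
  fun v ↦ ⟨_, chartDeriv_mfderiv he hy v⟩

lemma chartDeriv_fieldRep {y : CRModel n} (hy : y ∈ e.target) (X : (x : M) → CRTangent n x) :
    chartDeriv e y (fieldRep e X y) = X (e.symm y) :=
  chartDeriv_mfderiv he hy _

lemma contMDiffOn_symm_atlas : ContMDiffOn 𝓘(ℝ, CRModel n) 𝓘(ℝ, CRModel n) ∞ e.symm e.target :=
  contMDiffOn_symm_of_mem_maximalAtlas (IsManifold.subset_maximalAtlas he)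

lemma contMDiffOn_atlas : ContMDiffOn 𝓘(ℝ, CRModel n) 𝓘(ℝ, CRModel n) ∞ e e.source :=
  contMDiffOn_of_mem_maximalAtlas (IsManifold.subset_maximalAtlas he)

lemma fderiv_comp_symm {F : Type*} [NormedAddCommGroup F] [NormedSpace ℝ F] {f : M → F}
    {y : CRModel n} (hy : y ∈ e.target)
    (hf : MDifferentiableAt 𝓘(ℝ, CRModel n) 𝓘(ℝ, F) f (e.symm y)) (v : CRModel n) :
    fderiv ℝ (f ∘ e.symm) y v = diffl f (e.symm y) (chartDeriv e y v) := by
  have h := mfderiv_comp_apply (I := 𝓘(ℝ, CRModel n)) (I' := 𝓘(ℝ, CRModel n)) y hf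
    ((mdifferentiable_of_mem_atlas_smooth he).mdifferentiableAt_symm hy) v
  rw [mfderiv_eq_fderiv] at h
  exact h

lemma contDiffOn_comp_symm {F : Type*} [NormedAddCommGroup F] [NormedSpace ℝ F] {f : M → F}
    {k : ℕ∞} (hf : ContMDiff 𝓘(ℝ, CRModel n) 𝓘(ℝ, F) k f) :
    ContDiffOn ℝ k (f ∘ e.symm) e.target := by
  rw [← contMDiffOn_iff_contDiffOn]
  exact hf.comp_contMDiffOn ((contMDiffOn_symm_atlas he).of_le (by exact_mod_cast le_top))

/-- The coordinate fields of a chart are smooth. -/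
lemma contMDiffOn_chartDeriv (v : CRModel n → CRModel n) (hv : ContDiffOn ℝ ∞ v e.target) :
    ContMDiffOn 𝓘(ℝ, CRModel n) 𝓘(ℝ, CRModel n).tangent ∞
      (fun y ↦ (⟨e.symm y, chartDeriv e y (v y)⟩ : TangentBundle 𝓘(ℝ, CRModel n) M)) e.target := by
  have : IsManifold 𝓘(ℝ, CRModel n) 1 M := .of_le (n := ∞) (by simp)
  have h := (contMDiffOn_symm_atlas he).contMDiffOn_tangentMapWithin (m := ∞) (by simp)
    e.open_target.uniqueMDiffOn
  have hV : ContMDiffOn 𝓘(ℝ, CRModel n) 𝓘(ℝ, CRModel n).tangent ∞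
      (fun y ↦ (⟨y, v y⟩ : TangentBundle 𝓘(ℝ, CRModel n) (CRModel n))) e.target :=
    contMDiffOn_vectorSpace_iff_contDiffOn.2 hv
  refine (h.comp hV (fun y hy ↦ hy)).congr fun y hy ↦ ?_
  simp only [Function.comp, tangentMapWithin, chartDeriv]
  rw [mfderivWithin_of_isOpen e.open_target hy]
  rfl

/-- The coordinate expression of a smooth field is smooth. -/
lemma contDiffOn_mfderiv (X : (y : CRModel n) → CRTangent n (e.symm y))
    (hX : ContMDiffOn 𝓘(ℝ, CRModel n) 𝓘(ℝ, CRModel n).tangent ∞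
      (fun y ↦ (⟨e.symm y, X y⟩ : TangentBundle 𝓘(ℝ, CRModel n) M)) e.target) :
    ContDiffOn ℝ ∞ (fun y ↦ ((mfderiv 𝓘(ℝ, CRModel n) 𝓘(ℝ, CRModel n) e (e.symm y)) (X y) :
      CRModel n)) e.target := by
  have : IsManifold 𝓘(ℝ, CRModel n) 1 M := .of_le (n := ∞) (by simp)
  have h := (contMDiffOn_atlas he).contMDiffOn_tangentMapWithin (m := ∞) (by simp)
    e.open_source.uniqueMDiffOn
  have h2 := (contMDiff_snd_tangentBundle_modelSpace (n := ∞) (CRModel n)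
    𝓘(ℝ, CRModel n)).comp_contMDiffOn (h.comp hX (fun y hy ↦ e.map_target hy))
  refine contMDiffOn_iff_contDiffOn.1 (h2.congr fun y hy ↦ ?_)
  simp only [Function.comp, tangentMapWithin]
  rw [mfderivWithin_of_isOpen e.open_source (e.map_target hy)]

omit he

lemma symm_chartAt_self (p : M) : (chartAt (CRModel n) p).symm (chartAt (CRModel n) p p) = p :=
  (chartAt (CRModel n) p).left_inv (mem_chart_source _ p)

lemma chartAt_self_mem_target (p : M) :
    chartAt (CRModel n) p p ∈ (chartAt (CRModel n) p).target := mem_chart_target _ p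

/-- The identification of the tangent space at `p` with the model space (through the preferred
chart at `p`), on which the tangent spaces of Mathlib are built. -/
def tangentCoord (p : M) : CRTangent n p ≃L[ℝ] CRModel n := ContinuousLinearEquiv.refl ℝ (CRModel n)

lemma tangentCoord_chartDeriv_self (p : M) (v : CRModel n) :
    tangentCoord _ (chartDeriv (chartAt (CRModel n) p) (chartAt (CRModel n) p p) v) = v := by
  have : IsManifold 𝓘(ℝ, CRModel n) 1 M := .of_le (n := ∞) (by simp)
  have h := mfderivWithin_range_extChartAt_symm (I := 𝓘(ℝ, CRModel n)) (x := p)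
  simp only [mfld_simps, mfderivWithin_univ] at h
  exact congrArg (fun L : CRModel n →L[ℝ] CRModel n ↦ L v) h

/-- In the preferred chart at `p`, the field `extendVec v` is constant. -/
lemma extendVec_chartAt {p : M} (v : CRTangent n p) {y : CRModel n}
    (hy : y ∈ (chartAt (CRModel n) p).target) :
    extendVec v ((chartAt (CRModel n) p).symm y)
      = chartDeriv (chartAt (CRModel n) p) y (tangentCoord p v) := by
  have : IsManifold 𝓘(ℝ, CRModel n) 1 M := .of_le (n := ∞) (by simp)
  have hx : (chartAt (CRModel n) p).symm y ∈ (chartAt (CRModel n) p).source :=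
    (chartAt (CRModel n) p).map_target hy
  have h := TangentBundle.symmL_trivializationAt (I := 𝓘(ℝ, CRModel n)) (x₀ := p) hx
  have hv : ((trivializationAt (CRModel n) (TangentSpace 𝓘(ℝ, CRModel n) (M := M)) p)
      ⟨p, v⟩).2 = tangentCoord p v := by
    have h1 := TangentBundle.continuousLinearMapAt_trivializationAt (I := 𝓘(ℝ, CRModel n))
      (x₀ := p) (x := p) (mem_chart_source _ p)
    rw [mfderiv_extChartAt_self] at h1
    have h2 := congrArg (fun L : CRModel n →L[ℝ] CRModel n ↦ L v) h1
    have h3 := congrFun (Bundle.Trivialization.continuousLinearMapAt_apply ℝ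
      (trivializationAt (CRModel n) (TangentSpace 𝓘(ℝ, CRModel n) (M := M)) p) p) v
    rw [Bundle.Trivialization.coe_linearMapAt_of_mem _
      (FiberBundle.mem_baseSet_trivializationAt' p)] at h3
    exact h3.symm.trans h2
  have h4 := congrArg (fun L : CRModel n →L[ℝ] CRTangent n ((chartAt (CRModel n) p).symm y) ↦
    L (tangentCoord p v)) h
  have h5 : chartDeriv (chartAt (CRModel n) p) y (tangentCoord p v)
      = mfderivWithin 𝓘(ℝ, CRModel n) 𝓘(ℝ, CRModel n) (extChartAt 𝓘(ℝ, CRModel n) p).symm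
        (Set.range 𝓘(ℝ, CRModel n)) y (tangentCoord p v) := by
    simp only [mfld_simps, mfderivWithin_univ]
    rfl
  have h6 : (extChartAt 𝓘(ℝ, CRModel n) p) ((chartAt (CRModel n) p).symm y) = y := by
    simp [(chartAt (CRModel n) p).right_inv hy]
  rw [h6] at h4
  refine Eq.trans ?_ (h4.trans h5.symm)
  refine (congrArg ((trivializationAt (CRModel n) (TangentSpace 𝓘(ℝ, CRModel n) (M := M)) p).symm
    ((chartAt (CRModel n) p).symm y)) hv).trans ?_
  exact (Bundle.Trivialization.symmL_apply (R := ℝ) _ (by simpa using hx) _).symm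

lemma eventually_mem_target (p : M) :
    ∀ᶠ y in 𝓝 (chartAt (CRModel n) p p), y ∈ (chartAt (CRModel n) p).target :=
  (chartAt (CRModel n) p).open_target.mem_nhds (chartAt_self_mem_target p)

lemma extendVec_self {p : M} (v : CRTangent n p) : extendVec v p = v :=
  FiberBundle.extend_apply_self _ v

lemma fieldRep_extendVec {p : M} (v : CRTangent n p) {y : CRModel n}
    (hy : y ∈ (chartAt (CRModel n) p).target) :
    fieldRep (chartAt (CRModel n) p) (extendVec v) y = tangentCoord p v := by
  unfold fieldRep
  rw [extendVec_chartAt v hy]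
  exact mfderiv_chartDeriv (chart_mem_atlas _ p) hy _

lemma tangentCoord_congr (X : (x : M) → CRTangent n x) {p q : M} (h : p = q) :
    tangentCoord p (X p) = tangentCoord q (X q) := by
  rw [h]

lemma fieldRep_chartAt_self (p : M) (X : (x : M) → CRTangent n x) :
    fieldRep (chartAt (CRModel n) p) X (chartAt (CRModel n) p p) = tangentCoord p (X p) := by
  have h := chartDeriv_fieldRep (chart_mem_atlas _ p) (chartAt_self_mem_target p) X
  rw [← tangentCoord_congr X (symm_chartAt_self (n := n) p), ← h, tangentCoord_chartDeriv_self]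

/-- The Lie bracket in coordinates. -/
lemma bracket_eq (p : M) (X Y : (x : M) → CRTangent n x) :
    tangentCoord p (bracket X Y p)
      = fderiv ℝ (fieldRep (chartAt (CRModel n) p) Y) (chartAt (CRModel n) p p)
          (tangentCoord p (X p))
        - fderiv ℝ (fieldRep (chartAt (CRModel n) p) X) (chartAt (CRModel n) p p)
          (tangentCoord p (Y p)) := by
  have : IsManifold 𝓘(ℝ, CRModel n) 1 M := .of_le (n := ∞) (by simp)
  have key : ∀ Z : (x : M) → CRTangent n x,
      (VectorField.mpullbackWithin 𝓘(ℝ, CRModel n) 𝓘(ℝ, CRModel n)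
        (extChartAt 𝓘(ℝ, CRModel n) p).symm Z (Set.range 𝓘(ℝ, CRModel n)) : CRModel n → CRModel n)
      =ᶠ[𝓝 (chartAt (CRModel n) p p)] fieldRep (chartAt (CRModel n) p) Z := by
    intro Z
    filter_upwards [eventually_mem_target p] with y hy
    have hy' : y ∈ (extChartAt 𝓘(ℝ, CRModel n) p).target := by simpa using hy
    have hinv := isInvertible_mfderivWithin_extChartAt_symm (I := 𝓘(ℝ, CRModel n)) hy'
    have h := chartDeriv_fieldRep (chart_mem_atlas _ p) hy Z
    have hd : mfderivWithin 𝓘(ℝ, CRModel n) 𝓘(ℝ, CRModel n) (extChartAt 𝓘(ℝ, CRModel n) p).symm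
        (Set.range 𝓘(ℝ, CRModel n)) y = chartDeriv (chartAt (CRModel n) p) y := by
      simp only [mfld_simps, mfderivWithin_univ]
      rfl
    rw [VectorField.mpullbackWithin_apply, hd]
    rw [hd] at hinv
    have : (Z ((extChartAt 𝓘(ℝ, CRModel n) p).symm y)) =
      chartDeriv (chartAt (CRModel n) p) y (fieldRep (chartAt (CRModel n) p) Z y) := h.symm
    rw [this]
    exact hinv.inverse_apply_self _
  have h0 := VectorField.mlieBracketWithin_apply (I := 𝓘(ℝ, CRModel n)) (V := X) (W := Y)
    (s := Set.univ) (x₀ := p)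
  have hp : (extChartAt 𝓘(ℝ, CRModel n) p) p = chartAt (CRModel n) p p := by simp
  have h1 : (mfderiv 𝓘(ℝ, CRModel n) 𝓘(ℝ, CRModel n) (extChartAt 𝓘(ℝ, CRModel n) p) p).inverse
      = (ContinuousLinearMap.id ℝ (CRModel n)) := by
    rw [mfderiv_extChartAt_self]
    exact ContinuousLinearMap.inverse_id
  have h2 := ((key X).lieBracket_vectorField_eq (𝕜 := ℝ) (key Y))
  rw [VectorField.lieBracket, fieldRep_chartAt_self, fieldRep_chartAt_self] at h2
  have h3 : ∀ A B : CRModel n → CRModel n, VectorField.lieBracketWithin ℝ A B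
      ((extChartAt 𝓘(ℝ, CRModel n) p).symm ⁻¹' Set.univ ∩ Set.range 𝓘(ℝ, CRModel n))
        ((extChartAt 𝓘(ℝ, CRModel n) p) p)
      = VectorField.lieBracket ℝ A B (chartAt (CRModel n) p p) := by
    intro A B
    rw [hp, ← VectorField.lieBracketWithin_univ]
    simp
  rw [h1] at h0
  exact h0.trans ((h3 _ _).trans h2)

end ChartCalculus

/-! ### Changes of charts -/

section Transition

variable {n : ℕ} {M : Type*} [TopologicalSpace M] [ChartedSpace (CRModel n) M]
  [IsManifold 𝓘(ℝ, CRModel n) ∞ M]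

variable {e e' : OpenPartialHomeomorph M (CRModel n)} (he : e ∈ atlas (CRModel n) M)
  (he' : e' ∈ atlas (CRModel n) M)
include he he'

lemma contDiffAt_transition {z : CRModel n} (hz : z ∈ e.target) (hz' : e.symm z ∈ e'.source) :
    ContDiffAt ℝ ∞ (e' ∘ e.symm) z := by
  rw [← contMDiffAt_iff_contDiffAt]
  exact ((contMDiffOn_atlas he').contMDiffAt (e'.open_source.mem_nhds hz')).comp z
    ((contMDiffOn_symm_atlas he).contMDiffAt (e.open_target.mem_nhds hz))

/-- Change of charts for any quantity depending on a frame of the tangent space. The dependence on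
the base point is left arbitrary, so that the lemma applies to all tensors at once. -/
lemma chartDeriv_transition {α : Type*} (Φ : (x : M) → (CRModel n →L[ℝ] CRTangent n x) → α)
    {z : CRModel n} (hz : z ∈ e.target) (hz' : e.symm z ∈ e'.source) :
    Φ (e.symm z) (chartDeriv e z)
      = Φ (e'.symm (e' (e.symm z)))
          ((chartDeriv e' (e' (e.symm z))).comp (fderiv ℝ (e' ∘ e.symm) z)) := by
  have hτ : ∀ v : CRModel n, fderiv ℝ (e' ∘ e.symm) z v
      = (mfderiv 𝓘(ℝ, CRModel n) 𝓘(ℝ, CRModel n) e' (e.symm z)) (chartDeriv e z v) := by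
    intro v
    have h := mfderiv_comp_apply (I := 𝓘(ℝ, CRModel n)) (I' := 𝓘(ℝ, CRModel n)) z
      ((mdifferentiable_of_mem_atlas_smooth he').mdifferentiableAt hz')
      ((mdifferentiable_of_mem_atlas_smooth he).mdifferentiableAt_symm hz) v
    rw [mfderiv_eq_fderiv] at h
    exact h
  have hid := (mdifferentiable_of_mem_atlas_smooth he').symm_comp_deriv hz'
  let A : CRModel n →L[ℝ] CRModel n := chartDeriv e z
  let B : CRModel n →L[ℝ] CRModel n :=
    (chartDeriv e' (e' (e.symm z))).comp (fderiv ℝ (e' ∘ e.symm) z)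
  have hAB : A = B := by
    refine ContinuousLinearMap.ext fun v ↦ ?_
    have h1 : B v = chartDeriv e' (e' (e.symm z)) (fderiv ℝ (e' ∘ e.symm) z v) := rfl
    rw [h1, hτ]
    exact (congrArg (fun L : CRTangent n (e.symm z) →L[ℝ] CRTangent n (e.symm z) ↦
      L (chartDeriv e z v)) hid).symm
  let Ψ : M → (CRModel n →L[ℝ] CRModel n) → α := Φ
  change Ψ (e.symm z) A = Ψ (e'.symm (e' (e.symm z))) B
  rw [hAB, e'.left_inv hz']

omit he'

lemma tangentCoord_chartDeriv {z : CRModel n} (hz : z ∈ e.target) (v : CRModel n) :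
    tangentCoord _ (chartDeriv e z v)
      = fderiv ℝ (chartAt (CRModel n) (e.symm z) ∘ e.symm) z v := by
  have h := chartDeriv_transition he (chart_mem_atlas _ (e.symm z))
    (fun x L ↦ tangentCoord x (L v)) hz (mem_chart_source _ _)
  rw [h]
  exact tangentCoord_chartDeriv_self _ _

omit he

lemma diffl_eq_fderiv_chartAt {F : Type*} [NormedAddCommGroup F] [NormedSpace ℝ F] {f : M → F}
    {p : M} (hf : MDifferentiableAt 𝓘(ℝ, CRModel n) 𝓘(ℝ, F) f p) (v : CRTangent n p) :
    diffl f p v = fderiv ℝ (f ∘ (chartAt (CRModel n) p).symm) (chartAt (CRModel n) p p)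
      (tangentCoord p v) := by
  have h := fderiv_comp_symm (chart_mem_atlas _ p) (chartAt_self_mem_target p)
    (by rwa [symm_chartAt_self]) (tangentCoord p v)
  rw [h]
  have : ∀ (q : M) (w : CRTangent n q), q = p → tangentCoord q w = tangentCoord p v →
      diffl f p v = diffl f q w := by
    rintro q w rfl h
    rw [(tangentCoord q).injective h]
  exact this _ _ (symm_chartAt_self p) (tangentCoord_chartDeriv_self p _)

lemma mdifferentiableAt_of_comp_symm {F : Type*} [NormedAddCommGroup F] [NormedSpace ℝ F]
    {f : M → F} {p : M} (hf : DifferentiableAt ℝ (f ∘ (chartAt (CRModel n) p).symm)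
      (chartAt (CRModel n) p p)) : MDifferentiableAt 𝓘(ℝ, CRModel n) 𝓘(ℝ, F) f p := by
  have h1 := (mdifferentiableAt_iff_differentiableAt.2 hf).comp p
    ((mdifferentiable_of_mem_atlas_smooth (chart_mem_atlas _ p)).mdifferentiableAt
      (mem_chart_source _ p))
  refine h1.congr_of_eventuallyEq ?_
  filter_upwards [(chartAt (CRModel n) p).open_source.mem_nhds (mem_chart_source _ p)] with q hq
  simp [Function.comp, (chartAt (CRModel n) p).left_inv hq]

end Transition

lemma two_le_infty : (2 : WithTop ℕ∞) ≤ ((⊤ : ℕ∞) : WithTop ℕ∞) := by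
  exact ENat.LEInfty.out

section PullbackCalculus

variable {E : Type*} [NormedAddCommGroup E] [NormedSpace ℝ E]

/-- Derivative of the pullback of a (vector-valued) 1-form. -/
lemma fderiv_pullback_oneForm {F : Type*} [NormedAddCommGroup F] [NormedSpace ℝ F]
    {θ₁ θ₂ : E → E →L[ℝ] F} {τ : E → E} {y : E}
    (h : ∀ᶠ z in 𝓝 y, θ₁ z = (θ₂ (τ z)).comp (fderiv ℝ τ z))
    (hθ : DifferentiableAt ℝ θ₂ (τ y)) (hτ : ContDiffAt ℝ 2 τ y) (v w : E) :
    fderiv ℝ θ₁ y v w = fderiv ℝ θ₂ (τ y) (fderiv ℝ τ y v) (fderiv ℝ τ y w)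
      + θ₂ (τ y) (fderiv ℝ (fderiv ℝ τ) y v w) := by
  have hτ1 : DifferentiableAt ℝ τ y := hτ.differentiableAt (by simp)
  have hτ2 : DifferentiableAt ℝ (fderiv ℝ τ) y :=
    (hτ.fderiv_right (m := 1) (by norm_num)).differentiableAt (by simp)
  rw [Filter.EventuallyEq.fderiv_eq h]
  have hc : DifferentiableAt ℝ (fun z ↦ θ₂ (τ z)) y := hθ.comp y hτ1
  rw [fderiv_clm_comp hc hτ2]
  have := fderiv_comp y hθ hτ1
  rw [Function.comp_def] at this
  simp [this, add_comm]

/-- Derivative of the pullback of a bilinear form. -/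
lemma fderiv_pullback_bilin {g₁ g₂ : E → E →L[ℝ] E →L[ℝ] ℝ} {τ : E → E} {y : E}
    (h : ∀ᶠ z in 𝓝 y, ∀ v w, g₁ z v w = g₂ (τ z) (fderiv ℝ τ z v) (fderiv ℝ τ z w))
    (hg₁ : DifferentiableAt ℝ g₁ y)
    (hg : DifferentiableAt ℝ g₂ (τ y)) (hτ : ContDiffAt ℝ 2 τ y) (u v w : E) :
    fderiv ℝ g₁ y u v w = fderiv ℝ g₂ (τ y) (fderiv ℝ τ y u) (fderiv ℝ τ y v) (fderiv ℝ τ y w)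
      + g₂ (τ y) (fderiv ℝ (fderiv ℝ τ) y u v) (fderiv ℝ τ y w)
      + g₂ (τ y) (fderiv ℝ τ y v) (fderiv ℝ (fderiv ℝ τ) y u w) := by
  have hτ1 : DifferentiableAt ℝ τ y := hτ.differentiableAt (by simp)
  have hτ2 : DifferentiableAt ℝ (fderiv ℝ τ) y :=
    (hτ.fderiv_right (m := 1) (by norm_num)).differentiableAt (by simp)
  have h1 : HasFDerivAt (fun z ↦ g₁ z v w) (((fderiv ℝ g₁ y).flip v).flip w) y := by
    have := (hg₁.hasFDerivAt.clm_apply (hasFDerivAt_const v y)).clm_apply (hasFDerivAt_const w y)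
    refine this.congr_fderiv ?_
    ext; simp
  have h2 : HasFDerivAt (fun z ↦ g₂ (τ z) (fderiv ℝ τ z v) (fderiv ℝ τ z w)) _ y :=
    ((hg.hasFDerivAt.comp y hτ1.hasFDerivAt).clm_apply
      (hτ2.hasFDerivAt.clm_apply (hasFDerivAt_const v y))).clm_apply
      (hτ2.hasFDerivAt.clm_apply (hasFDerivAt_const w y))
  have h3 := h1.unique (h2.congr_of_eventuallyEq (h.mono fun z hz ↦ hz v w))
  have h4 := congrArg (fun L : E →L[ℝ] ℝ ↦ L u) h3
  simp at h4
  rw [h4]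
  ring

lemma fderiv_clm_apply_const {F : Type*} [NormedAddCommGroup F] [NormedSpace ℝ F]
    {θ : E → E →L[ℝ] F} {y : E} (hθ : DifferentiableAt ℝ θ y) (v w : E) :
    fderiv ℝ (fun z ↦ θ z w) y v = fderiv ℝ θ y v w := by
  rw [fderiv_clm_apply hθ (differentiableAt_const w)]
  simp

end PullbackCalculus

/-! ### The contact form in coordinates -/

namespace StrictlyPseudoconvexCR

variable {n : ℕ} {M : Type*} [TopologicalSpace M] [ChartedSpace (CRModel n) M]
  [IsManifold 𝓘(ℝ, CRModel n) ∞ M] (S : StrictlyPseudoconvexCR n M)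

/-- The contact form in the chart `e`. -/
def coordθ (e : OpenPartialHomeomorph M (CRModel n)) (y : CRModel n) : CRModel n →L[ℝ] ℝ :=
  (S.θ (e.symm y)).comp (chartDeriv e y)

lemma coordθ_apply (e : OpenPartialHomeomorph M (CRModel n)) (y v : CRModel n) :
    S.coordθ e y v = S.θ (e.symm y) (chartDeriv e y v) := rfl

variable {e : OpenPartialHomeomorph M (CRModel n)} (he : e ∈ atlas (CRModel n) M)
include he

lemma contDiffOn_θ_apply (X : (y : CRModel n) → CRTangent n (e.symm y))
    (hX : ContMDiffOn 𝓘(ℝ, CRModel n) 𝓘(ℝ, CRModel n).tangent ∞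
      (fun y ↦ (⟨e.symm y, X y⟩ : TangentBundle 𝓘(ℝ, CRModel n) M)) e.target) :
    ContDiffOn ℝ ∞ (fun y ↦ S.θ (e.symm y) (X y)) e.target := by
  have h1 := S.smooth_θ.comp_contMDiffOn (contMDiffOn_symm_atlas he)
  have h2 := ContMDiffOn.clm_bundle_apply (F₂ := ℝ) (E₂ := Bundle.Trivial M ℝ) (b := e.symm)
    (ϕ := fun y ↦ S.θ (e.symm y)) h1 hX
  intro y hy
  exact contMDiffWithinAt_iff_contDiffWithinAt.1 (Bundle.contMDiffWithinAt_totalSpace.1 (h2 y hy)).2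

lemma contDiffOn_coordθ : ContDiffOn ℝ ∞ (S.coordθ e) e.target := by
  rw [contDiffOn_clm_apply]
  intro v
  exact S.contDiffOn_θ_apply he _ (contMDiffOn_chartDeriv he (fun _ ↦ v) contDiffOn_const)

lemma contDiffAt_coordθ {y : CRModel n} (hy : y ∈ e.target) : ContDiffAt ℝ ∞ (S.coordθ e) y :=
  (S.contDiffOn_coordθ he).contDiffAt (e.open_target.mem_nhds hy)

lemma differentiableAt_coordθ {y : CRModel n} (hy : y ∈ e.target) :
    DifferentiableAt ℝ (S.coordθ e) y :=
  (S.contDiffAt_coordθ he hy).differentiableAt (by simp)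

omit he

lemma bracket_extendVec (p : M) (v w : CRTangent n p) :
    bracket (extendVec v) (extendVec w) p = 0 := by
  apply (tangentCoord p).injective
  rw [bracket_eq, map_zero]
  have h : ∀ u : CRTangent n p,
      fderiv ℝ (fieldRep (chartAt (CRModel n) p) (extendVec u)) (chartAt (CRModel n) p p) = 0 := by
    intro u
    have : fieldRep (chartAt (CRModel n) p) (extendVec u)
        =ᶠ[𝓝 (chartAt (CRModel n) p p)] fun _ ↦ tangentCoord p u := by
      filter_upwards [eventually_mem_target p] with y hy using fieldRep_extendVec u hy
    rw [this.fderiv_eq]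
    simp
  rw [h, h]
  simp

lemma diffl_θ_extendVec (p : M) (v w : CRTangent n p) :
    diffl (fun y ↦ S.θ y (extendVec w y)) p v
      = fderiv ℝ (S.coordθ (chartAt (CRModel n) p)) (chartAt (CRModel n) p p)
          (tangentCoord p v) (tangentCoord p w) := by
  have hd := S.differentiableAt_coordθ (chart_mem_atlas _ p) (chartAt_self_mem_target p)
  have hE : ((fun y ↦ S.θ y (extendVec w y)) ∘ (chartAt (CRModel n) p).symm)
      =ᶠ[𝓝 (chartAt (CRModel n) p p)]
      fun y ↦ S.coordθ (chartAt (CRModel n) p) y (tangentCoord p w) := by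
    filter_upwards [eventually_mem_target p] with y hy
    simp only [Function.comp, extendVec_chartAt w hy]
    rfl
  have hd' : DifferentiableAt ℝ ((fun y ↦ S.θ y (extendVec w y)) ∘ (chartAt (CRModel n) p).symm)
      (chartAt (CRModel n) p p) :=
    (hd.clm_apply (differentiableAt_const _)).congr_of_eventuallyEq hE
  rw [diffl_eq_fderiv_chartAt (mdifferentiableAt_of_comp_symm hd'), hE.fderiv_eq,
    fderiv_clm_apply_const hd]

/-- The exterior derivative of the contact form in the preferred chart. -/
lemma dθ_chartAt (p : M) (v w : CRTangent n p) :
    S.dθ p v w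
      = fderiv ℝ (S.coordθ (chartAt (CRModel n) p)) (chartAt (CRModel n) p p)
          (tangentCoord p v) (tangentCoord p w)
        - fderiv ℝ (S.coordθ (chartAt (CRModel n) p)) (chartAt (CRModel n) p p)
          (tangentCoord p w) (tangentCoord p v) := by
  rw [dθ, extDerivOneForm, diffl_θ_extendVec, diffl_θ_extendVec, bracket_extendVec]
  simp

include he

/-- Transformation of the contact form under a change of charts. -/
lemma coordθ_transition {e' : OpenPartialHomeomorph M (CRModel n)}
    (he' : e' ∈ atlas (CRModel n) M) {z : CRModel n} (hz : z ∈ e.target)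
    (hz' : e.symm z ∈ e'.source) :
    S.coordθ e z = (S.coordθ e' (e' (e.symm z))).comp (fderiv ℝ (e' ∘ e.symm) z) :=
  chartDeriv_transition he he' (fun x L ↦ (S.θ x).comp L) hz hz'

omit he in
lemma eventually_transition (e : OpenPartialHomeomorph M (CRModel n)) {y : CRModel n}
    (hy : y ∈ e.target) :
    ∀ᶠ z in 𝓝 y, z ∈ e.target ∧ e.symm z ∈ (chartAt (CRModel n) (e.symm y)).source := by
  refine (e.open_target.eventually_mem hy).and ?_
  exact (e.continuousAt_symm hy).eventually
    ((chartAt (CRModel n) (e.symm y)).open_source.mem_nhds (mem_chart_source _ _))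

lemma fderiv_coordθ_transition {y : CRModel n} (hy : y ∈ e.target) (v w : CRModel n) :
    fderiv ℝ (S.coordθ e) y v w
      = fderiv ℝ (S.coordθ (chartAt (CRModel n) (e.symm y)))
          (chartAt (CRModel n) (e.symm y) (e.symm y))
          (fderiv ℝ (chartAt (CRModel n) (e.symm y) ∘ e.symm) y v)
          (fderiv ℝ (chartAt (CRModel n) (e.symm y) ∘ e.symm) y w)
        + S.coordθ (chartAt (CRModel n) (e.symm y)) (chartAt (CRModel n) (e.symm y) (e.symm y))
          (fderiv ℝ (fderiv ℝ (chartAt (CRModel n) (e.symm y) ∘ e.symm)) y v w) := by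
  refine fderiv_pullback_oneForm (τ := chartAt (CRModel n) (e.symm y) ∘ e.symm) ?_ ?_ ?_ v w
  · filter_upwards [eventually_transition e hy] with z hz
    exact S.coordθ_transition he (chart_mem_atlas _ _) hz.1 hz.2
  · exact S.differentiableAt_coordθ (chart_mem_atlas _ _) (chartAt_self_mem_target _)
  · exact (contDiffAt_transition he (chart_mem_atlas _ _) hy (mem_chart_source _ _)).of_le
      two_le_infty

lemma sndFDeriv_transition_symm {y : CRModel n} (hy : y ∈ e.target) (v w : CRModel n) :
    fderiv ℝ (fderiv ℝ (chartAt (CRModel n) (e.symm y) ∘ e.symm)) y v w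
      = fderiv ℝ (fderiv ℝ (chartAt (CRModel n) (e.symm y) ∘ e.symm)) y w v :=
  ((contDiffAt_transition he (chart_mem_atlas _ _) hy (mem_chart_source _ _)).isSymmSndFDerivAt
    (by simpa using two_le_infty)).eq v w

/-- The exterior derivative of the contact form in an arbitrary chart. -/
lemma dθ_chart {y : CRModel n} (hy : y ∈ e.target) (v w : CRModel n) :
    S.dθ (e.symm y) (chartDeriv e y v) (chartDeriv e y w)
      = fderiv ℝ (S.coordθ e) y v w - fderiv ℝ (S.coordθ e) y w v := by
  rw [dθ_chartAt, tangentCoord_chartDeriv he hy, tangentCoord_chartDeriv he hy,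
    S.fderiv_coordθ_transition he hy, S.fderiv_coordθ_transition he hy,
    sndFDeriv_transition_symm he hy v w]
  ring

end StrictlyPseudoconvexCR

/-! ### Linear algebra of a strictly pseudoconvex structure -/

/-- The linear algebra of a strictly pseudoconvex structure on one tangent space `V`: a contact
form `θ`, an endomorphism `J` restricting to a complex structure of `ker θ`, and a 2-form `B`
(in the application, `dθ`) of type `(1,1)` whose associated form `-B (J ·, ·)` is positive definite
on `ker θ`. -/
structure LeviSpace (n : ℕ) (V : Type*) [AddCommGroup V] [Module ℝ V] where
  /-- the contact form -/
  θ : V →ₗ[ℝ] ℝ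
  /-- the complex structure of `ker θ`, arbitrarily extended -/
  J : V →ₗ[ℝ] V
  /-- the 2-form -/
  B : V →ₗ[ℝ] V →ₗ[ℝ] ℝ
  finrank_eq : Module.finrank ℝ V = 2 * n + 1
  θ_ne_zero : θ ≠ 0
  B_alt : ∀ v, B v v = 0
  θ_J : ∀ v, θ v = 0 → θ (J v) = 0
  J_J : ∀ v, θ v = 0 → J (J v) = -v
  B_J_J : ∀ v w, θ v = 0 → θ w = 0 → B (J v) (J w) = B v w
  pos : ∀ v, θ v = 0 → v ≠ 0 → 0 < -B (J v) v

namespace LeviSpace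

variable {n : ℕ} {V : Type*} [AddCommGroup V] [Module ℝ V] (L : LeviSpace n V)

lemma B_swap (v w : V) : L.B v w = -L.B w v := by
  have h := L.B_alt (v + w)
  simp only [map_add, LinearMap.add_apply, L.B_alt] at h
  linarith

lemma finiteDimensional (L : LeviSpace n V) : FiniteDimensional ℝ V :=
  Module.finite_of_finrank_pos (by rw [L.finrank_eq]; omega)

lemma B_J_right {v w : V} (hv : L.θ v = 0) (hw : L.θ w = 0) : L.B v (L.J w) = -L.B (L.J v) w := by
  have h := L.B_J_J (L.J v) w (L.θ_J v hv) hw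
  rw [L.J_J v hv] at h
  simp only [map_neg, LinearMap.neg_apply] at h
  linarith

lemma levi_symm {v w : V} (hv : L.θ v = 0) (hw : L.θ w = 0) : L.B (L.J v) w = L.B (L.J w) v := by
  rw [L.B_swap (L.J w) v, L.B_J_right hv hw, neg_neg]

/-- `dim V > dim ker θ`, so some nonzero vector is `B`-orthogonal to `ker θ`; it is transverse to
`ker θ`, where `B` is nondegenerate. -/
lemma exists_reeb : ∃ ξ, L.θ ξ = 1 ∧ ∀ w, L.B ξ w = 0 := by
  have := L.finiteDimensional
  have hker : Module.finrank ℝ (LinearMap.ker L.θ) < Module.finrank ℝ V := by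
    apply Submodule.finrank_lt
    rw [Ne, LinearMap.ker_eq_top]
    exact L.θ_ne_zero
  let Φ : V →ₗ[ℝ] Module.Dual ℝ (LinearMap.ker L.θ) :=
    (Module.Dual.transpose (LinearMap.ker L.θ).subtype) ∘ₗ L.B
  have hΦ : LinearMap.ker Φ ≠ ⊥ := by
    apply LinearMap.ker_ne_bot_of_finrank_lt
    rwa [Subspace.dual_finrank_eq]
  obtain ⟨v, hv, hv0⟩ := Submodule.exists_mem_ne_zero_of_ne_bot hΦ
  have hvH : ∀ w, L.θ w = 0 → L.B v w = 0 := by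
    intro w hw
    exact congrArg (fun f : Module.Dual ℝ (LinearMap.ker L.θ) ↦ f ⟨w, hw⟩) (LinearMap.mem_ker.1 hv)
  have hθv : L.θ v ≠ 0 := by
    intro h
    have h1 := L.pos v h hv0
    rw [L.B_swap, hvH _ (L.θ_J v h)] at h1
    simp at h1
  refine ⟨(L.θ v)⁻¹ • v, by simp [hθv], fun w ↦ ?_⟩
  have hw := hvH (w - (L.θ w / L.θ v) • v) (by simp [hθv])
  simp only [map_sub, map_smul, L.B_alt, smul_zero, sub_zero] at hw
  simp [hw]

/-- The form `B + θ ⊗ θ` is nondegenerate. -/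
lemma eq_zero_of_forall {v : V} (h : ∀ w, L.B v w + L.θ v * L.θ w = 0) : v = 0 := by
  obtain ⟨ξ, h1, h2⟩ := L.exists_reeb
  have hv : L.θ v = 0 := by
    have := h ξ
    rw [L.B_swap, h2, h1] at this
    linarith
  by_contra hv0
  have h3 := L.pos v hv hv0
  rw [L.B_swap] at h3
  have h4 := h (L.J v)
  rw [hv, zero_mul, add_zero] at h4
  rw [h4] at h3
  simp at h3

/-- A unitary family of `k ≤ n` vectors of `ker θ`. -/
lemma exists_unitary_family (k : ℕ) (hk : k ≤ n) : ∃ x : Fin k → V, (∀ i, L.θ (x i) = 0) ∧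
    (∀ i j, -L.B (L.J (x i)) (x j) = if i = j then 1 else 0) ∧ ∀ i j, L.B (x i) (x j) = 0 := by
  induction k with
  | zero => exact ⟨Fin.elim0, fun i ↦ i.elim0, fun i ↦ i.elim0, fun i ↦ i.elim0⟩
  | succ k ih =>
    obtain ⟨x, hx, hxx, hxJ⟩ := ih (by omega)
    have := L.finiteDimensional
    let Φ : V →ₗ[ℝ] (ℝ × ((Fin k → ℝ) × (Fin k → ℝ))) :=
      L.θ.prod ((LinearMap.pi fun i ↦ L.B (L.J (x i))).prod (LinearMap.pi fun i ↦ L.B (x i)))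
    have hΦ : LinearMap.ker Φ ≠ ⊥ := by
      apply LinearMap.ker_ne_bot_of_finrank_lt
      rw [L.finrank_eq]
      simp
      omega
    obtain ⟨v, hv, hv0⟩ := Submodule.exists_mem_ne_zero_of_ne_bot hΦ
    have hv' := LinearMap.mem_ker.1 hv
    have hvθ : L.θ v = 0 := congrArg Prod.fst hv'
    have hv1 : ∀ i, L.B (L.J (x i)) v = 0 := fun i ↦
      congrFun (congrArg (fun q ↦ q.2.1) hv') i
    have hv2 : ∀ i, L.B (x i) v = 0 := fun i ↦
      congrFun (congrArg (fun q ↦ q.2.2) hv') i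
    set c := -L.B (L.J v) v with hc
    have hcpos : 0 < c := L.pos v hvθ hv0
    have hsq : (√c)⁻¹ * (√c)⁻¹ * c = 1 := by
      rw [← mul_inv, Real.mul_self_sqrt hcpos.le, inv_mul_cancel₀ hcpos.ne']
    have hsymm : ∀ i, L.B (L.J v) (x i) = 0 := fun i ↦ by
      rw [L.levi_symm hvθ (hx i), hv1]
    refine ⟨Fin.snoc (α := fun _ ↦ V) x ((√c)⁻¹ • v), fun i ↦ ?_, fun i j ↦ ?_, fun i j ↦ ?_⟩
    · induction i using Fin.lastCases <;> simp [hvθ, hx]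
    · induction i using Fin.lastCases with
      | last =>
        induction j using Fin.lastCases with
        | last =>
          simp only [Fin.snoc_last, map_smul, LinearMap.smul_apply, smul_eq_mul, if_true]
          linear_combination hsq
        | cast j => simp [hsymm, (Fin.castSucc_ne_last j).symm]
      | cast i =>
        induction j using Fin.lastCases with
        | last => simp [hv1, Fin.castSucc_ne_last i]
        | cast j => simp [hxx]
    · induction i using Fin.lastCases with
      | last =>
        induction j using Fin.lastCases with
        | last => simp [L.B_alt]
        | cast j => simp [L.B_swap v, hv2]
      | cast i =>
        induction j using Fin.lastCases with
        | last => simp [hv2]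
        | cast j => simp [hxJ]

/-- The family `(x, Jx)` of a unitary family `x`. -/
def pair (x : Fin n → V) : Fin n ⊕ Fin n → V := Sum.elim x (fun i ↦ L.J (x i))

/-- The matrix of `B` in a family `(x, Jx)` with `x` unitary. -/
def stdSymplectic (n : ℕ) : Fin n ⊕ Fin n → Fin n ⊕ Fin n → ℝ
  | .inl _, .inl _ => 0
  | .inl i, .inr j => if i = j then 1 else 0
  | .inr i, .inl j => if i = j then -1 else 0
  | .inr _, .inr _ => 0

lemma exists_unitary_frame : ∃ x : Fin n → V, (∀ a, L.θ (L.pair x a) = 0) ∧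
    (∀ a b, -L.B (L.J (L.pair x a)) (L.pair x b) = if a = b then 1 else 0) ∧
    ∀ a b, L.B (L.pair x a) (L.pair x b) = stdSymplectic n a b := by
  obtain ⟨x, hx, hxx, hxJ⟩ := L.exists_unitary_family n le_rfl
  have hB : ∀ i j, L.B (x i) (L.J (x j)) = if i = j then 1 else 0 := fun i j ↦ by
    rw [L.B_J_right (hx i) (hx j), hxx]
  have hB' : ∀ i j, L.B (L.J (x i)) (x j) = if i = j then -1 else 0 := fun i j ↦ by
    have := hxx i j
    split_ifs at this ⊢ <;> linarith
  refine ⟨x, ?_, ?_, ?_⟩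
  · rintro (i | i)
    · exact hx i
    · exact L.θ_J _ (hx i)
  · rintro (i | i) (j | j)
    · simp [pair, hB', Sum.inl_injective.eq_iff]; split_ifs <;> simp
    · simp [pair, L.B_J_J _ _ (hx i) (hx j), hxJ]
    · simp [pair, L.J_J _ (hx i), hxJ]
    · simp [pair, L.J_J _ (hx i), hB]
  · rintro (i | i) (j | j)
    · simp [pair, hxJ, stdSymplectic]
    · simp [pair, hB, stdSymplectic]
    · simp [pair, hB', stdSymplectic]
    · simp [pair, L.B_J_J _ _ (hx i) (hx j), hxJ, stdSymplectic]

end LeviSpace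

/-! ### The exterior derivative of the contact form has type (1,1) -/

section SmoothExtension

variable {n : ℕ} {M : Type*} [TopologicalSpace M] [ChartedSpace (CRModel n) M]
  [IsManifold 𝓘(ℝ, CRModel n) ∞ M] [T2Space M]

/-- Every tangent vector is the value of a globally smooth vector field. -/
lemma exists_smoothField (p : M) (v : CRTangent n p) :
    ∃ X : (x : M) → CRTangent n x, IsSmoothField X ∧ X p = v := by
  let χ : SmoothBumpFunction 𝓘(ℝ, CRModel n) p := Classical.arbitrary _
  have hext : ContMDiffOn 𝓘(ℝ, CRModel n) 𝓘(ℝ, CRModel n).tangent ∞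
      (fun x ↦ (⟨x, extendVec v x⟩ : TangentBundle 𝓘(ℝ, CRModel n) M))
      (chartAt (CRModel n) p).source := by
    have h := (contMDiffOn_chartDeriv (chart_mem_atlas _ p) (fun _ ↦ tangentCoord p v)
      contDiffOn_const).comp (contMDiffOn_atlas (chart_mem_atlas _ p))
      (fun x hx ↦ (chartAt (CRModel n) p).map_source hx)
    refine h.congr fun x hx ↦ ?_
    have h1 := extendVec_chartAt v ((chartAt (CRModel n) p).map_source hx)
    simp only [Function.comp]
    rw [← h1, (chartAt (CRModel n) p).left_inv hx]
  refine ⟨fun x ↦ χ x • extendVec v x, ?_, by simp⟩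
  have h := ContMDiffOn.smul_section_of_tsupport (I := 𝓘(ℝ, CRModel n)) (n := ∞) (ψ := χ)
    (s := extendVec v) (u := (chartAt (CRModel n) p).source) χ.contMDiff.contMDiffOn
    (chartAt (CRModel n) p).open_source χ.tsupport_subset_chartAt_source hext
  exact h

end SmoothExtension

namespace StrictlyPseudoconvexCR

variable {n : ℕ} {M : Type*} [TopologicalSpace M] [ChartedSpace (CRModel n) M]
  [IsManifold 𝓘(ℝ, CRModel n) ∞ M] (S : StrictlyPseudoconvexCR n M)

/-- A quantity depending on a frame at `p`, read in the preferred chart at `p`. -/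
lemma _root_.chartDeriv_self_transfer {α : Type*}
    (Φ : (x : M) → (CRModel n →L[ℝ] CRTangent n x) → α) (p : M) :
    Φ p (tangentCoord p).symm.toContinuousLinearMap
      = Φ ((chartAt (CRModel n) p).symm (chartAt (CRModel n) p p))
          (chartDeriv (chartAt (CRModel n) p) (chartAt (CRModel n) p p)) := by
  let A : CRModel n →L[ℝ] CRModel n := (tangentCoord p).symm.toContinuousLinearMap
  let B : CRModel n →L[ℝ] CRModel n :=
    chartDeriv (chartAt (CRModel n) p) (chartAt (CRModel n) p p)
  have hAB : A = B := ContinuousLinearMap.ext fun v ↦ (tangentCoord_chartDeriv_self p v).symm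
  let Ψ : M → (CRModel n →L[ℝ] CRModel n) → α := Φ
  change Ψ p A = Ψ ((chartAt (CRModel n) p).symm (chartAt (CRModel n) p p)) B
  rw [hAB, symm_chartAt_self]

lemma θ_chartAt (p : M) (v : CRTangent n p) :
    S.θ p v = S.coordθ (chartAt (CRModel n) p) (chartAt (CRModel n) p p) (tangentCoord p v) := by
  have := chartDeriv_self_transfer (fun x A ↦ S.θ x (A (tangentCoord p v))) p
  rw [coordθ_apply, ← this]
  simp

/-- On smooth horizontal fields, `dθ(X, Y) = -θ([X, Y])`. -/
lemma dθ_eq_neg_θ_bracket {X Y : (x : M) → CRTangent n x} (hX : IsSmoothField X)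
    (hY : IsSmoothField Y) (hXθ : ∀ x, S.θ x (X x) = 0) (hYθ : ∀ x, S.θ x (Y x) = 0) (p : M) :
    S.dθ p (X p) (Y p) = -S.θ p (bracket X Y p) := by
  have hsm : ∀ Z : (x : M) → CRTangent n x, IsSmoothField Z → (∀ x, S.θ x (Z x) = 0) →
      ∀ u, fderiv ℝ (S.coordθ (chartAt (CRModel n) p)) (chartAt (CRModel n) p p) u
        (tangentCoord p (Z p)) + S.coordθ (chartAt (CRModel n) p) (chartAt (CRModel n) p p)
        (fderiv ℝ (fieldRep (chartAt (CRModel n) p) Z) (chartAt (CRModel n) p p) u) = 0 := by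
    intro Z hZ hZθ u
    have hd : DifferentiableAt ℝ (fieldRep (chartAt (CRModel n) p) Z) (chartAt (CRModel n) p p) :=
      ((contDiffOn_mfderiv (chart_mem_atlas _ p) (fun y ↦ Z ((chartAt (CRModel n) p).symm y))
        (hZ.comp_contMDiffOn (contMDiffOn_symm_atlas (chart_mem_atlas _ p)))).contDiffAt
        ((chartAt (CRModel n) p).open_target.mem_nhds (chartAt_self_mem_target p))).differentiableAt
        (by simp)
    have hθd := S.differentiableAt_coordθ (chart_mem_atlas _ p) (chartAt_self_mem_target p)
    have h0 : (fun y ↦ S.coordθ (chartAt (CRModel n) p) y (fieldRep (chartAt (CRModel n) p) Z y))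
        =ᶠ[𝓝 (chartAt (CRModel n) p p)] fun _ ↦ 0 := by
      filter_upwards [eventually_mem_target p] with y hy
      rw [coordθ_apply, chartDeriv_fieldRep (chart_mem_atlas _ p) hy, hZθ]
    have h1 := h0.fderiv_eq (𝕜 := ℝ)
    rw [fderiv_clm_apply hθd hd, (hasFDerivAt_const (𝕜 := ℝ) (0 : ℝ) _).fderiv] at h1
    have h2 := congrArg (fun A : CRModel n →L[ℝ] ℝ ↦ A u) h1
    simp only [add_apply, ContinuousLinearMap.comp_apply,
      ContinuousLinearMap.flip_apply, fieldRep_chartAt_self] at h2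
    rw [add_comm]
    exact h2
  have h1 := hsm X hX hXθ (tangentCoord p (Y p))
  have h2 := hsm Y hY hYθ (tangentCoord p (X p))
  rw [dθ_chartAt, θ_chartAt, bracket_eq, map_sub]
  linarith

/-- The exterior derivative `dθ` at a point, as a bilinear form. -/
def dθForm (p : M) : CRTangent n p →ₗ[ℝ] CRTangent n p →ₗ[ℝ] ℝ :=
  LinearMap.mk₂ ℝ (S.dθ p)
    (fun u v w ↦ by
      simp only [dθ_chartAt, map_add, add_apply]
      ring)
    (fun c v w ↦ by
      simp only [dθ_chartAt, map_smul, smul_apply, smul_eq_mul]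
      ring)
    (fun u v w ↦ by
      simp only [dθ_chartAt, map_add, add_apply]
      ring)
    (fun c v w ↦ by
      simp only [dθ_chartAt, map_smul, smul_apply, smul_eq_mul]
      ring)

variable [T2Space M]

lemma exists_horizontal_smoothField (p : M) (v : CRTangent n p) (hv : S.θ p v = 0) :
    ∃ X : (x : M) → CRTangent n x, IsSmoothField X ∧ (∀ x, S.θ x (X x) = 0) ∧ X p = v := by
  obtain ⟨w, hw⟩ : ∃ w, S.θ p w = 1 := by
    obtain ⟨w, hw⟩ := DFunLike.ne_iff.1 (S.θ_ne_zero p)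
    have hw' : S.θ p w ≠ 0 := hw
    exact ⟨(S.θ p w)⁻¹ • w, by simp [hw']⟩
  obtain ⟨A, hA, hAp⟩ := exists_smoothField p v
  obtain ⟨Y, hB, hBp⟩ := exists_smoothField p w
  have hθ : ∀ Z : (x : M) → CRTangent n x, IsSmoothField Z →
      ContMDiff 𝓘(ℝ, CRModel n) 𝓘(ℝ, ℝ) ∞ (fun x ↦ S.θ x (Z x)) := by
    intro Z hZ x
    have h2 := ContMDiff.clm_bundle_apply (F₂ := ℝ) (E₂ := Bundle.Trivial M ℝ) (b := fun x ↦ x)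
      (ϕ := fun y ↦ S.θ y) S.smooth_θ hZ
    exact (Bundle.contMDiffAt_totalSpace.1 (h2 x)).2
  refine ⟨fun x ↦ S.θ x (Y x) • A x - S.θ x (A x) • Y x, ?_, fun x ↦ by simp; ring, ?_⟩
  · exact ContMDiff.sub_section (ContMDiff.smul_section (hθ Y hB) hA)
      (ContMDiff.smul_section (hθ A hA) hB)
  · simp [hAp, hBp, hw, hv]

/-- The integrability condition makes `dθ` a form of type `(1,1)`. -/
lemma dθ_J_J (p : M) (v w : CRTangent n p) (hv : S.θ p v = 0) (hw : S.θ p w = 0) :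
    S.dθ p (S.J p v) (S.J p w) = S.dθ p v w := by
  obtain ⟨X, hX, hXθ, rfl⟩ := S.exists_horizontal_smoothField p v hv
  obtain ⟨Y, hY, hYθ, rfl⟩ := S.exists_horizontal_smoothField p w hw
  have hJ : ∀ Z : (x : M) → CRTangent n x, IsSmoothField Z →
      IsSmoothField (fun y ↦ S.J y (Z y)) := by
    intro Z hZ
    exact ContMDiff.clm_bundle_apply (b := fun x ↦ x) (ϕ := fun y ↦ S.J y) S.smooth_J hZ
  rw [S.dθ_eq_neg_θ_bracket hX hY hXθ hYθ,
    S.dθ_eq_neg_θ_bracket (X := fun y ↦ S.J y (X y)) (Y := fun y ↦ S.J y (Y y)) (hJ X hX) (hJ Y hY)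
      (fun x ↦ S.J_horizontal x _ (hXθ x)) (fun x ↦ S.J_horizontal x _ (hYθ x))]
  have h := S.integrable_horizontal X Y hX hY hXθ hYθ p
  rw [map_sub] at h
  linarith

/-- The linear algebra of the CR structure on the tangent space at `p`. -/
def leviSpace (p : M) : LeviSpace n (CRTangent n p) where
  θ := (S.θ p).toLinearMap
  J := (S.J p).toLinearMap
  B := S.dθForm p
  finrank_eq := by
    rw [(tangentCoord p).toLinearEquiv.finrank_eq]
    simp
  θ_ne_zero h := S.θ_ne_zero p (ContinuousLinearMap.ext fun v ↦
    congrArg (fun f : CRTangent n p →ₗ[ℝ] ℝ ↦ f v) h)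
  B_alt v := by
    change S.dθ p v v = 0
    rw [dθ_chartAt, sub_self]
  θ_J := S.J_horizontal p
  J_J := S.J_sq p
  B_J_J := S.dθ_J_J p
  pos := S.levi_pos p

end StrictlyPseudoconvexCR

/-! ### The Reeb field, horizontal frames and the Webster metric -/

namespace StrictlyPseudoconvexCR

variable {n : ℕ} {M : Type*} [TopologicalSpace M] [ChartedSpace (CRModel n) M]
  [IsManifold 𝓘(ℝ, CRModel n) ∞ M] [T2Space M] (S : StrictlyPseudoconvexCR n M)

lemma reeb_spec (p : M) : S.θ p (S.reeb p) = 1 ∧ ∀ w, S.dθ p (S.reeb p) w = 0 :=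
  Classical.epsilon_spec (p := fun v ↦ S.θ p v = 1 ∧ ∀ w, S.dθ p v w = 0)
    (S.leviSpace p).exists_reeb

@[simp] lemma θ_reeb (p : M) : S.θ p (S.reeb p) = 1 := (S.reeb_spec p).1

lemma levi_eq (p : M) (v w : CRTangent n p) :
    S.levi p v w = -(S.leviSpace p).B ((S.leviSpace p).J v) w := rfl

lemma frame_spec (p : M) : (∀ i, S.θ p (S.frame p i) = 0) ∧
    ∀ i j, S.levi p (S.frame p i) (S.frame p j) = if i = j then 1 else 0 := by
  refine Classical.epsilon_spec (p := fun e : Fin (2 * n) → CRTangent n p ↦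
    (∀ i, S.θ p (e i) = 0) ∧ ∀ i j, S.levi p (e i) (e j) = if i = j then 1 else 0) ?_
  obtain ⟨x, h1, h2, -⟩ := (S.leviSpace p).exists_unitary_frame
  have σ : Fin (2 * n) ≃ Fin n ⊕ Fin n := Fintype.equivOfCardEq (by simp; omega)
  refine ⟨fun i ↦ (S.leviSpace p).pair x (σ i), fun i ↦ h1 (σ i), fun i j ↦ ?_⟩
  rw [levi_eq, h2]
  simp

@[simp] lemma θ_frame (p : M) (i) : S.θ p (S.frame p i) = 0 := (S.frame_spec p).1 i

@[simp] lemma θ_horiz (p : M) (v : CRTangent n p) : S.θ p (S.horiz p v) = 0 := by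
  simp [horiz]

lemma horiz_of_θ_eq_zero {p : M} {v : CRTangent n p} (h : S.θ p v = 0) : S.horiz p v = v := by
  simp [horiz, h]

lemma webster_horiz {p : M} (v : CRTangent n p) {w : CRTangent n p} (hw : S.θ p w = 0) :
    S.webster p (S.horiz p v) w = S.webster p v w := by
  simp [webster, S.horiz_of_θ_eq_zero (S.θ_horiz p v), hw]

lemma webster_symm (p : M) (v w : CRTangent n p) : S.webster p v w = S.webster p w v := by
  rw [webster, webster, levi_eq, levi_eq,
    (S.leviSpace p).levi_symm (v := S.horiz p v) (w := S.horiz p w) (S.θ_horiz p v)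
      (S.θ_horiz p w), mul_comm (S.θ p v)]

lemma webster_reeb (p : M) (v : CRTangent n p) : S.webster p (S.reeb p) v = S.θ p v := by
  have h : S.horiz p (S.reeb p) = 0 := by simp [horiz]
  rw [webster, h, levi_eq]
  simp

lemma webster_pos {p : M} {v : CRTangent n p} (hv : v ≠ 0) : 0 < S.webster p v v := by
  rw [webster]
  by_cases h : S.horiz p v = 0
  · rw [h, levi_eq]
    have hθ : S.θ p v ≠ 0 := by
      intro h0
      rw [S.horiz_of_θ_eq_zero h0] at h
      exact hv h
    simpa using mul_self_pos.2 hθ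
  · have h1 : 0 < S.levi p (S.horiz p v) (S.horiz p v) := S.levi_pos p _ (S.θ_horiz p v) h
    nlinarith [mul_self_nonneg (S.θ p v)]

/-! ### The structure in coordinates -/

/-- The endomorphism `J` in the chart `e`. -/
def coordJ (e : OpenPartialHomeomorph M (CRModel n)) (y : CRModel n) : CRModel n →L[ℝ] CRModel n :=
  (mfderiv 𝓘(ℝ, CRModel n) 𝓘(ℝ, CRModel n) e (e.symm y)).comp
    ((S.J (e.symm y)).comp (chartDeriv e y))

/-- The Reeb field in the chart `e`. -/
def coordξ (e : OpenPartialHomeomorph M (CRModel n)) (y : CRModel n) : CRModel n :=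
  fieldRep e S.reeb y

/-- The form `dθ` in the chart `e`. -/
def coorddθ (e : OpenPartialHomeomorph M (CRModel n)) (y : CRModel n) :
    CRModel n →L[ℝ] CRModel n →L[ℝ] ℝ :=
  fderiv ℝ (S.coordθ e) y - (fderiv ℝ (S.coordθ e) y).flip

/-- The projection onto the Levi distribution in the chart `e`. -/
def coordProj (e : OpenPartialHomeomorph M (CRModel n)) (y : CRModel n) :
    CRModel n →L[ℝ] CRModel n :=
  ContinuousLinearMap.id ℝ (CRModel n) - (S.coordθ e y).smulRight (S.coordξ e y)

/-- The Webster metric in the chart `e`. -/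
def coordG (e : OpenPartialHomeomorph M (CRModel n)) (y : CRModel n) :
    CRModel n →L[ℝ] CRModel n →L[ℝ] ℝ :=
  (S.coordθ e y).smulRight (S.coordθ e y)
    - ((((S.coorddθ e y).comp ((S.coordJ e y).comp (S.coordProj e y))).flip).comp
        (S.coordProj e y)).flip

variable {e : OpenPartialHomeomorph M (CRModel n)} (he : e ∈ atlas (CRModel n) M)
  {y : CRModel n} (hy : y ∈ e.target)
include he hy

lemma chartDeriv_coordξ : chartDeriv e y (S.coordξ e y) = S.reeb (e.symm y) :=
  chartDeriv_fieldRep he hy _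

lemma chartDeriv_coordJ (v : CRModel n) :
    chartDeriv e y (S.coordJ e y v) = S.J (e.symm y) (chartDeriv e y v) :=
  chartDeriv_mfderiv he hy _

lemma coorddθ_apply (v w : CRModel n) :
    S.coorddθ e y v w = S.dθ (e.symm y) (chartDeriv e y v) (chartDeriv e y w) := by
  rw [S.dθ_chart he hy]
  simp [coorddθ]

lemma chartDeriv_coordProj (v : CRModel n) :
    chartDeriv e y (S.coordProj e y v) = S.horiz (e.symm y) (chartDeriv e y v) := by
  simp [coordProj, horiz, S.chartDeriv_coordξ he hy, coordθ_apply]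

lemma coordG_apply (v w : CRModel n) :
    S.coordG e y v w = S.webster (e.symm y) (chartDeriv e y v) (chartDeriv e y w) := by
  have h : S.coordG e y v w = S.coordθ e y v * S.coordθ e y w
      - S.coorddθ e y (S.coordJ e y (S.coordProj e y v)) (S.coordProj e y w) := by
    simp [coordG]
  rw [h, S.coorddθ_apply he hy, S.chartDeriv_coordJ he hy, S.chartDeriv_coordProj he hy,
    S.chartDeriv_coordProj he hy, webster, levi, coordθ_apply, coordθ_apply]
  ring

lemma coordθ_coordξ : S.coordθ e y (S.coordξ e y) = 1 := by
  rw [coordθ_apply, S.chartDeriv_coordξ he hy, θ_reeb]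

lemma coorddθ_coordξ (v : CRModel n) : S.coorddθ e y (S.coordξ e y) v = 0 := by
  rw [S.coorddθ_apply he hy, S.chartDeriv_coordξ he hy, (S.reeb_spec _).2]

lemma coordG_symm (v w : CRModel n) : S.coordG e y v w = S.coordG e y w v := by
  rw [S.coordG_apply he hy, S.coordG_apply he hy, webster_symm]

lemma coordG_coordξ (v : CRModel n) : S.coordG e y (S.coordξ e y) v = S.coordθ e y v := by
  rw [S.coordG_apply he hy, S.chartDeriv_coordξ he hy, webster_reeb, coordθ_apply]

lemma coordG_pos {v : CRModel n} (hv : v ≠ 0) : 0 < S.coordG e y v v := by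
  rw [S.coordG_apply he hy]
  apply S.webster_pos
  intro h
  exact hv (chartDeriv_injective he hy (h.trans (map_zero _).symm))

omit he hy in
lemma finrank_dual_model : Module.finrank ℝ (CRModel n) = Module.finrank ℝ (CRModel n →L[ℝ] ℝ) := by
  rw [← (LinearMap.toContinuousLinearMap (𝕜 := ℝ) (E := CRModel n) (F' := ℝ)).finrank_eq]
  exact (Subspace.dual_finrank_eq (K := ℝ) (V := CRModel n)).symm

omit he hy in
/-- An injective bilinear form on the model space is an isomorphism onto the dual. -/
lemma exists_equiv_of_injective (B : CRModel n →L[ℝ] CRModel n →L[ℝ] ℝ)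
    (hB : Function.Injective B) :
    ∃ Φ : CRModel n ≃L[ℝ] (CRModel n →L[ℝ] ℝ), (Φ : CRModel n →L[ℝ] CRModel n →L[ℝ] ℝ) = B :=
  ⟨(LinearEquiv.ofInjectiveOfFinrankEq B.toLinearMap hB finrank_dual_model).toContinuousLinearEquiv,
    by ext; rfl⟩

lemma coordG_exists_equiv : ∃ Φ : CRModel n ≃L[ℝ] (CRModel n →L[ℝ] ℝ),
    (Φ : CRModel n →L[ℝ] CRModel n →L[ℝ] ℝ) = S.coordG e y := by
  apply exists_equiv_of_injective
  rw [injective_iff_map_eq_zero]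
  intro v hv
  by_contra h0
  have := S.coordG_pos he hy h0
  rw [hv] at this
  simp at this

omit hy

lemma contDiffOn_coordJ : ContDiffOn ℝ ∞ (S.coordJ e) e.target := by
  rw [contDiffOn_clm_apply]
  intro v
  refine contDiffOn_mfderiv he (fun y ↦ S.J (e.symm y) (chartDeriv e y v)) ?_
  exact ContMDiffOn.clm_bundle_apply (b := e.symm) (ϕ := fun y ↦ S.J (e.symm y))
    (S.smooth_J.comp_contMDiffOn (contMDiffOn_symm_atlas he))
    (contMDiffOn_chartDeriv he (fun _ ↦ v) contDiffOn_const)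

lemma contDiffOn_fderiv_coordθ : ContDiffOn ℝ ∞ (fderiv ℝ (S.coordθ e)) e.target :=
  ((contDiffOn_infty_iff_fderiv_of_isOpen e.open_target).1 (S.contDiffOn_coordθ he)).2

omit he in
lemma contDiffOn_flip {s : Set (CRModel n)} {B : CRModel n → CRModel n →L[ℝ] CRModel n →L[ℝ] ℝ}
    {k : WithTop ℕ∞} (hB : ContDiffOn ℝ k B s) : ContDiffOn ℝ k (fun y ↦ (B y).flip) s :=
  contDiffOn_clm_apply.2 fun v ↦ contDiffOn_clm_apply.2 fun _ ↦
    (hB.clm_apply contDiffOn_const).clm_apply (contDiffOn_const (c := v))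

lemma contDiffOn_coorddθ : ContDiffOn ℝ ∞ (S.coorddθ e) e.target :=
  (S.contDiffOn_fderiv_coordθ he).sub (contDiffOn_flip (S.contDiffOn_fderiv_coordθ he))

/-- The Reeb field is smooth: it solves `(dθ + θ ⊗ θ)(ξ, ·) = θ`, a linear system with smooth
invertible coefficients. -/
lemma contDiffOn_coordξ : ContDiffOn ℝ ∞ (S.coordξ e) e.target := by
  set B : CRModel n → CRModel n →L[ℝ] CRModel n →L[ℝ] ℝ :=
    fun y ↦ S.coorddθ e y + (S.coordθ e y).smulRight (S.coordθ e y) with hBdef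
  have hBs : ContDiffOn ℝ ∞ B e.target :=
    (S.contDiffOn_coorddθ he).add ((S.contDiffOn_coordθ he).smulRight (S.contDiffOn_coordθ he))
  have hBinj : ∀ y ∈ e.target, ∃ Φ : CRModel n ≃L[ℝ] (CRModel n →L[ℝ] ℝ),
      (Φ : CRModel n →L[ℝ] CRModel n →L[ℝ] ℝ) = B y := by
    intro y hy
    apply exists_equiv_of_injective
    rw [injective_iff_map_eq_zero]
    intro v hv
    have h0 : chartDeriv e y v = 0 := by
      apply (S.leviSpace (e.symm y)).eq_zero_of_forall
      intro w
      obtain ⟨w, rfl⟩ := chartDeriv_surjective he hy w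
      have h := congrArg (fun f : CRModel n →L[ℝ] ℝ ↦ f w) hv
      simp only [hBdef, add_apply, S.coorddθ_apply he hy] at h
      have h' : S.dθ (e.symm y) (chartDeriv e y v) (chartDeriv e y w)
          + S.coordθ e y v * S.coordθ e y w = 0 := by simpa using h
      exact h'
    exact chartDeriv_injective he hy (h0.trans (map_zero _).symm)
  have hB : ∀ y ∈ e.target, B y (S.coordξ e y) = S.coordθ e y := by
    intro y hy
    ext v
    simp [hBdef, S.coorddθ_coordξ he hy, S.coordθ_coordξ he hy]
  have hsol : ContDiffOn ℝ ∞ (fun y ↦ (B y).inverse (S.coordθ e y)) e.target := by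
    refine ContDiffOn.clm_apply ?_ (S.contDiffOn_coordθ he)
    intro y hy
    obtain ⟨Φ, hΦ⟩ := hBinj y hy
    have h1 : ContDiffAt ℝ ∞ ContinuousLinearMap.inverse (B y) := by
      rw [← hΦ]
      exact contDiffAt_map_inverse Φ
    exact h1.comp_contDiffWithinAt y (hBs y hy)
  refine hsol.congr fun y hy ↦ ?_
  obtain ⟨Φ, hΦ⟩ := hBinj y hy
  rw [← hB y hy, ← hΦ, ContinuousLinearMap.inverse_equiv]
  simp

lemma contDiffOn_coordProj : ContDiffOn ℝ ∞ (S.coordProj e) e.target :=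
  contDiffOn_const.sub ((S.contDiffOn_coordθ he).smulRight (S.contDiffOn_coordξ he))

lemma contDiffOn_coordG : ContDiffOn ℝ ∞ (S.coordG e) e.target := by
  refine ((S.contDiffOn_coordθ he).smulRight (S.contDiffOn_coordθ he)).sub ?_
  refine contDiffOn_flip ((contDiffOn_flip ?_).clm_comp (S.contDiffOn_coordProj he))
  exact (S.contDiffOn_coorddθ he).clm_comp
    ((S.contDiffOn_coordJ he).clm_comp (S.contDiffOn_coordProj he))

include hy

lemma differentiableAt_coordG : DifferentiableAt ℝ (S.coordG e) y :=
  ((S.contDiffOn_coordG he).contDiffAt (e.open_target.mem_nhds hy)).differentiableAt (by simp)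

lemma differentiableAt_coordξ : DifferentiableAt ℝ (S.coordξ e) y :=
  ((S.contDiffOn_coordξ he).contDiffAt (e.open_target.mem_nhds hy)).differentiableAt (by simp)

end StrictlyPseudoconvexCR

namespace StrictlyPseudoconvexCR

variable {n : ℕ} {M : Type*} [TopologicalSpace M] [ChartedSpace (CRModel n) M]
  [IsManifold 𝓘(ℝ, CRModel n) ∞ M] [T2Space M] (S : StrictlyPseudoconvexCR n M)

/-! ### The Tanaka-Webster connection in the preferred chart -/

section Koszul

variable (p : M)

/-- The preferred chart at the point under consideration. -/
local notation "κ" => chartAt (CRModel n) p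

lemma webster_chartAt (v w : CRTangent n p) :
    S.webster p v w = S.coordG κ (κ p) (tangentCoord p v) (tangentCoord p w) := by
  have := chartDeriv_self_transfer
    (fun x A ↦ S.webster x (A (tangentCoord p v)) (A (tangentCoord p w))) p
  rw [S.coordG_apply (chart_mem_atlas _ p) (chartAt_self_mem_target p), ← this]
  simp

lemma diffl_webster {A B : (x : M) → CRTangent n x}
    (hA : DifferentiableAt ℝ (fieldRep κ A) (κ p)) (hB : DifferentiableAt ℝ (fieldRep κ B) (κ p))
    (v : CRTangent n p) :
    diffl (fun q ↦ S.webster q (A q) (B q)) p v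
      = fderiv ℝ (S.coordG κ) (κ p) (tangentCoord p v) (tangentCoord p (A p)) (tangentCoord p (B p))
        + S.coordG κ (κ p) (fderiv ℝ (fieldRep κ A) (κ p) (tangentCoord p v)) (tangentCoord p (B p))
        + S.coordG κ (κ p) (tangentCoord p (A p))
          (fderiv ℝ (fieldRep κ B) (κ p) (tangentCoord p v)) := by
  have hg := S.differentiableAt_coordG (chart_mem_atlas _ p) (chartAt_self_mem_target p)
  have hE : ((fun q ↦ S.webster q (A q) (B q)) ∘ (κ).symm) =ᶠ[𝓝 (κ p)]
      fun y ↦ S.coordG κ y (fieldRep κ A y) (fieldRep κ B y) := by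
    filter_upwards [eventually_mem_target p] with y hy
    rw [S.coordG_apply (chart_mem_atlas _ p) hy, chartDeriv_fieldRep (chart_mem_atlas _ p) hy,
      chartDeriv_fieldRep (chart_mem_atlas _ p) hy]
    rfl
  have hF := (hg.hasFDerivAt.clm_apply hA.hasFDerivAt).clm_apply hB.hasFDerivAt
  have hF' := hF.congr_of_eventuallyEq hE
  rw [diffl_eq_fderiv_chartAt (mdifferentiableAt_of_comp_symm hF'.differentiableAt), hF'.fderiv]
  simp only [add_apply, ContinuousLinearMap.comp_apply, ContinuousLinearMap.flip_apply,
    fieldRep_chartAt_self]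
  ring

lemma fieldRep_extendVec_eventuallyEq (v : CRTangent n p) :
    fieldRep κ (extendVec v) =ᶠ[𝓝 (κ p)] fun _ ↦ tangentCoord p v := by
  filter_upwards [eventually_mem_target p] with y hy using fieldRep_extendVec v hy

lemma differentiableAt_fieldRep_extendVec (v : CRTangent n p) :
    DifferentiableAt ℝ (fieldRep κ (extendVec v)) (κ p) :=
  (differentiableAt_const _).congr_of_eventuallyEq (fieldRep_extendVec_eventuallyEq p v)

lemma fderiv_fieldRep_extendVec (v : CRTangent n p) :
    fderiv ℝ (fieldRep κ (extendVec v)) (κ p) = 0 := by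
  rw [(fieldRep_extendVec_eventuallyEq p v).fderiv_eq]
  simp

/-- Koszul's formula in the preferred chart: the Christoffel symbols of the Webster metric. -/
lemma koszul_eq {Y : (x : M) → CRTangent n x} (hY : DifferentiableAt ℝ (fieldRep κ Y) (κ p))
    (v z : CRTangent n p) :
    S.koszul (extendVec v) Y (extendVec z) p
      = (1 / 2) * (fderiv ℝ (S.coordG κ) (κ p) (tangentCoord p v) (tangentCoord p (Y p))
            (tangentCoord p z)
          + fderiv ℝ (S.coordG κ) (κ p) (tangentCoord p (Y p)) (tangentCoord p v)
            (tangentCoord p z)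
          - fderiv ℝ (S.coordG κ) (κ p) (tangentCoord p z) (tangentCoord p v)
            (tangentCoord p (Y p)))
        + S.coordG κ (κ p) (fderiv ℝ (fieldRep κ Y) (κ p) (tangentCoord p v))
            (tangentCoord p z) := by
  have hs := S.coordG_symm (chart_mem_atlas _ p) (chartAt_self_mem_target p)
    (fderiv ℝ (fieldRep κ Y) (κ p) (tangentCoord p z)) (tangentCoord p v)
  rw [koszul, S.diffl_webster p hY (differentiableAt_fieldRep_extendVec p z),
    S.diffl_webster p (differentiableAt_fieldRep_extendVec p v)
      (differentiableAt_fieldRep_extendVec p z),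
    S.diffl_webster p (differentiableAt_fieldRep_extendVec p v) hY, webster_chartAt,
    webster_chartAt, webster_chartAt, bracket_eq, bracket_eq, bracket_eq]
  simp only [fderiv_fieldRep_extendVec, extendVec_self, zero_apply, map_zero, zero_sub, sub_zero,
    map_neg, neg_apply, add_zero]
  rw [hs]
  ring

lemma leviCivita_spec {Y : (x : M) → CRTangent n x} (hY : DifferentiableAt ℝ (fieldRep κ Y) (κ p))
    (v z : CRTangent n p) :
    S.webster p (S.leviCivita Y p v) z = S.koszul (extendVec v) Y (extendVec z) p := by
  refine Classical.epsilon_spec (p := fun a ↦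
    ∀ z, S.webster p a z = S.koszul (extendVec v) Y (extendVec z) p) ?_ z
  obtain ⟨Φ, hΦ⟩ := S.coordG_exists_equiv (chart_mem_atlas _ p) (chartAt_self_mem_target p)
  let D := fderiv ℝ (S.coordG κ) (κ p)
  let ℓ : CRModel n →L[ℝ] ℝ := (1 / 2 : ℝ) • (D (tangentCoord p v) (tangentCoord p (Y p))
      + D (tangentCoord p (Y p)) (tangentCoord p v)
      - (D.flip (tangentCoord p v)).flip (tangentCoord p (Y p)))
    + S.coordG κ (κ p) (fderiv ℝ (fieldRep κ Y) (κ p) (tangentCoord p v))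
  refine ⟨(tangentCoord p).symm (Φ.symm ℓ), fun z ↦ ?_⟩
  rw [koszul_eq S p hY, webster_chartAt, ← hΦ]
  simp [ℓ, D]
  rw [← hΦ]
  rfl

lemma fieldRep_horiz_extendVec (v : CRTangent n p) :
    fieldRep κ (fun y ↦ S.horiz y (extendVec v y)) =ᶠ[𝓝 (κ p)]
      fun y ↦ tangentCoord p v - S.coordθ κ y (tangentCoord p v) • S.coordξ κ y := by
  filter_upwards [eventually_mem_target p] with y hy
  apply chartDeriv_injective (chart_mem_atlas _ p) hy
  rw [chartDeriv_fieldRep (chart_mem_atlas _ p) hy, map_sub, map_smul,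
    S.chartDeriv_coordξ (chart_mem_atlas _ p) hy, coordθ_apply, horiz, extendVec_chartAt v hy]

lemma θ_tanakaWebster {v : CRTangent n p} (hv : S.θ p v = 0) :
    S.θ p (S.tanakaWebster (extendVec v) p v)
      = fderiv ℝ (S.coordθ κ) (κ p) (tangentCoord p v) (tangentCoord p v) := by
  simp only [tanakaWebster, hv, zero_smul, add_zero, map_add, map_smul, θ_horiz, θ_reeb, zero_add,
    smul_eq_mul, mul_one]
  rw [diffl_θ_extendVec]

/-- The horizontal part of `∇_v v` for horizontal `v`, by Koszul's formula. -/
lemma webster_tanakaWebster {v z : CRTangent n p} (hv : S.θ p v = 0) (hz : S.θ p z = 0) :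
    S.webster p (S.tanakaWebster (extendVec v) p v) z
      = fderiv ℝ (S.coordG κ) (κ p) (tangentCoord p v) (tangentCoord p v) (tangentCoord p z)
        - (1 / 2) * fderiv ℝ (S.coordG κ) (κ p) (tangentCoord p z) (tangentCoord p v)
          (tangentCoord p v) := by
  have hθd := S.differentiableAt_coordθ (chart_mem_atlas _ p) (chartAt_self_mem_target p)
  have hξd := S.differentiableAt_coordξ (chart_mem_atlas _ p) (chartAt_self_mem_target p)
  have hθv : S.coordθ κ (κ p) (tangentCoord p v) = 0 := by rw [← θ_chartAt, hv]
  have hθz : S.coordθ κ (κ p) (tangentCoord p z) = 0 := by rw [← θ_chartAt, hz]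
  have hF := ((hasFDerivAt_const (tangentCoord p v) (κ p)).sub
    ((hθd.hasFDerivAt.clm_apply (hasFDerivAt_const (tangentCoord p v) (κ p))).smul
      hξd.hasFDerivAt)).congr_of_eventuallyEq (S.fieldRep_horiz_extendVec p v)
  have hadd : ∀ a : CRTangent n p, ∀ c : ℝ, S.webster p (S.horiz p a + c • S.reeb p) z
      = S.webster p a z := by
    intro a c
    rw [← S.webster_horiz a hz, webster_chartAt, webster_chartAt, map_add, map_smul, map_add,
      map_smul]
    simp only [add_apply, smul_apply, ← webster_chartAt, webster_reeb, hz]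
    simp
  have hY0 : S.horiz p (extendVec v p) = v := by rw [extendVec_self, S.horiz_of_θ_eq_zero hv]
  have hTW : S.tanakaWebster (extendVec v) p v
      = S.horiz p (S.leviCivita (fun y ↦ S.horiz y (extendVec v y)) p v)
        + diffl (fun y ↦ S.θ y (extendVec v y)) p v • S.reeb p := by
    simp only [tanakaWebster, hv, zero_smul, add_zero, S.horiz_of_θ_eq_zero hv]
  rw [hTW, hadd, S.leviCivita_spec p hF.differentiableAt, S.koszul_eq p hF.differentiableAt,
    hF.fderiv, hY0]
  have hlast : S.coordG κ (κ p) (((0 : CRModel n →L[ℝ] CRModel n)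
      - (S.coordθ κ (κ p) (tangentCoord p v) • fderiv ℝ (S.coordξ κ) (κ p)
        + ((S.coordθ κ (κ p)).comp (0 : CRModel n →L[ℝ] CRModel n)
          + (fderiv ℝ (S.coordθ κ) (κ p)).flip (tangentCoord p v)).smulRight (S.coordξ κ (κ p))))
            (tangentCoord p v)) (tangentCoord p z) = 0 := by
    rw [hθv]
    simp [S.coordG_coordξ (chart_mem_atlas _ p) (chartAt_self_mem_target p), hθz]
  rw [hlast]
  ring

end Koszul

end StrictlyPseudoconvexCR

namespace StrictlyPseudoconvexCR

variable {n : ℕ} {M : Type*} [TopologicalSpace M] [ChartedSpace (CRModel n) M]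
  [IsManifold 𝓘(ℝ, CRModel n) ∞ M] [T2Space M] (S : StrictlyPseudoconvexCR n M)

/-! ### The tension in an arbitrary chart -/

section Smooth

variable {F : Type*} [NormedAddCommGroup F] [NormedSpace ℝ F] {f : M → F}
  (hf : ContMDiff 𝓘(ℝ, CRModel n) 𝓘(ℝ, F) 2 f)
  {e : OpenPartialHomeomorph M (CRModel n)} (he : e ∈ atlas (CRModel n) M)
  {y : CRModel n} (hy : y ∈ e.target)
include hf he hy

lemma contDiffAt_two_comp_symm : ContDiffAt ℝ 2 (f ∘ e.symm) y :=
  (contDiffOn_comp_symm (k := 2) he hf).contDiffAt (e.open_target.mem_nhds hy)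

lemma differentiableAt_fderiv_comp_symm : DifferentiableAt ℝ (fderiv ℝ (f ∘ e.symm)) y :=
  ((contDiffAt_two_comp_symm hf he hy).fderiv_right (m := 1) (by norm_num)).differentiableAt
    (by simp)

lemma sndFDeriv_comp_symm_symm (v w : CRModel n) :
    fderiv ℝ (fderiv ℝ (f ∘ e.symm)) y v w = fderiv ℝ (fderiv ℝ (f ∘ e.symm)) y w v :=
  ((contDiffAt_two_comp_symm hf he hy).isSymmSndFDerivAt (by simp)).eq v w

omit he hy

lemma mdifferentiableAt_of_two (p : M) : MDifferentiableAt 𝓘(ℝ, CRModel n) 𝓘(ℝ, F) f p :=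
  (hf p).mdifferentiableAt (by simp)

include he hy

lemma fderiv_comp_symm_of_two (v : CRModel n) :
    fderiv ℝ (f ∘ e.symm) y v = diffl f (e.symm y) (chartDeriv e y v) :=
  fderiv_comp_symm he hy (mdifferentiableAt_of_two hf _) v

/-- Second derivatives under a change of charts: besides the tensorial part there is a term with the
second derivative of the transition map, which the connection compensates. -/
lemma sndFDeriv_comp_symm_transition (v w : CRModel n) :
    fderiv ℝ (fderiv ℝ (f ∘ e.symm)) y v w
      = fderiv ℝ (fderiv ℝ (f ∘ (chartAt (CRModel n) (e.symm y)).symm))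
          (chartAt (CRModel n) (e.symm y) (e.symm y))
          (fderiv ℝ (chartAt (CRModel n) (e.symm y) ∘ e.symm) y v)
          (fderiv ℝ (chartAt (CRModel n) (e.symm y) ∘ e.symm) y w)
        + fderiv ℝ (f ∘ (chartAt (CRModel n) (e.symm y)).symm)
          (chartAt (CRModel n) (e.symm y) (e.symm y))
          (fderiv ℝ (fderiv ℝ (chartAt (CRModel n) (e.symm y) ∘ e.symm)) y v w) := by
  refine fderiv_pullback_oneForm (τ := chartAt (CRModel n) (e.symm y) ∘ e.symm) ?_ ?_ ?_ v w
  · filter_upwards [eventually_transition e hy] with z hz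
    ext u
    have hz2 : chartAt (CRModel n) (e.symm y) (e.symm z)
        ∈ (chartAt (CRModel n) (e.symm y)).target := (chartAt _ _).map_source hz.2
    rw [fderiv_comp_symm_of_two hf he hz.1, ContinuousLinearMap.comp_apply,
      Function.comp_apply, fderiv_comp_symm_of_two hf (chart_mem_atlas _ _) hz2]
    exact chartDeriv_transition he (chart_mem_atlas _ _) (fun x A ↦ diffl f x (A u)) hz.1 hz.2
  · exact differentiableAt_fderiv_comp_symm hf (chart_mem_atlas _ _) (chartAt_self_mem_target _)
  · exact (contDiffAt_transition he (chart_mem_atlas _ _) hy (mem_chart_source _ _)).of_le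
      two_le_infty

end Smooth

lemma beta_chartAt {F : Type*} [NormedAddCommGroup F] [NormedSpace ℝ F] {f : M → F}
    (hf : ContMDiff 𝓘(ℝ, CRModel n) 𝓘(ℝ, F) 2 f) (p : M) (v : CRTangent n p) :
    S.beta f p v v
      = fderiv ℝ (fderiv ℝ (f ∘ (chartAt (CRModel n) p).symm)) (chartAt (CRModel n) p p)
          (tangentCoord p v) (tangentCoord p v)
        - fderiv ℝ (f ∘ (chartAt (CRModel n) p).symm) (chartAt (CRModel n) p p)
          (tangentCoord p (S.tanakaWebster (extendVec v) p v)) := by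
  have hd := differentiableAt_fderiv_comp_symm hf (chart_mem_atlas _ p) (chartAt_self_mem_target p)
  have hE : ((fun q ↦ diffl f q (extendVec v q)) ∘ (chartAt (CRModel n) p).symm)
      =ᶠ[𝓝 (chartAt (CRModel n) p p)]
      fun y ↦ fderiv ℝ (f ∘ (chartAt (CRModel n) p).symm) y (tangentCoord p v) := by
    filter_upwards [eventually_mem_target p] with y hy
    rw [fderiv_comp_symm_of_two hf (chart_mem_atlas _ p) hy, Function.comp_apply,
      extendVec_chartAt v hy]
  have hd' : DifferentiableAt ℝ
      ((fun q ↦ diffl f q (extendVec v q)) ∘ (chartAt (CRModel n) p).symm)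
      (chartAt (CRModel n) p p) :=
    (hd.clm_apply (differentiableAt_const _)).congr_of_eventuallyEq hE
  rw [beta, diffl_eq_fderiv_chartAt (mdifferentiableAt_of_comp_symm hd'), hE.fderiv_eq,
    fderiv_clm_apply_const hd, diffl_eq_fderiv_chartAt (mdifferentiableAt_of_two hf p)]

variable {e : OpenPartialHomeomorph M (CRModel n)} (he : e ∈ atlas (CRModel n) M)
  {y : CRModel n} (hy : y ∈ e.target)
include he hy

lemma fderiv_coordG_transition (u v w : CRModel n) :
    fderiv ℝ (S.coordG e) y u v w
      = fderiv ℝ (S.coordG (chartAt (CRModel n) (e.symm y)))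
          (chartAt (CRModel n) (e.symm y) (e.symm y))
          (fderiv ℝ (chartAt (CRModel n) (e.symm y) ∘ e.symm) y u)
          (fderiv ℝ (chartAt (CRModel n) (e.symm y) ∘ e.symm) y v)
          (fderiv ℝ (chartAt (CRModel n) (e.symm y) ∘ e.symm) y w)
        + S.coordG (chartAt (CRModel n) (e.symm y)) (chartAt (CRModel n) (e.symm y) (e.symm y))
          (fderiv ℝ (fderiv ℝ (chartAt (CRModel n) (e.symm y) ∘ e.symm)) y u v)
          (fderiv ℝ (chartAt (CRModel n) (e.symm y) ∘ e.symm) y w)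
        + S.coordG (chartAt (CRModel n) (e.symm y)) (chartAt (CRModel n) (e.symm y) (e.symm y))
          (fderiv ℝ (chartAt (CRModel n) (e.symm y) ∘ e.symm) y v)
          (fderiv ℝ (fderiv ℝ (chartAt (CRModel n) (e.symm y) ∘ e.symm)) y u w) := by
  refine fderiv_pullback_bilin (τ := chartAt (CRModel n) (e.symm y) ∘ e.symm) ?_
    (S.differentiableAt_coordG he hy) ?_ ?_ u v w
  · filter_upwards [eventually_transition e hy] with z hz v w
    have hz2 : chartAt (CRModel n) (e.symm y) (e.symm z)
        ∈ (chartAt (CRModel n) (e.symm y)).target := (chartAt _ _).map_source hz.2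
    rw [S.coordG_apply he hz.1, Function.comp_apply, S.coordG_apply (chart_mem_atlas _ _) hz2]
    exact chartDeriv_transition he (chart_mem_atlas _ _)
      (fun x A ↦ S.webster x (A v) (A w)) hz.1 hz.2
  · exact S.differentiableAt_coordG (chart_mem_atlas _ _) (chartAt_self_mem_target _)
  · exact (contDiffAt_transition he (chart_mem_atlas _ _) hy (mem_chart_source _ _)).of_le
      two_le_infty

lemma coordG_chartAt (v w : CRModel n) :
    S.coordG e y v w
      = S.coordG (chartAt (CRModel n) (e.symm y)) (chartAt (CRModel n) (e.symm y) (e.symm y))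
          (fderiv ℝ (chartAt (CRModel n) (e.symm y) ∘ e.symm) y v)
          (fderiv ℝ (chartAt (CRModel n) (e.symm y) ∘ e.symm) y w) := by
  rw [S.coordG_apply he hy, webster_chartAt, tangentCoord_chartDeriv he hy,
    tangentCoord_chartDeriv he hy]

lemma coordθ_chartAt (v : CRModel n) :
    S.coordθ e y v
      = S.coordθ (chartAt (CRModel n) (e.symm y)) (chartAt (CRModel n) (e.symm y) (e.symm y))
          (fderiv ℝ (chartAt (CRModel n) (e.symm y) ∘ e.symm) y v) := by
  rw [coordθ_apply, θ_chartAt, tangentCoord_chartDeriv he hy]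

/-- The tension in an arbitrary chart. The vectors `b a` form the horizontal orthonormal frame and
`N a` stands for the Tanaka-Webster derivative of the coordinate field `b a` along itself, which is
determined by its `θ`-component and by the Christoffel symbols of the Webster metric. -/
lemma exists_coordFrame : ∃ b N : Fin (2 * n) → CRModel n,
    (∀ a, chartDeriv e y (b a) = S.frame (e.symm y) a) ∧
    (∀ a, S.coordθ e y (N a) = fderiv ℝ (S.coordθ e) y (b a) (b a)) ∧
    (∀ a z, S.coordθ e y z = 0 → S.coordG e y (N a) z
      = fderiv ℝ (S.coordG e) y (b a) (b a) z
        - (1 / 2) * fderiv ℝ (S.coordG e) y z (b a) (b a)) ∧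
    ∀ (F : Type) [NormedAddCommGroup F] [NormedSpace ℝ F] (f : M → F),
      ContMDiff 𝓘(ℝ, CRModel n) 𝓘(ℝ, F) 2 f → S.tension f (e.symm y)
        = ∑ a, (fderiv ℝ (fderiv ℝ (f ∘ e.symm)) y (b a) (b a)
            - fderiv ℝ (f ∘ e.symm) y (N a)) := by
  set p := e.symm y with hp
  set κ := chartAt (CRModel n) p with hκ
  set τ := κ ∘ e.symm with hτ
  choose b hb using fun a ↦ chartDeriv_surjective he hy (S.frame (e.symm y) a)
  have hsurj : ∀ w : CRModel n, ∃ u, fderiv ℝ τ y u = w := by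
    intro w
    obtain ⟨u, hu⟩ := chartDeriv_surjective he hy ((tangentCoord (e.symm y)).symm w)
    refine ⟨u, ?_⟩
    have h := tangentCoord_chartDeriv he hy u
    rw [hu] at h
    simpa using h.symm
  have hLb : ∀ a, fderiv ℝ τ y (b a) = tangentCoord p (S.frame p a) := by
    intro a
    rw [← tangentCoord_chartDeriv he hy, hb]
  -- the second derivative of the change of charts is absorbed into `N`
  choose N hN using fun a ↦ hsurj (tangentCoord p (S.tanakaWebster (extendVec (S.frame p a)) p
    (S.frame p a)) + fderiv ℝ (fderiv ℝ τ) y (b a) (b a))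
  refine ⟨b, N, hb, fun a ↦ ?_, fun a z hz ↦ ?_, fun F _ _ f hf ↦ ?_⟩
  · rw [S.fderiv_coordθ_transition he hy, S.coordθ_chartAt he hy, hN, map_add, ← θ_chartAt,
      S.θ_tanakaWebster p (S.θ_frame p a), hLb]
  · have hz' : S.θ p (chartDeriv e y z) = 0 := hz
    have h1 := S.webster_tanakaWebster p (S.θ_frame p a) hz'
    rw [webster_chartAt, tangentCoord_chartDeriv he hy] at h1
    rw [S.coordG_chartAt he hy, hN, map_add, add_apply, h1, S.fderiv_coordG_transition he hy,
      S.fderiv_coordG_transition he hy, sndFDeriv_transition_symm he hy z (b a), ← hp, ← hκ, ← hτ,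
      hLb, S.coordG_symm (chart_mem_atlas _ p) (chartAt_self_mem_target p)
        (fderiv ℝ (fderiv ℝ τ) y (b a) z)]
    ring
  · rw [tension]
    refine Finset.sum_congr rfl fun a _ ↦ ?_
    have h2 : fderiv ℝ (f ∘ e.symm) y (N a) = fderiv ℝ (f ∘ κ.symm) (κ p) (fderiv ℝ τ y (N a)) := by
      rw [fderiv_comp_symm_of_two hf he hy, diffl_eq_fderiv_chartAt (mdifferentiableAt_of_two hf _),
        tangentCoord_chartDeriv he hy]
    rw [S.beta_chartAt hf, sndFDeriv_comp_symm_transition hf he hy, h2, hN, map_add, ← hp, ← hκ,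
      ← hτ, hLb]
    abel

end StrictlyPseudoconvexCR

/-! ### Semi-isometric maps -/

/-- A family of `dim V` vectors that is orthonormal for a bilinear form `g` is a basis, in which
coordinates are computed by `g`. -/
lemma exists_basis_of_orthonormal {V ι : Type*} [AddCommGroup V] [Module ℝ V] [Fintype ι]
    [DecidableEq ι] [FiniteDimensional ℝ V] (g : V →ₗ[ℝ] V →ₗ[ℝ] ℝ) (B : ι → V)
    (h : ∀ i j, g (B i) (B j) = if i = j then 1 else 0)
    (hc : Fintype.card ι = Module.finrank ℝ V) :
    ∃ b : Module.Basis ι ℝ V, (∀ i, b i = B i) ∧ ∀ v i, b.repr v i = g v (B i) := by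
  have hli : LinearIndependent ℝ B := by
    rw [Fintype.linearIndependent_iff]
    intro c hc j
    have h1 := congrArg (fun v ↦ g v (B j)) hc
    simpa [map_sum, LinearMap.sum_apply, h] using h1
  let b := basisOfLinearIndependentOfCardEqFinrank' B hli hc
  have hb : ∀ i, b i = B i := fun i ↦ by simp [b]
  refine ⟨b, hb, fun v i ↦ ?_⟩
  conv_rhs => rw [← b.sum_repr v]
  simp [map_sum, LinearMap.sum_apply, h, hb]

namespace StrictlyPseudoconvexCR

variable {n : ℕ} {M : Type*} [TopologicalSpace M] [ChartedSpace (CRModel n) M]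
  [IsManifold 𝓘(ℝ, CRModel n) ∞ M] [T2Space M] (S : StrictlyPseudoconvexCR n M)

section SemiIsometric

variable {m : ℕ} {f : M → EuclideanSpace ℝ (Fin m)}

lemma inner_diffl_of_horizontal (hfiso : S.IsSemiIsometric f) {p : M} {v w : CRTangent n p}
    (hv : S.θ p v = 0) (hw : S.θ p w = 0) :
    inner ℝ (diffl f p v) (diffl f p w) = S.levi p v w := by
  have hsq : ∀ u : CRTangent n p, S.θ p u = 0 → ‖diffl f p u‖ ^ 2 = S.levi p u u := by
    intro u hu
    rw [(hfiso p u hu).1, Real.sq_sqrt]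
    by_cases h0 : u = 0
    · simp [h0, levi_eq]
    · exact (S.levi_pos p u hu h0).le
  have h1 := hsq (v + w) (by simp [hv, hw])
  have h2 := hsq v hv
  have h3 := hsq w hw
  rw [map_add, norm_add_sq_real, h2, h3] at h1
  have h4 : S.levi p (v + w) (v + w) = S.levi p v v + S.levi p v w + S.levi p w v
      + S.levi p w w := by
    simp only [levi_eq, map_add, LinearMap.add_apply]
    ring
  have h5 : S.levi p w v = S.levi p v w := by
    rw [levi_eq, levi_eq, (S.leviSpace p).levi_symm (v := v) (w := w) hv hw]
  linarith

/-- The metric induced by a semi-isometric map differs from the Webster metric by a multiple of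
`θ ⊗ θ`. -/
lemma inner_diffl (hfiso : S.IsSemiIsometric f) (p : M) (v w : CRTangent n p) :
    inner ℝ (diffl f p v) (diffl f p w)
      = S.webster p v w + (‖diffl f p (S.reeb p)‖ ^ 2 - 1) * (S.θ p v * S.θ p w) := by
  have hdec : ∀ u : CRTangent n p, diffl f p u
      = diffl f p (S.horiz p u) + S.θ p u • diffl f p (S.reeb p) := by
    intro u
    rw [← map_smul, ← map_add]
    simp [horiz]
  have h1 := (hfiso p _ (S.θ_horiz p v)).2
  have h2 := (hfiso p _ (S.θ_horiz p w)).2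
  have h2' : inner ℝ (diffl f p (S.reeb p)) (diffl f p (S.horiz p w)) = 0 := by
    rw [real_inner_comm, h2]
  rw [hdec v, hdec w, inner_add_left, inner_add_right, inner_add_right, inner_smul_left,
    inner_smul_right, inner_smul_right, inner_smul_left, h1, h2',
    S.inner_diffl_of_horizontal hfiso (S.θ_horiz p v) (S.θ_horiz p w),
    real_inner_self_eq_norm_sq, webster]
  simp
  ring

variable (hf : ContMDiff 𝓘(ℝ, CRModel n) 𝓘(ℝ, EuclideanSpace ℝ (Fin m)) 2 f)
  (hfiso : S.IsSemiIsometric f)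
  {e : OpenPartialHomeomorph M (CRModel n)} (he : e ∈ atlas (CRModel n) M)
  {y : CRModel n} (hy : y ∈ e.target)
include hf hfiso he hy

lemma inner_fderiv_comp_symm (v w : CRModel n) :
    inner ℝ (fderiv ℝ (f ∘ e.symm) y v) (fderiv ℝ (f ∘ e.symm) y w)
      = S.coordG e y v w + (‖fderiv ℝ (f ∘ e.symm) y (S.coordξ e y)‖ ^ 2 - 1)
        * (S.coordθ e y v * S.coordθ e y w) := by
  rw [fderiv_comp_symm_of_two hf he hy, fderiv_comp_symm_of_two hf he hy,
    fderiv_comp_symm_of_two hf he hy, S.inner_diffl hfiso, S.coordG_apply he hy,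
    S.chartDeriv_coordξ he hy, coordθ_apply, coordθ_apply]

/-- In directions horizontal at `y`, the metric induced by `f` and the Webster metric have the same
first derivatives at `y`, because `θ ⊗ θ` vanishes there to second order. -/
lemma fderiv_coordG_of_horizontal {v w : CRModel n} (hv : S.coordθ e y v = 0)
    (hw : S.coordθ e y w = 0) (u : CRModel n) :
    fderiv ℝ (S.coordG e) y u v w
      = inner ℝ (fderiv ℝ (fderiv ℝ (f ∘ e.symm)) y u v) (fderiv ℝ (f ∘ e.symm) y w)
        + inner ℝ (fderiv ℝ (f ∘ e.symm) y v) (fderiv ℝ (fderiv ℝ (f ∘ e.symm)) y u w) := by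
  have hd := differentiableAt_fderiv_comp_symm hf he hy
  have hg := S.differentiableAt_coordG he hy
  have hθ := S.differentiableAt_coordθ he hy
  have hξ := S.differentiableAt_coordξ he hy
  have hq : DifferentiableAt ℝ
      (fun z ↦ ‖fderiv ℝ (f ∘ e.symm) z (S.coordξ e z)‖ ^ 2 - 1) y :=
    ((hd.clm_apply hξ).norm_sq ℝ).sub_const 1
  have h1 := (hd.hasFDerivAt.clm_apply (hasFDerivAt_const v y)).inner ℝ
    (hd.hasFDerivAt.clm_apply (hasFDerivAt_const w y))
  have h2 := ((hg.hasFDerivAt.clm_apply (hasFDerivAt_const v y)).clm_apply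
    (hasFDerivAt_const w y)).add (hq.hasFDerivAt.mul
      ((hθ.hasFDerivAt.clm_apply (hasFDerivAt_const v y)).mul
        (hθ.hasFDerivAt.clm_apply (hasFDerivAt_const w y))))
  have hE : (fun z ↦ inner ℝ (fderiv ℝ (f ∘ e.symm) z v) (fderiv ℝ (f ∘ e.symm) z w))
      =ᶠ[𝓝 y] _ := (e.open_target.eventually_mem hy).mono fun z hz ↦
        S.inner_fderiv_comp_symm hf hfiso he hz v w
  have h3 := congrArg (fun L : CRModel n →L[ℝ] ℝ ↦ L u)
    (h1.unique (h2.congr_of_eventuallyEq hE))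
  simp [hv, hw] at h3
  linarith

/-- By the first derivatives of the induced metric, `N a` and the second derivative of `f` along
`b a` have the same scalar product with every horizontal direction. -/
lemma inner_tension_chart {z : CRModel n} (hz : S.coordθ e y z = 0) :
    inner ℝ (S.tension f (e.symm y)) (fderiv ℝ (f ∘ e.symm) y z) = 0 := by
  obtain ⟨b, N, hb, -, hNg, hten⟩ := S.exists_coordFrame he hy
  rw [hten _ f hf, sum_inner]
  refine Finset.sum_eq_zero fun a _ ↦ ?_
  have hba : S.coordθ e y (b a) = 0 := by rw [coordθ_apply, hb, θ_frame]
  have h1 := hNg a z hz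
  rw [S.fderiv_coordG_of_horizontal hf hfiso he hy hba hz,
    S.fderiv_coordG_of_horizontal hf hfiso he hy hba hba,
    sndFDeriv_comp_symm_symm hf he hy z (b a)] at h1
  rw [inner_sub_left, S.inner_fderiv_comp_symm hf hfiso he hy, hz, h1,
    real_inner_comm (fderiv ℝ (f ∘ e.symm) y (b a))]
  ring

omit he hy

/-- The Levi tension of a semi-isometric map is orthogonal to the image of the Levi
distribution. -/
lemma inner_tension_diffl {p : M} {v : CRTangent n p} (hv : S.θ p v = 0) :
    inner ℝ (S.tension f p) (diffl f p v) = 0 := by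
  have h := S.inner_tension_chart hf hfiso (chart_mem_atlas _ p) (chartAt_self_mem_target p)
    (z := tangentCoord p v) (by rw [← θ_chartAt, hv])
  rwa [← diffl_eq_fderiv_chartAt (mdifferentiableAt_of_two hf p), symm_chartAt_self] at h

end SemiIsometric

/-! ### The carré du champ of the sub-Laplacian -/

/-- The horizontal scalar product `⟨∇^H φ, ∇^H ψ⟩` of the gradients of two functions. -/
def carre (φ ψ : M → ℝ) (p : M) : ℝ :=
  ∑ a, diffl φ p (S.frame p a) * diffl ψ p (S.frame p a)

lemma gradSq_eq_carre (φ : M → ℝ) (p : M) : S.gradSq φ p = S.carre φ φ p := by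
  simp [gradSq, carre, sq]

lemma carre_comm (φ ψ : M → ℝ) (p : M) : S.carre φ ψ p = S.carre ψ φ p := by
  simp [carre, mul_comm]

section Leibniz

variable {φ ψ G : M → ℝ} {p : M} (hφ : MDifferentiableAt 𝓘(ℝ, CRModel n) 𝓘(ℝ, ℝ) φ p)
  (hψ : MDifferentiableAt 𝓘(ℝ, CRModel n) 𝓘(ℝ, ℝ) ψ p)
include hφ hψ

lemma diffl_mul (v : CRTangent n p) :
    diffl (φ * ψ) p v = φ p * diffl ψ p v + ψ p * diffl φ p v := by
  have h := congrArg (fun L : CRTangent n p →L[ℝ] ℝ ↦ L v) (mvfderiv_mul hφ hψ)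
  simpa using h

lemma carre_mul (G : M → ℝ) :
    S.carre G (φ * ψ) p = φ p * S.carre G ψ p + ψ p * S.carre G φ p := by
  simp only [carre, diffl_mul hφ hψ, Finset.mul_sum, ← Finset.sum_add_distrib]
  exact Finset.sum_congr rfl fun a _ ↦ by ring

lemma carre_sub (G : M → ℝ) : S.carre G (φ - ψ) p = S.carre G φ p - S.carre G ψ p := by
  have h : ∀ v, diffl (φ - ψ) p v = diffl φ p v - diffl ψ p v := fun v ↦ by
    have h := congrArg (fun L : CRTangent n p →L[ℝ] ℝ ↦ L v) (mvfderiv_sub hφ hψ)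
    simpa using h
  simp only [carre, h, ← Finset.sum_sub_distrib]
  exact Finset.sum_congr rfl fun a _ ↦ by ring

end Leibniz

section Components

variable {m : ℕ} {f : M → EuclideanSpace ℝ (Fin m)}

/-- A component of a map into a Euclidean space. -/
def component (f : M → EuclideanSpace ℝ (Fin m)) (α : Fin m) (x : M) : ℝ := f x α

variable (hf : ContMDiff 𝓘(ℝ, CRModel n) 𝓘(ℝ, EuclideanSpace ℝ (Fin m)) 2 f)
include hf

lemma contMDiff_component (α : Fin m) :
    ContMDiff 𝓘(ℝ, CRModel n) 𝓘(ℝ, ℝ) 2 (component f α) :=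
  (EuclideanSpace.proj α : EuclideanSpace ℝ (Fin m) →L[ℝ] ℝ).contMDiff.comp hf

lemma fderiv_component_comp_symm (α : Fin m) {e : OpenPartialHomeomorph M (CRModel n)}
    (he : e ∈ atlas (CRModel n) M) {y : CRModel n} (hy : y ∈ e.target) (v : CRModel n) :
    fderiv ℝ (component f α ∘ e.symm) y v = fderiv ℝ (f ∘ e.symm) y v α := by
  have h := (EuclideanSpace.proj α : EuclideanSpace ℝ (Fin m) →L[ℝ] ℝ).hasFDerivAt.comp y
    ((contDiffAt_two_comp_symm hf he hy).differentiableAt (by simp)).hasFDerivAt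
  exact congrArg (fun L : CRModel n →L[ℝ] ℝ ↦ L v) h.fderiv

lemma diffl_component (α : Fin m) (p : M) (v : CRTangent n p) :
    diffl (component f α) p v = diffl f p v α := by
  rw [diffl_eq_fderiv_chartAt (mdifferentiableAt_of_two (contMDiff_component hf α) p),
    diffl_eq_fderiv_chartAt (mdifferentiableAt_of_two hf p),
    fderiv_component_comp_symm hf α (chart_mem_atlas _ p) (chartAt_self_mem_target p)]

lemma tension_component (α : Fin m) (p : M) :
    S.tension (component f α) p = S.tension f p α := by
  obtain ⟨b, N, -, -, -, hten⟩ :=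
    S.exists_coordFrame (chart_mem_atlas _ p) (chartAt_self_mem_target p)
  have h1 := hten _ f hf
  have h2 := hten _ _ (contMDiff_component hf α)
  rw [symm_chartAt_self] at h1 h2
  rw [h1, h2, WithLp.ofLp_sum, Finset.sum_apply]
  refine Finset.sum_congr rfl fun a _ ↦ ?_
  have hd := differentiableAt_fderiv_comp_symm hf (chart_mem_atlas _ p) (chartAt_self_mem_target p)
  have hd' := differentiableAt_fderiv_comp_symm (contMDiff_component hf α) (chart_mem_atlas _ p)
    (chartAt_self_mem_target p)
  have hE : (fun z ↦ fderiv ℝ (component f α ∘ (chartAt (CRModel n) p).symm) z (b a))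
      =ᶠ[𝓝 (chartAt (CRModel n) p p)]
      fun z ↦ (EuclideanSpace.proj α : EuclideanSpace ℝ (Fin m) →L[ℝ] ℝ)
        (fderiv ℝ (f ∘ (chartAt (CRModel n) p).symm) z (b a)) :=
    (eventually_mem_target p).mono fun z hz ↦
      fderiv_component_comp_symm hf α (chart_mem_atlas _ p) hz _
  have h3 := (EuclideanSpace.proj α : EuclideanSpace ℝ (Fin m) →L[ℝ] ℝ).hasFDerivAt.comp
    (chartAt (CRModel n) p p) (hd.hasFDerivAt.clm_apply (hasFDerivAt_const (b a) _))
  have h4 := congrArg (fun L : CRModel n →L[ℝ] ℝ ↦ L (b a)) (h3.congr_of_eventuallyEq hE).fderiv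
  simp only [fderiv_clm_apply_const hd'] at h4
  rw [h4, fderiv_component_comp_symm hf α (chart_mem_atlas _ p) (chartAt_self_mem_target p)]
  simp

lemma norm_tension_sq (p : M) :
    ‖S.tension f p‖ ^ 2 = ∑ α, S.tension (component f α) p ^ 2 := by
  rw [EuclideanSpace.norm_sq_eq]
  exact Finset.sum_congr rfl fun α _ ↦ by rw [S.tension_component hf, Real.norm_eq_abs, sq_abs]

variable (hfiso : S.IsSemiIsometric f)
include hfiso

lemma inner_diffl_frame (p : M) (a b) :
    inner ℝ (diffl f p (S.frame p a)) (diffl f p (S.frame p b)) = if a = b then 1 else 0 := by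
  rw [S.inner_diffl_of_horizontal hfiso (S.θ_frame p a) (S.θ_frame p b), (S.frame_spec p).2]

/-- The horizontal part of `df` is isometric, so the products `⟨∇^H f α, ∇^H φ⟩`, the components of
`df (∇^H φ)`, determine the scalar products of horizontal gradients. -/
lemma sum_carre_component_mul (φ ψ : M → ℝ) (p : M) :
    ∑ α, S.carre (component f α) φ p * S.carre (component f α) ψ p = S.carre φ ψ p := by
  have h : ∀ a b, ∑ α, diffl (component f α) p (S.frame p a)
      * diffl (component f α) p (S.frame p b) = if a = b then 1 else 0 := by
    intro a b
    rw [← S.inner_diffl_frame hf hfiso p a b, PiLp.inner_apply]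
    refine Finset.sum_congr rfl fun α _ ↦ ?_
    rw [diffl_component hf, diffl_component hf]
    simp [mul_comm]
  calc ∑ α, S.carre (component f α) φ p * S.carre (component f α) ψ p
      = ∑ a, ∑ b, (diffl φ p (S.frame p a) * diffl ψ p (S.frame p b)) *
        ∑ α, diffl (component f α) p (S.frame p a) * diffl (component f α) p (S.frame p b) := by
        simp only [carre, Finset.sum_mul_sum]
        simp only [Finset.mul_sum]
        rw [Finset.sum_comm]
        refine Finset.sum_congr rfl fun a _ ↦ ?_
        rw [Finset.sum_comm]
        exact Finset.sum_congr rfl fun b _ ↦ Finset.sum_congr rfl fun α _ ↦ by ring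
    _ = S.carre φ ψ p := by simp [h, carre]

lemma sum_carre_component_self (p : M) :
    ∑ α, S.carre (component f α) (component f α) p = 2 * n := by
  have h : ∀ a, ∑ α, diffl (component f α) p (S.frame p a)
      * diffl (component f α) p (S.frame p a) = 1 := by
    intro a
    have := S.inner_diffl_frame hf hfiso p a a
    rw [if_pos rfl, PiLp.inner_apply] at this
    rw [← this]
    refine Finset.sum_congr rfl fun α _ ↦ ?_
    rw [diffl_component hf]
    simp [sq]
  simp only [carre]
  rw [Finset.sum_comm]
  simp [h]

/-- The tension is orthogonal to `df (∇^H φ)`. -/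
lemma sum_tension_mul_carre (φ : M → ℝ) (p : M) :
    ∑ α, S.tension (component f α) p * S.carre (component f α) φ p = 0 := by
  have h : ∀ a, ∑ α, S.tension (component f α) p * diffl (component f α) p (S.frame p a) = 0 := by
    intro a
    rw [← S.inner_tension_diffl hf hfiso (S.θ_frame p a), PiLp.inner_apply]
    refine Finset.sum_congr rfl fun α _ ↦ ?_
    rw [diffl_component hf, S.tension_component hf]
    simp [mul_comm]
  calc ∑ α, S.tension (component f α) p * S.carre (component f α) φ p
      = ∑ a, diffl φ p (S.frame p a) * ∑ α, S.tension (component f α) p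
        * diffl (component f α) p (S.frame p a) := by
        simp only [carre, Finset.mul_sum]
        rw [Finset.sum_comm]
        exact Finset.sum_congr rfl fun b _ ↦ Finset.sum_congr rfl fun α _ ↦ by ring
    _ = 0 := by simp [h]

end Components

end StrictlyPseudoconvexCR

/-! ### Linear algebra of orthonormal bases and determinants -/

/-- The derivative of the determinant at the identity matrix is the trace. -/
lemma hasFDerivAt_det_of_eq_one {E ι : Type*} [NormedAddCommGroup E] [NormedSpace ℝ E] [Fintype ι]
    [DecidableEq ι] {A : E → Matrix ι ι ℝ} {A' : ι → ι → E →L[ℝ] ℝ} {y : E}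
    (h : ∀ i j, HasFDerivAt (fun z ↦ A z i j) (A' i j) y) (h1 : A y = 1) :
    HasFDerivAt (fun z ↦ (A z).det) (∑ i, A' i i) y := by
  have hσ : ∀ σ : Equiv.Perm ι, HasFDerivAt
      (fun z ↦ ((Equiv.Perm.sign σ : ℤ) : ℝ) * ∏ i, A z (σ i) i)
      (if σ = 1 then ∑ i, A' i i else 0) y := by
    intro σ
    have h2 := (HasFDerivAt.finsetProd (u := Finset.univ)
      (g := fun i z ↦ A z (σ i) i) fun i _ ↦ h (σ i) i).const_mul
        ((Equiv.Perm.sign σ : ℤ) : ℝ)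
    refine h2.congr_fderiv ?_
    split_ifs with hs
    · subst hs
      simp only [Equiv.Perm.sign_one, Equiv.Perm.one_apply, h1, Matrix.one_apply_eq,
        Finset.prod_const_one, one_smul]
      simp
    · rw [Finset.sum_eq_zero, smul_zero]
      intro i _
      obtain ⟨j, hji, hj⟩ : ∃ j, j ≠ i ∧ σ j ≠ j := by
        by_contra! hcon
        apply hs
        have : σ i = i := by
          by_contra hi
          have := hcon (σ i) hi
          exact hi (σ.injective this)
        ext j
        by_cases hj : j = i
        · simp [hj, this]
        · simp [hcon j hj]
      rw [Finset.prod_eq_zero (i := j) (by simp [hji]) (by rw [h1, Matrix.one_apply_ne hj]),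
        zero_smul]
  have h3 := HasFDerivAt.fun_sum (u := Finset.univ) fun σ _ ↦ hσ σ
  simp only [Finset.sum_ite_eq', Finset.mem_univ, if_true] at h3
  refine h3.congr_of_eventuallyEq (Eventually.of_forall fun z ↦ ?_)
  simp only [Matrix.det_apply']

section Gram

variable {n : ℕ}

/-- The coordinate vectors of the model space. -/
def coordVec (n : ℕ) (i : Fin (2 * n + 1)) : CRModel n :=
  EuclideanSpace.basisFun (Fin (2 * n + 1)) ℝ i

/-- The matrix of a family of vectors of the model space, with the vectors as columns. -/
def colMatrix (B : Fin (2 * n + 1) → CRModel n) : Matrix (Fin (2 * n + 1)) (Fin (2 * n + 1)) ℝ :=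
  Matrix.of fun k i ↦ B i k

/-- The Gram matrix of a family of vectors. -/
def gram (g : CRModel n →L[ℝ] CRModel n →L[ℝ] ℝ) (B : Fin (2 * n + 1) → CRModel n) :
    Matrix (Fin (2 * n + 1)) (Fin (2 * n + 1)) ℝ :=
  Matrix.of fun i j ↦ g (B i) (B j)

lemma sum_smul_coordVec (v : CRModel n) : ∑ k, v k • coordVec n k = v :=
  (EuclideanSpace.basisFun (Fin (2 * n + 1)) ℝ).sum_repr v

lemma gram_eq (g : CRModel n →L[ℝ] CRModel n →L[ℝ] ℝ) (B : Fin (2 * n + 1) → CRModel n) :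
    gram g B = (colMatrix B).transpose * gram g (coordVec n) * colMatrix B := by
  ext i j
  simp only [gram, colMatrix, Matrix.mul_apply, Matrix.of_apply, Matrix.transpose_apply]
  conv_lhs => rw [← sum_smul_coordVec (B i), ← sum_smul_coordVec (B j)]
  simp only [map_sum, map_smul, sum_apply, smul_apply, smul_eq_mul,
    Finset.sum_mul, Finset.mul_sum]
  exact Finset.sum_congr rfl fun k _ ↦ Finset.sum_congr rfl fun l _ ↦ by ring

lemma det_gram_eq (g : CRModel n →L[ℝ] CRModel n →L[ℝ] ℝ) (B : Fin (2 * n + 1) → CRModel n) :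
    (gram g B).det = (colMatrix B).det ^ 2 * (gram g (coordVec n)).det := by
  rw [gram_eq, Matrix.det_mul, Matrix.det_mul, Matrix.det_transpose]
  ring

/-- The logarithmic derivative of the determinant of the Gram matrix. -/
lemma hasFDerivAt_det_gram {g : CRModel n → CRModel n →L[ℝ] CRModel n →L[ℝ] ℝ} {y : CRModel n}
    (hg : DifferentiableAt ℝ g y) {B : Fin (2 * n + 1) → CRModel n} (hB : gram (g y) B = 1) :
    ∃ L : CRModel n →L[ℝ] ℝ, (∀ z, L z = ∑ i, fderiv ℝ g y z (B i) (B i)) ∧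
      HasFDerivAt (fun z ↦ (gram (g z) (coordVec n)).det)
        ((gram (g y) (coordVec n)).det • L) y := by
  have h1 : ∀ i j, HasFDerivAt (fun z ↦ gram (g z) B i j) _ y := fun i j ↦
    (hg.hasFDerivAt.clm_apply (hasFDerivAt_const (B i) y)).clm_apply (hasFDerivAt_const (B j) y)
  have h2 := hasFDerivAt_det_of_eq_one h1 hB
  have key : ∀ L : CRModel n →L[ℝ] ℝ, HasFDerivAt (fun z ↦ (gram (g z) B).det) L y →
      HasFDerivAt (fun z ↦ (gram (g z) (coordVec n)).det)
        ((gram (g y) (coordVec n)).det • L) y := by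
    intro L hL
    have hd : (colMatrix B).det ^ 2 * (gram (g y) (coordVec n)).det = 1 := by
      rw [← det_gram_eq, hB, Matrix.det_one]
    refine (hL.const_mul (gram (g y) (coordVec n)).det).congr_of_eventuallyEq
      (Eventually.of_forall fun z ↦ ?_)
    simp only [det_gram_eq _ B, ← mul_assoc]
    rw [mul_comm (gram (g y) (coordVec n)).det, hd, one_mul]
  exact ⟨_, fun z ↦ by simp, key _ h2⟩

/-- The trace of an endomorphism, computed in an orthonormal basis. -/
lemma trace_eq_of_gram_eq_one {g : CRModel n →L[ℝ] CRModel n →L[ℝ] ℝ}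
    {B : Fin (2 * n + 1) → CRModel n} (hB : gram g B = 1) (L : CRModel n →L[ℝ] CRModel n) :
    ∑ i, L (coordVec n i) i = ∑ i, g (L (B i)) (B i) := by
  obtain ⟨b, hb, hr⟩ := exists_basis_of_orthonormal
    (LinearMap.mk₂ ℝ (fun v w ↦ g v w) (by simp) (by simp) (by simp) (by simp)) B
    (fun i j ↦ by
      have := congrFun (congrFun hB i) j
      simpa [gram, Matrix.one_apply] using this) (by simp)
  have h1 := LinearMap.trace_eq_matrix_trace ℝ b L.toLinearMap
  have h2 := LinearMap.trace_eq_matrix_trace ℝ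
    (EuclideanSpace.basisFun (Fin (2 * n + 1)) ℝ).toBasis L.toLinearMap
  rw [h1] at h2
  simp only [Matrix.trace, Matrix.diag, LinearMap.toMatrix_apply, hb, hr] at h2
  simpa [coordVec] using h2.symm

lemma eq_sum_of_gram_eq_one {g : CRModel n →L[ℝ] CRModel n →L[ℝ] ℝ}
    {B : Fin (2 * n + 1) → CRModel n} (hB : gram g B = 1) (v : CRModel n) :
    v = ∑ i, g v (B i) • B i := by
  obtain ⟨b, hb, hr⟩ := exists_basis_of_orthonormal
    (LinearMap.mk₂ ℝ (fun v w ↦ g v w) (by simp) (by simp) (by simp) (by simp)) B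
    (fun i j ↦ by
      have := congrFun (congrFun hB i) j
      simpa [gram, Matrix.one_apply] using this) (by simp)
  conv_lhs => rw [← b.sum_repr v]
  simp [hb, hr]

end Gram

namespace StrictlyPseudoconvexCR

variable {n : ℕ} {M : Type*} [TopologicalSpace M] [ChartedSpace (CRModel n) M]
  [IsManifold 𝓘(ℝ, CRModel n) ∞ M] [T2Space M] (S : StrictlyPseudoconvexCR n M)

/-! ### The horizontal gradient in a chart and its divergence -/

/-- The density of the Riemannian volume of the Webster metric in the chart `e`. -/
def coordDensity (e : OpenPartialHomeomorph M (CRModel n)) (y : CRModel n) : ℝ :=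
  √((gram (S.coordG e y) (coordVec n)).det)

/-- The horizontal gradient of a function in the chart `e`. -/
def coordGrad (e : OpenPartialHomeomorph M (CRModel n)) (φ : M → ℝ) (y : CRModel n) : CRModel n :=
  (S.coordG e y).inverse
    (fderiv ℝ (φ ∘ e.symm) y - fderiv ℝ (φ ∘ e.symm) y (S.coordξ e y) • S.coordθ e y)

variable {e : OpenPartialHomeomorph M (CRModel n)} (he : e ∈ atlas (CRModel n) M)
include he

section Pointwise

variable {y : CRModel n} (hy : y ∈ e.target)
include hy

lemma coordG_coordGrad (φ : M → ℝ) (v : CRModel n) : S.coordG e y (S.coordGrad e φ y) v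
    = fderiv ℝ (φ ∘ e.symm) y v - fderiv ℝ (φ ∘ e.symm) y (S.coordξ e y) * S.coordθ e y v := by
  obtain ⟨Φ, hΦ⟩ := S.coordG_exists_equiv he hy
  rw [coordGrad, ← hΦ, ContinuousLinearMap.inverse_equiv]
  simp

lemma coordθ_coordGrad (φ : M → ℝ) : S.coordθ e y (S.coordGrad e φ y) = 0 := by
  rw [← S.coordG_coordξ he hy, S.coordG_symm he hy, S.coordG_coordGrad he hy,
    S.coordθ_coordξ he hy]
  ring

lemma gram_cons_of_orthonormal {b : Fin (2 * n) → CRModel n}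
    (h0 : ∀ a, S.coordθ e y (b a) = 0) (hlevi : ∀ i j, S.levi (e.symm y)
      (chartDeriv e y (b i)) (chartDeriv e y (b j)) = if i = j then 1 else 0) :
    gram (S.coordG e y) (Fin.cons (S.coordξ e y) b : Fin (2 * n + 1) → CRModel n) = 1 := by
  ext i j
  refine Fin.cases ?_ (fun i ↦ ?_) i <;> refine Fin.cases ?_ (fun j ↦ ?_) j
  · simp [gram, S.coordG_coordξ he hy, S.coordθ_coordξ he hy]
  · simp [gram, S.coordG_coordξ he hy, h0, (Fin.succ_ne_zero j).symm]
  · simp [gram, S.coordG_symm he hy (b i), S.coordG_coordξ he hy, h0]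
  · have h1 : ∀ a, S.θ (e.symm y) (chartDeriv e y (b a)) = 0 := h0
    simp only [gram, Matrix.of_apply, Fin.cons_succ, S.coordG_apply he hy, webster,
      S.horiz_of_θ_eq_zero (h1 _), h1, hlevi, Matrix.one_apply, Fin.succ_inj]
    simp

lemma gram_cons_coordξ {b : Fin (2 * n) → CRModel n}
    (hb : ∀ a, chartDeriv e y (b a) = S.frame (e.symm y) a) :
    gram (S.coordG e y) (Fin.cons (S.coordξ e y) b : Fin (2 * n + 1) → CRModel n) = 1 :=
  S.gram_cons_of_orthonormal he hy (fun a ↦ by rw [coordθ_apply, hb, θ_frame])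
    fun i j ↦ by rw [hb, hb, (S.frame_spec (e.symm y)).2]

lemma carre_eq_fderiv_coordGrad {φ ψ : M → ℝ}
    (hφ : MDifferentiableAt 𝓘(ℝ, CRModel n) 𝓘(ℝ, ℝ) φ (e.symm y))
    (hψ : MDifferentiableAt 𝓘(ℝ, CRModel n) 𝓘(ℝ, ℝ) ψ (e.symm y)) :
    S.carre φ ψ (e.symm y) = fderiv ℝ (ψ ∘ e.symm) y (S.coordGrad e φ y) := by
  choose b hb using fun a ↦ chartDeriv_surjective he hy (S.frame (e.symm y) a)
  have h0 : ∀ a, S.coordθ e y (b a) = 0 := fun a ↦ by rw [coordθ_apply, hb, θ_frame]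
  rw [eq_sum_of_gram_eq_one (S.gram_cons_coordξ he hy hb) (S.coordGrad e φ y), Fin.sum_univ_succ]
  simp only [Fin.cons_zero, Fin.cons_succ, S.coordG_coordGrad he hy, h0, S.coordθ_coordξ he hy]
  simp [carre, fderiv_comp_symm he hy hφ, fderiv_comp_symm he hy hψ, hb]

lemma det_gram_coordG_pos : 0 < (gram (S.coordG e y) (coordVec n)).det := by
  choose b hb using fun a ↦ chartDeriv_surjective he hy (S.frame (e.symm y) a)
  have h := det_gram_eq (S.coordG e y) (Fin.cons (S.coordξ e y) b)
  rw [S.gram_cons_coordξ he hy hb, Matrix.det_one] at h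
  by_contra! hneg
  nlinarith [sq_nonneg (colMatrix (Fin.cons (S.coordξ e y) b)).det]

lemma coordDensity_pos : 0 < S.coordDensity e y := Real.sqrt_pos.2 (S.det_gram_coordG_pos he hy)

end Pointwise

variable {φ : M → ℝ} (hφ : ContMDiff 𝓘(ℝ, CRModel n) 𝓘(ℝ, ℝ) 2 φ)

lemma contDiffOn_coordDensity : ContDiffOn ℝ ∞ (S.coordDensity e) e.target := by
  refine ContDiffOn.sqrt ?_ fun y hy ↦ (S.det_gram_coordG_pos he hy).ne'
  simp only [Matrix.det_apply', gram, Matrix.of_apply]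
  refine ContDiffOn.sum fun σ _ ↦ contDiffOn_const.mul (contDiffOn_prod fun i _ ↦ ?_)
  exact ((S.contDiffOn_coordG he).clm_apply contDiffOn_const).clm_apply contDiffOn_const

include hφ

lemma contDiffOn_coordGrad : ContDiffOn ℝ 1 (S.coordGrad e φ) e.target := by
  have h1 : ContDiffOn ℝ 1 (fderiv ℝ (φ ∘ e.symm)) e.target :=
    (contDiffOn_comp_symm (k := 2) he hφ).fderiv_of_isOpen e.open_target (by norm_num)
  have hone : (1 : WithTop ℕ∞) ≤ ((⊤ : ℕ∞) : WithTop ℕ∞) := ENat.LEInfty.out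
  refine ContDiffOn.clm_apply ?_ (h1.sub ((h1.clm_apply
    ((S.contDiffOn_coordξ he).of_le hone)).smul ((S.contDiffOn_coordθ he).of_le hone)))
  intro y hy
  obtain ⟨Φ, hΦ⟩ := S.coordG_exists_equiv he hy
  have h2 : ContDiffAt ℝ 1 ContinuousLinearMap.inverse (S.coordG e y) := by
    rw [← hΦ]
    exact contDiffAt_map_inverse Φ
  exact h2.comp_contDiffWithinAt y (((S.contDiffOn_coordG he).of_le hone) y hy)

/-- The divergence formula: the sub-Laplacian is the divergence of the horizontal gradient with
respect to the Riemannian density of the Webster metric. -/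
lemma divergence_coordGrad {y : CRModel n} (hy : y ∈ e.target) :
    ∑ i, fderiv ℝ (fun z ↦ S.coordDensity e z • S.coordGrad e φ z) y (coordVec n i) i
      = S.coordDensity e y * S.tension φ (e.symm y) := by
  obtain ⟨b, N, hb, hNθ, hNg, hten⟩ := S.exists_coordFrame he hy
  have h0 : ∀ a, S.coordθ e y (b a) = 0 := fun a ↦ by rw [coordθ_apply, hb, θ_frame]
  have hB := S.gram_cons_coordξ he hy hb
  have hdG := S.differentiableAt_coordG he hy
  have hdθ := S.differentiableAt_coordθ he hy
  have hdξ := S.differentiableAt_coordξ he hy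
  have hdφ := differentiableAt_fderiv_comp_symm hφ he hy
  have hdW : DifferentiableAt ℝ (S.coordGrad e φ) y :=
    ((S.contDiffOn_coordGrad he hφ).contDiffAt (e.open_target.mem_nhds hy)).differentiableAt
      (by simp)
  have hnhds := e.open_target.eventually_mem hy
  set W := S.coordGrad e φ y with hW
  set ξ := S.coordξ e y with hξ
  set r := fderiv ℝ (φ ∘ e.symm) y ξ with hr
  have hθW : S.coordθ e y W = 0 := S.coordθ_coordGrad he hy φ
  -- derivative of the density
  obtain ⟨L, hL, hdet⟩ := hasFDerivAt_det_gram hdG hB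
  have hdens : fderiv ℝ (S.coordDensity e) y W = S.coordDensity e y * (1 / 2 * L W) := by
    have h1 := (hdet.sqrt (S.det_gram_coordG_pos he hy).ne').fderiv
    have h2 : fderiv ℝ (S.coordDensity e) y = _ := h1
    have h3 := Real.mul_self_sqrt (S.det_gram_coordG_pos he hy).le
    have h4 := (S.coordDensity_pos he hy).ne'
    rw [h2]
    simp only [coordDensity] at h4 ⊢
    simp only [smul_apply, smul_eq_mul]
    field_simp
    rw [sq, h3]
  have hLW : L W = 2 * fderiv ℝ (S.coordθ e) y W ξ
      + ∑ a, fderiv ℝ (S.coordG e) y W (b a) (b a) := by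
    have h1 : fderiv ℝ (S.coordG e) y W ξ ξ + 2 * S.coordθ e y (fderiv ℝ (S.coordξ e) y W) = 0 := by
      have h2 := ((hdG.hasFDerivAt.clm_apply hdξ.hasFDerivAt).clm_apply hdξ.hasFDerivAt)
      have h3 : (fun z ↦ S.coordG e z (S.coordξ e z) (S.coordξ e z)) =ᶠ[𝓝 y] fun _ ↦ 1 :=
        hnhds.mono fun z hz ↦ by
          simp only [S.coordG_coordξ he hz, S.coordθ_coordξ he hz]
      have h4 := congrArg (fun l : CRModel n →L[ℝ] ℝ ↦ l W)
        (h2.unique ((hasFDerivAt_const (1 : ℝ) y).congr_of_eventuallyEq h3))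
      simp [← hξ, S.coordG_symm he hy _ ξ] at h4
      rw [hξ, S.coordG_coordξ he hy, ← hξ] at h4
      linarith
    have h5 : fderiv ℝ (S.coordθ e) y W ξ + S.coordθ e y (fderiv ℝ (S.coordξ e) y W) = 0 := by
      have h2 := hdθ.hasFDerivAt.clm_apply hdξ.hasFDerivAt
      have h3 : (fun z ↦ S.coordθ e z (S.coordξ e z)) =ᶠ[𝓝 y] fun _ ↦ 1 :=
        hnhds.mono fun z hz ↦ S.coordθ_coordξ he hz
      have h4 := congrArg (fun l : CRModel n →L[ℝ] ℝ ↦ l W)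
        (h2.unique ((hasFDerivAt_const (1 : ℝ) y).congr_of_eventuallyEq h3))
      simp [← hξ] at h4
      linarith
    rw [hL, Fin.sum_univ_succ]
    simp only [Fin.cons_zero, Fin.cons_succ]
    linarith
  -- along `ξ`, using `dθ(ξ, ·) = 0` to exchange the two arguments of the derivative of `θ`
  have hWξ : S.coordG e y (fderiv ℝ (S.coordGrad e φ) y ξ) ξ = -fderiv ℝ (S.coordθ e) y W ξ := by
    have h2 := hdθ.hasFDerivAt.clm_apply hdW.hasFDerivAt
    have h3 : (fun z ↦ S.coordθ e z (S.coordGrad e φ z)) =ᶠ[𝓝 y] fun _ ↦ 0 :=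
      hnhds.mono fun z hz ↦ S.coordθ_coordGrad he hz φ
    have h4 := congrArg (fun l : CRModel n →L[ℝ] ℝ ↦ l ξ)
      (h2.unique ((hasFDerivAt_const (0 : ℝ) y).congr_of_eventuallyEq h3))
    have h5 := S.coorddθ_coordξ he hy W
    simp only [coorddθ, ← hξ] at h5
    simp at h4 h5
    rw [S.coordG_symm he hy, hξ, S.coordG_coordξ he hy, ← hξ]
    linarith
  have hWb : ∀ a, S.coordG e y (fderiv ℝ (S.coordGrad e φ) y (b a)) (b a)
      = fderiv ℝ (fderiv ℝ (φ ∘ e.symm)) y (b a) (b a) - r * fderiv ℝ (S.coordθ e) y (b a) (b a)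
        - fderiv ℝ (S.coordG e) y (b a) (b a) W := by
    intro a
    have h2 := (hdG.hasFDerivAt.clm_apply hdW.hasFDerivAt).clm_apply (hasFDerivAt_const (b a) y)
    have h3 := (hdφ.hasFDerivAt.clm_apply (hasFDerivAt_const (b a) y)).sub
      ((hdφ.hasFDerivAt.clm_apply hdξ.hasFDerivAt).mul
        (hdθ.hasFDerivAt.clm_apply (hasFDerivAt_const (b a) y)))
    have h4 := congrArg (fun l : CRModel n →L[ℝ] ℝ ↦ l (b a)) (h2.unique (h3.congr_of_eventuallyEq
      (hnhds.mono fun z hz ↦ S.coordG_coordGrad he hz φ (b a))))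
    have h5 : fderiv ℝ (S.coordG e) y (b a) (b a) W = fderiv ℝ (S.coordG e) y (b a) W (b a) := by
      have h6 := (hdG.hasFDerivAt.clm_apply (hasFDerivAt_const (b a) y)).clm_apply
        (hasFDerivAt_const W y)
      have h7 := (hdG.hasFDerivAt.clm_apply (hasFDerivAt_const W y)).clm_apply
        (hasFDerivAt_const (b a) y)
      have h8 := congrArg (fun l : CRModel n →L[ℝ] ℝ ↦ l (b a))
        (h6.unique (h7.congr_of_eventuallyEq (hnhds.mono fun z hz ↦ S.coordG_symm he hz _ _)))
      simpa using h8
    simp [h0, ← hW, ← hξ, ← hr] at h4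
    rw [h5]
    linarith
  have hNφ : ∀ a, fderiv ℝ (φ ∘ e.symm) y (N a) = fderiv ℝ (S.coordG e) y (b a) (b a) W
      - 1 / 2 * fderiv ℝ (S.coordG e) y W (b a) (b a)
      + r * fderiv ℝ (S.coordθ e) y (b a) (b a) := by
    intro a
    have h1 := S.coordG_coordGrad he hy φ (N a)
    rw [S.coordG_symm he hy, hNg a _ hθW, hNθ] at h1
    linarith
  -- the divergence is a trace, computed in the orthonormal frame `ξ, b a`
  have hprod : ∀ i, fderiv ℝ (fun z ↦ S.coordDensity e z • S.coordGrad e φ z) y (coordVec n i) i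
      = S.coordDensity e y * fderiv ℝ (S.coordGrad e φ) y (coordVec n i) i
        + fderiv ℝ (S.coordDensity e) y (W i • coordVec n i) := by
    intro i
    have hdd : DifferentiableAt ℝ (S.coordDensity e) y :=
      ((S.contDiffOn_coordDensity he).contDiffAt (e.open_target.mem_nhds hy)).differentiableAt
        (by simp)
    rw [fderiv_fun_smul hdd hdW]
    simp [← hW, mul_comm]
  simp only [hprod, Finset.sum_add_distrib, ← map_sum, sum_smul_coordVec, ← Finset.mul_sum]
  rw [hdens, trace_eq_of_gram_eq_one hB, hten ℝ φ hφ, Fin.sum_univ_succ]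
  simp only [Fin.cons_zero, Fin.cons_succ, hWξ, hWb, hNφ, hLW, Finset.sum_sub_distrib,
    Finset.sum_add_distrib, ← Finset.mul_sum]
  ring

end StrictlyPseudoconvexCR

/-! ### The volume form and the Riemannian density -/

section Wedge

variable {n : ℕ} {V : Type*} [AddCommGroup V] [Module ℝ V]

/-- The multilinear form `θ ⊗ B ⊗ ⋯ ⊗ B` as a function. -/
def tensorPow (θ : V →ₗ[ℝ] ℝ) (B : V →ₗ[ℝ] V →ₗ[ℝ] ℝ) (v : Fin (2 * n + 1) → V) : ℝ :=
  θ (v 0) * ∏ i : Fin n, B (v ⟨2 * i.1 + 1, by omega⟩) (v ⟨2 * i.1 + 2, by omega⟩)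

/-- `θ ⊗ B ⊗ ⋯ ⊗ B` is linear in each slot. -/
lemma exists_linear_tensorPow_update (θ : V →ₗ[ℝ] ℝ) (B : V →ₗ[ℝ] V →ₗ[ℝ] ℝ)
    (v : Fin (2 * n + 1) → V) (j : Fin (2 * n + 1)) :
    ∃ L : V →ₗ[ℝ] ℝ, ∀ x, tensorPow θ B (Function.update v j x) = L x := by
  have hpair : ∀ k : Fin n, (∃ Λ : V →ₗ[ℝ] ℝ, ∀ x,
      B (Function.update v j x ⟨2 * k.1 + 1, by omega⟩)
        (Function.update v j x ⟨2 * k.1 + 2, by omega⟩) = Λ x) →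
      j ≠ 0 → (∀ i : Fin n, i ≠ k → (⟨2 * i.1 + 1, by omega⟩ : Fin (2 * n + 1)) ≠ j
        ∧ (⟨2 * i.1 + 2, by omega⟩ : Fin (2 * n + 1)) ≠ j) →
      ∃ L : V →ₗ[ℝ] ℝ, ∀ x, tensorPow θ B (Function.update v j x) = L x := by
    rintro k ⟨Λ, hΛ⟩ hj hne
    refine ⟨(θ (v 0) * ∏ i ∈ Finset.univ.erase k,
      B (v ⟨2 * i.1 + 1, by omega⟩) (v ⟨2 * i.1 + 2, by omega⟩)) • Λ, fun x ↦ ?_⟩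
    rw [tensorPow, ← Finset.mul_prod_erase Finset.univ _ (Finset.mem_univ k), hΛ,
      Function.update_of_ne hj.symm]
    have : ∏ i ∈ Finset.univ.erase k, B (Function.update v j x ⟨2 * i.1 + 1, by omega⟩)
        (Function.update v j x ⟨2 * i.1 + 2, by omega⟩)
        = ∏ i ∈ Finset.univ.erase k,
          B (v ⟨2 * i.1 + 1, by omega⟩) (v ⟨2 * i.1 + 2, by omega⟩) := by
      refine Finset.prod_congr rfl fun i hi ↦ ?_
      have hik := hne i (Finset.ne_of_mem_erase hi)
      rw [Function.update_of_ne hik.1, Function.update_of_ne hik.2]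
    rw [this]
    simp
    ring
  have hjlt := j.2
  rcases Nat.eq_zero_or_pos j.1 with h0 | hpos
  · have hj : j = 0 := Fin.ext h0
    refine ⟨(∏ i : Fin n, B (v ⟨2 * i.1 + 1, by omega⟩) (v ⟨2 * i.1 + 2, by omega⟩)) • θ,
      fun x ↦ ?_⟩
    have : ∀ i : Fin n, (⟨2 * i.1 + 1, by omega⟩ : Fin (2 * n + 1)) ≠ j
        ∧ (⟨2 * i.1 + 2, by omega⟩ : Fin (2 * n + 1)) ≠ j := fun i ↦ by
      simp only [Ne, Fin.ext_iff]
      omega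
    simp only [tensorPow, Function.update_of_ne (this _).1, Function.update_of_ne (this _).2]
    subst hj
    simp [mul_comm]
  · rcases Nat.even_or_odd' (j.1 - 1) with ⟨k, hk | hk⟩
    · have hkn : k < n := by omega
      have hj : j = ⟨2 * k + 1, by omega⟩ := Fin.ext (by simp; omega)
      refine hpair ⟨k, hkn⟩ ⟨B.flip (v ⟨2 * k + 2, by omega⟩), fun x ↦ ?_⟩ ?_ fun i hi ↦ ?_
      · have hne : (⟨2 * k + 2, by omega⟩ : Fin (2 * n + 1)) ≠ j := by
          rw [Ne, Fin.ext_iff]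
          simp
          omega
        simp only [← hj, Function.update_self, Function.update_of_ne hne]
        rfl
      · rw [Ne, Fin.ext_iff, Fin.val_zero]
        omega
      · have : i.1 ≠ k := fun h ↦ hi (Fin.ext h)
        simp only [Ne, Fin.ext_iff]
        omega
    · have hkn : k < n := by omega
      have hj : j = ⟨2 * k + 2, by omega⟩ := Fin.ext (by simp; omega)
      refine hpair ⟨k, hkn⟩ ⟨B (v ⟨2 * k + 1, by omega⟩), fun x ↦ ?_⟩ ?_ fun i hi ↦ ?_
      · have hne : (⟨2 * k + 1, by omega⟩ : Fin (2 * n + 1)) ≠ j := by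
          rw [Ne, Fin.ext_iff]
          simp
          omega
        simp only [← hj, Function.update_self, Function.update_of_ne hne]
      · rw [Ne, Fin.ext_iff, Fin.val_zero]
        omega
      · have : i.1 ≠ k := fun h ↦ hi (Fin.ext h)
        simp only [Ne, Fin.ext_iff]
        omega

/-- `θ ⊗ B ⊗ ⋯ ⊗ B` as a multilinear form. -/
def tensorPowMultilinear (n : ℕ) (θ : V →ₗ[ℝ] ℝ) (B : V →ₗ[ℝ] V →ₗ[ℝ] ℝ) :
    MultilinearMap ℝ (fun _ : Fin (2 * n + 1) ↦ V) ℝ :=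
  MultilinearMap.mk' (tensorPow θ B)
    (fun v j x y ↦ by
      obtain ⟨L, hL⟩ := exists_linear_tensorPow_update θ B v j
      simp only [hL, map_add])
    (fun v j c x ↦ by
      obtain ⟨L, hL⟩ := exists_linear_tensorPow_update θ B v j
      simp only [hL, map_smul])

lemma alternatization_tensorPow (θ : V →ₗ[ℝ] ℝ) (B : V →ₗ[ℝ] V →ₗ[ℝ] ℝ)
    (v : Fin (2 * n + 1) → V) :
    MultilinearMap.alternatization (tensorPowMultilinear n θ B) v
      = ∑ σ : Equiv.Perm (Fin (2 * n + 1)), ((Equiv.Perm.sign σ : ℤ) : ℝ) *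
          tensorPow θ B (fun i ↦ v (σ i)) := by
  rw [MultilinearMap.alternatization_apply]
  refine Finset.sum_congr rfl fun σ _ ↦ ?_
  rw [Units.smul_def, zsmul_eq_mul]
  rfl

end Wedge

namespace StrictlyPseudoconvexCR

variable {n : ℕ} {M : Type*} [TopologicalSpace M] [ChartedSpace (CRModel n) M]
  [IsManifold 𝓘(ℝ, CRModel n) ∞ M] [T2Space M] (S : StrictlyPseudoconvexCR n M)

lemma volForm_eq (p : M) (v : Fin (2 * n + 1) → CRTangent n p) :
    S.volForm p v = (1 / (2 ^ n * (n.factorial : ℝ))) * ((1 / 2 ^ n) *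
      MultilinearMap.alternatization
        (tensorPowMultilinear n (S.leviSpace p).θ (S.leviSpace p).B) v) := by
  rw [alternatization_tensorPow]
  rfl

/-- An identification of the index set of a horizontal frame with that of a unitary one. -/
def frameIndex (n : ℕ) : Fin (2 * n) ≃ Fin n ⊕ Fin n :=
  Fintype.equivOfCardEq (by simp; omega)

/-- The values of `dθ` on the vectors `ξ, x_1, …, x_n, J x_1, …, J x_n`, for a unitary
frame `x`. -/
def stdTwoForm (n : ℕ) : Fin (2 * n + 1) → Fin (2 * n + 1) → ℝ :=
  Fin.cons 0 fun a ↦ Fin.cons 0 fun b ↦ LeviSpace.stdSymplectic n (frameIndex n a) (frameIndex n b)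

/-- The absolute value of the volume form on the vectors `ξ, x_1, …, x_n, J x_1, …, J x_n`,
for a unitary frame `x`. It depends on `n` only, and its value is irrelevant for what follows. -/
def volConst (n : ℕ) : ℝ :=
  |(1 / (2 ^ n * (n.factorial : ℝ))) * ((1 / 2 ^ n) *
    ∑ σ : Equiv.Perm (Fin (2 * n + 1)), ((Equiv.Perm.sign σ : ℤ) : ℝ) *
      ((Fin.cons 1 0 : Fin (2 * n + 1) → ℝ) (σ 0) *
        ∏ i : Fin n, stdTwoForm n (σ ⟨2 * i.1 + 1, by omega⟩) (σ ⟨2 * i.1 + 2, by omega⟩)))|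

variable {e : OpenPartialHomeomorph M (CRModel n)} (he : e ∈ atlas (CRModel n) M)
  {y : CRModel n} (hy : y ∈ e.target)
include he hy

/-- The volume form is, up to a constant factor, the Riemannian volume of the Webster metric. -/
lemma volDensity_eq : S.volDensity e y = volConst n * S.coordDensity e y := by
  obtain ⟨x, hx, hxx, hxB⟩ := (S.leviSpace (e.symm y)).exists_unitary_frame
  choose b hb using fun a ↦ chartDeriv_surjective he hy
    ((S.leviSpace (e.symm y)).pair x (frameIndex n a))
  set B : Fin (2 * n + 1) → CRModel n := Fin.cons (S.coordξ e y) b with hBdef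
  have hgram : gram (S.coordG e y) B = 1 := by
    refine S.gram_cons_of_orthonormal he hy (fun a ↦ ?_) fun i j ↦ ?_
    · rw [coordθ_apply, hb]
      exact hx _
    · rw [hb, hb, levi_eq, hxx]
      simp
  -- the volume form in the chart, as an alternating form on the model space
  let f : CRModel n [⋀^Fin (2 * n + 1)]→ₗ[ℝ] ℝ :=
    (MultilinearMap.alternatization (tensorPowMultilinear n (S.leviSpace (e.symm y)).θ
      (S.leviSpace (e.symm y)).B)).compLinearMap (chartDeriv e y).toLinearMap
  have hfv : ∀ v, S.volForm (e.symm y) (fun i ↦ chartDeriv e y (v i))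
      = (1 / (2 ^ n * (n.factorial : ℝ))) * ((1 / 2 ^ n) * f v) := by
    intro v
    rw [volForm_eq]
    rfl
  have hfB : f B = f (coordVec n) * (colMatrix B).det := by
    have h1 := congrArg (fun g : CRModel n [⋀^Fin (2 * n + 1)]→ₗ[ℝ] ℝ ↦ g B)
      (f.eq_smul_basis_det (EuclideanSpace.basisFun (Fin (2 * n + 1)) ℝ).toBasis)
    have h2 : (EuclideanSpace.basisFun (Fin (2 * n + 1)) ℝ).toBasis.toMatrix B = colMatrix B := by
      ext i j
      simp [Module.Basis.toMatrix_apply, colMatrix]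
    have h3 : ((EuclideanSpace.basisFun (Fin (2 * n + 1)) ℝ).toBasis :
        Fin (2 * n + 1) → CRModel n) = coordVec n := by
      ext i
      simp [coordVec]
    simpa [Module.Basis.det_apply, h2, h3] using h1
  have hvolB : |S.volForm (e.symm y) (fun i ↦ chartDeriv e y (B i))| = volConst n := by
    have hθ : ∀ i, S.θ (e.symm y) (chartDeriv e y (B i))
        = (Fin.cons 1 0 : Fin (2 * n + 1) → ℝ) i := by
      intro i
      refine Fin.cases ?_ (fun i ↦ ?_) i
      · exact S.coordθ_coordξ he hy
      · rw [hBdef, Fin.cons_succ, hb]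
        exact hx _
    have hdθ : ∀ i j, S.dθ (e.symm y) (chartDeriv e y (B i)) (chartDeriv e y (B j))
        = stdTwoForm n i j := by
      intro i j
      refine Fin.cases ?_ (fun i ↦ ?_) i
      · rw [hBdef, Fin.cons_zero, S.chartDeriv_coordξ he hy, (S.reeb_spec _).2]
        rfl
      · refine Fin.cases ?_ (fun j ↦ ?_) j
        · have h1 := (S.leviSpace (e.symm y)).B_swap (chartDeriv e y (B i.succ))
            (chartDeriv e y (B 0))
          refine h1.trans ?_
          rw [hBdef, Fin.cons_zero, S.chartDeriv_coordξ he hy]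
          have h2 : (S.leviSpace (e.symm y)).B (S.reeb (e.symm y))
            (chartDeriv e y ((Fin.cons (S.coordξ e y) b : Fin (2 * n + 1) → CRModel n) i.succ))
              = 0 :=
              (S.reeb_spec _).2 _
          rw [h2]
          simp [stdTwoForm]
        · rw [hBdef, Fin.cons_succ, Fin.cons_succ, hb, hb]
          exact hxB _ _
    rw [volForm, volConst]
    simp only [hθ, hdθ]
  have hdet := det_gram_eq (S.coordG e y) B
  rw [hgram, Matrix.det_one] at hdet
  have hdens : |(colMatrix B).det| * S.coordDensity e y = 1 := by
    rw [coordDensity, ← Real.sqrt_sq_eq_abs, ← Real.sqrt_mul (sq_nonneg _), ← hdet, Real.sqrt_one]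
  have hvol : S.volDensity e y = |S.volForm (e.symm y) (fun i ↦ chartDeriv e y (coordVec n i))| :=
    rfl
  rw [← hvolB, hvol, hfv, hfv, hfB]
  simp only [abs_mul]
  linear_combination (-|1 / (2 ^ n * (n.factorial : ℝ))| * |(1 : ℝ) / 2 ^ n| * |f (coordVec n)|)
    * hdens

end StrictlyPseudoconvexCR

namespace StrictlyPseudoconvexCR

variable {n : ℕ} {M : Type*} [TopologicalSpace M] [ChartedSpace (CRModel n) M]
  [IsManifold 𝓘(ℝ, CRModel n) ∞ M] [T2Space M] (S : StrictlyPseudoconvexCR n M)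

/-! ### The measure of the volume form -/

section Chart

variable {e : OpenPartialHomeomorph M (CRModel n)} (he : e ∈ atlas (CRModel n) M)
include he

lemma continuousOn_volDensity : ContinuousOn (S.volDensity e) e.target :=
  (continuousOn_const.mul (S.contDiffOn_coordDensity he).continuousOn).congr
    fun _ hy ↦ S.volDensity_eq he hy

/-- The Riemannian density transforms by the Jacobian of the change of charts. -/
lemma coordDensity_transition {e' : OpenPartialHomeomorph M (CRModel n)}
    (he' : e' ∈ atlas (CRModel n) M) {y : CRModel n} (hy : y ∈ e.target)
    (hy' : e.symm y ∈ e'.source) :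
    S.coordDensity e y
      = |(fderiv ℝ (e' ∘ e.symm) y).det| * S.coordDensity e' (e' (e.symm y)) := by
  set L := fderiv ℝ (e' ∘ e.symm) y with hL
  have hty : e' (e.symm y) ∈ e'.target := e'.map_source hy'
  have h1 : gram (S.coordG e y) (coordVec n)
      = gram (S.coordG e' (e' (e.symm y))) (fun i ↦ L (coordVec n i)) := by
    ext i j
    simp only [gram, Matrix.of_apply, S.coordG_apply he hy, S.coordG_apply he' hty]
    exact chartDeriv_transition he he'
      (fun x A ↦ S.webster x (A (coordVec n i)) (A (coordVec n j))) hy hy'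
  have h2 : (colMatrix fun i ↦ L (coordVec n i)).det = L.det := by
    rw [ContinuousLinearMap.det,
      ← LinearMap.det_toMatrix (EuclideanSpace.basisFun (Fin (2 * n + 1)) ℝ).toBasis]
    congr 1
    ext i j
    simp [colMatrix, LinearMap.toMatrix_apply, coordVec]
  rw [coordDensity, h1, det_gram_eq, h2, Real.sqrt_mul (sq_nonneg _), Real.sqrt_sq_eq_abs,
    coordDensity]

lemma volDensity_transition {e' : OpenPartialHomeomorph M (CRModel n)}
    (he' : e' ∈ atlas (CRModel n) M) {y : CRModel n} (hy : y ∈ e.target)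
    (hy' : e.symm y ∈ e'.source) :
    S.volDensity e y
      = |(fderiv ℝ (e' ∘ e.symm) y).det| * S.volDensity e' (e' (e.symm y)) := by
  rw [S.volDensity_eq he hy, S.volDensity_eq he' (e'.map_source hy'),
    S.coordDensity_transition he he' hy hy']
  ring

end Chart

variable [MeasurableSpace M] [BorelSpace M]

lemma measurableSet_target_inter_preimage (e : OpenPartialHomeomorph M (CRModel n)) {A : Set M}
    (hA : MeasurableSet A) : MeasurableSet (e.target ∩ e.symm ⁻¹' A) := by
  have h := e.open_target.measurableSet.subtype_image
    ((e.continuousOn_symm.domRestrict).measurable hA)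
  convert h using 1
  ext y
  simp [and_comm]

lemma aemeasurable_symm (e : OpenPartialHomeomorph M (CRModel n)) (ρ : CRModel n → ℝ≥0∞) :
    AEMeasurable e.symm ((volume.restrict e.target).withDensity ρ) :=
  (e.continuousOn_symm.aemeasurable e.open_target.measurableSet).mono_ac
    (withDensity_absolutelyContinuous _ _)

lemma chartVol_apply (e : OpenPartialHomeomorph M (CRModel n)) {A : Set M}
    (hA : MeasurableSet A) :
    S.chartVol e A = ∫⁻ y in e.target ∩ e.symm ⁻¹' A, ENNReal.ofReal (S.volDensity e y) := by
  rw [chartVol, Measure.map_apply_of_aemeasurable (aemeasurable_symm e _) hA, withDensity_apply',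
    Measure.restrict_restrict' e.open_target.measurableSet, Set.inter_comm]

lemma chartVol_compl_source (e : OpenPartialHomeomorph M (CRModel n)) :
    S.chartVol e e.sourceᶜ = 0 := by
  rw [S.chartVol_apply e e.open_source.measurableSet.compl]
  have : e.target ∩ e.symm ⁻¹' e.sourceᶜ = ∅ := by
    ext y
    simp only [Set.mem_inter_iff, Set.mem_preimage, Set.mem_compl_iff, Set.mem_empty_iff_false,
      iff_false, not_and, not_not]
    exact fun hy ↦ e.map_target hy
  rw [this]
  simp

/-- The chart measures agree on overlaps. -/
lemma chartVol_eq_of_subset {e e' : OpenPartialHomeomorph M (CRModel n)}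
    (he : e ∈ atlas (CRModel n) M) (he' : e' ∈ atlas (CRModel n) M) {A : Set M}
    (hA : MeasurableSet A) (hAe : A ⊆ e.source) (hAe' : A ⊆ e'.source) :
    S.chartVol e A = S.chartVol e' A := by
  rw [S.chartVol_apply e hA, S.chartVol_apply e' hA]
  set T := e.target ∩ e.symm ⁻¹' A with hT
  have himg : (e' ∘ e.symm) '' T = e'.target ∩ e'.symm ⁻¹' A := by
    ext z
    constructor
    · rintro ⟨y, ⟨hy, hyA⟩, rfl⟩
      refine ⟨e'.map_source (hAe' hyA), ?_⟩
      simp only [Set.mem_preimage, Function.comp_apply]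
      rwa [e'.left_inv (hAe' hyA)]
    · rintro ⟨hz, hzA⟩
      refine ⟨e (e'.symm z), ⟨e.map_source (hAe hzA), ?_⟩, ?_⟩
      · simp only [Set.mem_preimage]
        rwa [e.left_inv (hAe hzA)]
      · simp only [Function.comp_apply]
        rw [e.left_inv (hAe hzA), e'.right_inv hz]
  have hinj : Set.InjOn (e' ∘ e.symm) T := by
    rintro y ⟨hy, hyA⟩ z ⟨hz, hzA⟩ hyz
    have h1 : e.symm y = e.symm z := e'.injOn (hAe' hyA) (hAe' hzA) hyz
    exact e.symm.injOn hy hz h1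
  have hder : ∀ y ∈ T, HasFDerivWithinAt (e' ∘ e.symm) (fderiv ℝ (e' ∘ e.symm) y) T y := by
    rintro y ⟨hy, hyA⟩
    exact ((contDiffAt_transition he he' hy (hAe' hyA)).differentiableAt
      (by simp)).hasFDerivAt.hasFDerivWithinAt
  rw [← himg, lintegral_image_eq_lintegral_abs_det_fderiv_mul volume
    (measurableSet_target_inter_preimage e hA) hder hinj]
  refine setLIntegral_congr_fun (measurableSet_target_inter_preimage e hA) ?_
  rintro y ⟨hy, hyA⟩
  simp only [Function.comp_apply]
  rw [S.volDensity_transition he he' hy (hAe' hyA), ENNReal.ofReal_mul (abs_nonneg _)]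

/-- There is a measure extending all the chart measures: it is glued from countably many of them
along a measurable partition of `M`. -/
lemma exists_glued_measure [SecondCountableTopology M] : ∃ ν : Measure M,
    ∀ e ∈ atlas (CRModel n) M, ∀ A, MeasurableSet A → A ⊆ e.source → ν A = S.chartVol e A := by
  obtain ⟨s, hs, hcov⟩ := TopologicalSpace.countable_cover_nhds
    (fun x : M ↦ (chartAt (CRModel n) x).open_source.mem_nhds (mem_chart_source _ x))
  rcases s.eq_empty_or_nonempty with rfl | hne
  · have : IsEmpty M := ⟨fun x ↦ by simpa using hcov.ge (Set.mem_univ x)⟩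
    exact ⟨0, fun e _ A _ _ ↦ by simp [Set.eq_empty_of_isEmpty A]⟩
  obtain ⟨x, rfl⟩ := hs.exists_eq_range hne
  let D : ℕ → Set M := disjointed fun i ↦ (chartAt (CRModel n) (x i)).source
  have hD : ∀ i, MeasurableSet (D i) := fun i ↦
    .disjointed (fun j ↦ (chartAt (CRModel n) (x j)).open_source.measurableSet) i
  have hDs : ∀ i, D i ⊆ (chartAt (CRModel n) (x i)).source := fun i ↦ disjointed_subset _ i
  have hDu : ⋃ i, D i = Set.univ := by
    rw [iUnion_disjointed]
    simpa using hcov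
  refine ⟨Measure.sum fun i ↦ (S.chartVol (chartAt (CRModel n) (x i))).restrict (D i),
    fun e he A hA hAe ↦ ?_⟩
  rw [Measure.sum_apply _ hA]
  have h1 : ∀ i, (S.chartVol (chartAt (CRModel n) (x i))).restrict (D i) A
      = S.chartVol e (A ∩ D i) := fun i ↦ by
    rw [Measure.restrict_apply hA]
    exact S.chartVol_eq_of_subset (chart_mem_atlas _ _) he (hA.inter (hD i))
      (Set.inter_subset_right.trans (hDs i)) (Set.inter_subset_left.trans hAe)
  simp only [h1]
  rw [← measure_iUnion (fun i j hij ↦ (disjoint_disjointed _ hij).mono Set.inter_subset_right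
    Set.inter_subset_right) fun i ↦ hA.inter (hD i), ← Set.inter_iUnion, hDu, Set.inter_univ]

variable [SecondCountableTopology M]

lemma vol_eq_chartVol {e : OpenPartialHomeomorph M (CRModel n)} (he : e ∈ atlas (CRModel n) M)
    {A : Set M} (hA : MeasurableSet A) (hAe : A ⊆ e.source) : S.vol A = S.chartVol e A := by
  obtain ⟨ν, hν⟩ := S.exists_glued_measure
  -- the glued measure dominates every chart measure, hence their supremum
  have hle : S.vol ≤ ν := by
    refine iSup₂_le fun e' he' ↦ Measure.le_iff.2 fun B hB ↦ ?_
    calc S.chartVol e' B ≤ S.chartVol e' (B ∩ e'.source) + S.chartVol e' e'.sourceᶜ := by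
          refine (measure_mono fun x hx ↦ ?_).trans (measure_union_le _ _)
          by_cases h : x ∈ e'.source
          · exact Or.inl ⟨hx, h⟩
          · exact Or.inr h
      _ = ν (B ∩ e'.source) := by
          rw [chartVol_compl_source, add_zero, hν e' he' _
            (hB.inter e'.open_source.measurableSet) Set.inter_subset_right]
      _ ≤ ν B := measure_mono Set.inter_subset_left
  refine le_antisymm ((hle A).trans_eq (hν e he A hA hAe)) ?_
  exact le_iSup₂ (f := fun e (_ : e ∈ atlas (CRModel n) M) ↦ S.chartVol e) e he A

lemma restrict_source_vol {e : OpenPartialHomeomorph M (CRModel n)}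
    (he : e ∈ atlas (CRModel n) M) : S.vol.restrict e.source = S.chartVol e := by
  ext A hA
  rw [Measure.restrict_apply hA, S.vol_eq_chartVol he (hA.inter e.open_source.measurableSet)
    Set.inter_subset_right]
  refine le_antisymm (measure_mono Set.inter_subset_left) ?_
  calc S.chartVol e A ≤ S.chartVol e (A ∩ e.source) + S.chartVol e e.sourceᶜ := by
        refine (measure_mono fun x hx ↦ ?_).trans (measure_union_le _ _)
        by_cases h : x ∈ e.source
        · exact Or.inl ⟨hx, h⟩
        · exact Or.inr h
    _ = S.chartVol e (A ∩ e.source) := by rw [chartVol_compl_source, add_zero]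

lemma isLocallyFiniteMeasure_vol : IsLocallyFiniteMeasure S.vol := by
  refine ⟨fun p ↦ ?_⟩
  set e := chartAt (CRModel n) p with he
  have hmem : e ∈ atlas (CRModel n) M := chart_mem_atlas _ p
  obtain ⟨K, hK, hpK, hKt⟩ := exists_compact_subset e.open_target (chartAt_self_mem_target p)
  obtain ⟨C, hC⟩ := hK.exists_bound_of_continuousOn ((S.continuousOn_volDensity hmem).mono hKt)
  have hopen : IsOpen (e.source ∩ e ⁻¹' interior K) :=
    e.isOpen_inter_preimage isOpen_interior
  refine ⟨_, hopen.mem_nhds ⟨mem_chart_source _ p, hpK⟩, ?_⟩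
  rw [S.vol_eq_chartVol hmem hopen.measurableSet Set.inter_subset_left,
    S.chartVol_apply e hopen.measurableSet]
  calc ∫⁻ y in e.target ∩ e.symm ⁻¹' (e.source ∩ e ⁻¹' interior K),
        ENNReal.ofReal (S.volDensity e y)
      ≤ ∫⁻ y in K, ENNReal.ofReal C := by
        have hsub : e.target ∩ e.symm ⁻¹' (e.source ∩ e ⁻¹' interior K) ⊆ K := by
          rintro y ⟨hy, -, hyK⟩
          simp only [Set.mem_preimage, e.right_inv hy] at hyK
          exact interior_subset hyK
        refine (lintegral_mono_set hsub).trans (setLIntegral_mono' hK.measurableSet fun y hy ↦ ?_)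
        exact ENNReal.ofReal_le_ofReal ((le_abs_self _).trans (hC y hy))
    _ < ⊤ := by
        rw [setLIntegral_const]
        exact ENNReal.mul_lt_top ENNReal.ofReal_lt_top hK.measure_lt_top

/-- Integration in a chart. -/
lemma setIntegral_source_vol {e : OpenPartialHomeomorph M (CRModel n)}
    (he : e ∈ atlas (CRModel n) M) {F : M → ℝ} (hF : Continuous F) :
    ∫ x in e.source, F x ∂S.vol
      = ∫ y in e.target, volConst n * (S.coordDensity e y * F (e.symm y)) := by
  rw [S.restrict_source_vol he, chartVol, integral_map (aemeasurable_symm e _)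
    hF.aestronglyMeasurable]
  have hm : AEMeasurable (fun y ↦ ENNReal.ofReal (S.volDensity e y)) (volume.restrict e.target) :=
    ((S.continuousOn_volDensity he).aemeasurable e.open_target.measurableSet).ennreal_ofReal
  rw [integral_withDensity_eq_integral_toReal_smul₀ hm (by simp)]
  refine setIntegral_congr_fun e.open_target.measurableSet fun y hy ↦ ?_
  have h0 : 0 ≤ S.volDensity e y := abs_nonneg _
  simp only [ENNReal.toReal_ofReal h0, smul_eq_mul]
  rw [S.volDensity_eq he hy, mul_assoc]

end StrictlyPseudoconvexCR

/-! ### Integration by parts -/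

/-- The integral of the divergence of a compactly supported field of the form `g F`. -/
lemma integral_sum_mul_fderiv_add {n : ℕ} {U : Set (CRModel n)} (hU : IsOpen U)
    {F : CRModel n → CRModel n} (hF : ContDiffOn ℝ 1 F U) {g : CRModel n → ℝ}
    (hg : ContDiff ℝ 1 g) (hgc : HasCompactSupport g) (hgU : tsupport g ⊆ U) :
    ∫ y, (fderiv ℝ g y (F y) + g y * ∑ i, fderiv ℝ F y (coordVec n i) i) = 0 := by
  have hF' : ∀ i, ContDiffOn ℝ 1 (fun y ↦ F y i) U := fun i ↦
    (EuclideanSpace.proj i : CRModel n →L[ℝ] ℝ).contDiff.comp_contDiffOn hF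
  have hFd : ∀ y ∈ U, ∀ i v, fderiv ℝ (fun y ↦ F y i) y v = fderiv ℝ F y v i := by
    intro y hy i v
    have h := (EuclideanSpace.proj i : CRModel n →L[ℝ] ℝ).hasFDerivAt.comp y
      (((hF y hy).contDiffAt (hU.mem_nhds hy)).differentiableAt (by simp)).hasFDerivAt
    exact congrArg (fun L : CRModel n →L[ℝ] ℝ ↦ L v) h.fderiv
  have hint : ∀ h k : CRModel n → ℝ, ContinuousOn h U → Continuous k → tsupport k ⊆ tsupport g →
      Integrable (fun y ↦ h y * k y) := by
    intro h k hh hk hks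
    have hts : tsupport (fun y ↦ h y * k y) ⊆ tsupport g :=
      (tsupport_mul_subset_right).trans hks
    refine Continuous.integrable_of_hasCompactSupport (continuous_of_tsupport fun y hy ↦ ?_)
      (hgc.mono' ((subset_tsupport _).trans hts))
    exact (hh.continuousAt (hU.mem_nhds (hgU (hts hy)))).mul hk.continuousAt
  have hg' : ∀ i, Continuous fun y ↦ fderiv ℝ g y (coordVec n i) := fun i ↦
    (hg.continuous_fderiv (by simp)).clm_apply continuous_const
  have hg's : ∀ i, tsupport (fun y ↦ fderiv ℝ g y (coordVec n i)) ⊆ tsupport g := fun i ↦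
    tsupport_fderiv_apply_subset ℝ _
  have hF'c : ∀ i, ContinuousOn (fun y ↦ fderiv ℝ (fun y ↦ F y i) y (coordVec n i)) U := fun i ↦
    ((hF' i).continuousOn_fderiv_of_isOpen hU (by simp)).clm_apply continuousOn_const
  have hpart : ∀ i, ∫ y, F y i * fderiv ℝ g y (coordVec n i)
      = -∫ y, fderiv ℝ (fun y ↦ F y i) y (coordVec n i) * g y := by
    intro i
    refine integral_bilinear_fderiv_right_eq_neg_left_of_integrable
      (B := ContinuousLinearMap.mul ℝ ℝ) (hint _ _ (hF'c i) hg.continuous subset_rfl)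
      (hint _ _ (hF' i).continuousOn (hg' i) (hg's i))
      (hint _ _ (hF' i).continuousOn hg.continuous subset_rfl) (fun y hy ↦ ?_) fun y _ ↦ ?_
    · exact ((hF' i y (hgU hy)).contDiffAt (hU.mem_nhds (hgU hy))).differentiableAt (by simp)
    · exact hg.differentiable (by simp) y
  have hpt : ∀ y, fderiv ℝ g y (F y) + g y * ∑ i, fderiv ℝ F y (coordVec n i) i
      = ∑ i, (F y i * fderiv ℝ g y (coordVec n i)
        + fderiv ℝ (fun y ↦ F y i) y (coordVec n i) * g y) := by
    intro y
    rw [Finset.sum_add_distrib]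
    congr 1
    · conv_lhs => rw [← sum_smul_coordVec (F y)]
      simp
    · by_cases hy : y ∈ U
      · simp only [hFd y hy, Finset.mul_sum, mul_comm]
      · have : g y = 0 := image_eq_zero_of_notMem_tsupport fun h ↦ hy (hgU h)
        simp [this]
  simp only [hpt]
  have hi1 := fun i ↦ hint _ _ (hF' i).continuousOn (hg' i) (hg's i)
  have hi2 := fun i ↦ hint _ _ (hF'c i) hg.continuous subset_rfl
  have hi3 : ∀ i, Integrable (fun y ↦ F y i * fderiv ℝ g y (coordVec n i)
      + fderiv ℝ (fun y ↦ F y i) y (coordVec n i) * g y) := fun i ↦ (hi1 i).add (hi2 i)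
  rw [integral_finsetSum _ fun i _ ↦ hi3 i]
  refine Finset.sum_eq_zero fun i _ ↦ ?_
  rw [integral_add (hi1 i) (hi2 i), hpart]
  ring

namespace StrictlyPseudoconvexCR

variable {n : ℕ} {M : Type*} [TopologicalSpace M] [ChartedSpace (CRModel n) M]
  [IsManifold 𝓘(ℝ, CRModel n) ∞ M] [T2Space M] (S : StrictlyPseudoconvexCR n M)

omit [T2Space M] in
lemma continuous_of_continuousOn_charts {F : M → ℝ}
    (h : ∀ e ∈ atlas (CRModel n) M, ContinuousOn (F ∘ e.symm) e.target) : Continuous F := by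
  rw [continuous_iff_continuousAt]
  intro p
  have hp := chartAt_self_mem_target (n := n) p
  have h1 : ContinuousAt ((F ∘ (chartAt (CRModel n) p).symm) ∘ chartAt (CRModel n) p) p :=
    ((h _ (chart_mem_atlas _ p)).continuousAt ((chartAt _ p).open_target.mem_nhds hp)).comp
      ((chartAt _ p).continuousAt (mem_chart_source _ p))
  refine h1.congr ?_
  filter_upwards [(chartAt (CRModel n) p).open_source.mem_nhds (mem_chart_source _ p)] with x hx
  simp [(chartAt (CRModel n) p).left_inv hx]

section Functions

variable {φ ψ : M → ℝ} (hφ : ContMDiff 𝓘(ℝ, CRModel n) 𝓘(ℝ, ℝ) 2 φ)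
  (hψ : ContMDiff 𝓘(ℝ, CRModel n) 𝓘(ℝ, ℝ) 2 ψ)
include hφ

/-- The tension of a function is continuous, since it is a divergence in every chart. -/
lemma continuous_tension : Continuous (S.tension φ) := by
  refine continuous_of_continuousOn_charts (n := n) fun e he ↦ ?_
  have h1 : ContDiffOn ℝ 1 (fun z ↦ S.coordDensity e z • S.coordGrad e φ z) e.target :=
    ((S.contDiffOn_coordDensity he).of_le ENat.LEInfty.out).smul (S.contDiffOn_coordGrad he hφ)
  have h2 : ContinuousOn (fun y ↦ (S.coordDensity e y)⁻¹ *
      ∑ i, fderiv ℝ (fun z ↦ S.coordDensity e z • S.coordGrad e φ z) y (coordVec n i) i)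
      e.target := by
    refine ((S.contDiffOn_coordDensity he).continuousOn.inv₀
      fun y hy ↦ (S.coordDensity_pos he hy).ne').mul (continuousOn_finsetSum _ fun i _ ↦ ?_)
    exact (EuclideanSpace.proj i : CRModel n →L[ℝ] ℝ).continuous.comp_continuousOn
      ((h1.continuousOn_fderiv_of_isOpen e.open_target (by simp)).clm_apply continuousOn_const)
  refine h2.congr fun y hy ↦ ?_
  dsimp only
  rw [S.divergence_coordGrad he hφ hy, ← mul_assoc,
    inv_mul_cancel₀ (S.coordDensity_pos he hy).ne', one_mul, Function.comp_apply]

include hψ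

lemma continuous_carre : Continuous (S.carre φ ψ) := by
  refine continuous_of_continuousOn_charts (n := n) fun e he ↦ ?_
  have h1 : ContinuousOn (fun y ↦ fderiv ℝ (ψ ∘ e.symm) y (S.coordGrad e φ y)) e.target :=
    ((contDiffOn_comp_symm (k := 2) he hψ).continuousOn_fderiv_of_isOpen e.open_target
      (by norm_num)).clm_apply (S.contDiffOn_coordGrad he hφ).continuousOn
  exact h1.congr fun y hy ↦ S.carre_eq_fderiv_coordGrad he hy (mdifferentiableAt_of_two hφ _)
    (mdifferentiableAt_of_two hψ _)

lemma carre_eq_zero_of_notMem_tsupport {p : M} (hp : p ∉ tsupport ψ) : S.carre φ ψ p = 0 := by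
  have h1 := S.carre_eq_fderiv_coordGrad (chart_mem_atlas _ p) (chartAt_self_mem_target p)
    (mdifferentiableAt_of_two hφ _) (mdifferentiableAt_of_two hψ _)
  have h2 : ψ ∘ (chartAt (CRModel n) p).symm =ᶠ[𝓝 (chartAt (CRModel n) p p)] fun _ ↦ 0 := by
    have h3 := (chartAt (CRModel n) p).continuousAt_symm (chartAt_self_mem_target p)
    rw [ContinuousAt, symm_chartAt_self] at h3
    exact h3.eventually (notMem_tsupport_iff_eventuallyEq.1 hp)
  rw [symm_chartAt_self, h2.fderiv_eq] at h1
  simpa using h1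

lemma hasCompactSupport_carre (hc : HasCompactSupport ψ) : HasCompactSupport (S.carre φ ψ) :=
  hc.mono' fun p hp ↦ by
    by_contra h
    exact hp (S.carre_eq_zero_of_notMem_tsupport hφ hψ h)

variable [MeasurableSpace M] [BorelSpace M] [SecondCountableTopology M]

/-- The integrand of the integration by parts formula is continuous with compact support. -/
lemma integrable_carre_add (hc : HasCompactSupport ψ) :
    Integrable (fun x ↦ S.carre φ ψ x + ψ x * S.tension φ x) S.vol := by
  have := S.isLocallyFiniteMeasure_vol
  exact ((S.continuous_carre hφ hψ).integrable_of_hasCompactSupport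
    (S.hasCompactSupport_carre hφ hψ hc)).add
    ((hψ.continuous.mul (S.continuous_tension hφ)).integrable_of_hasCompactSupport hc.mul_right)

lemma integral_carre_add_of_subset_source {e : OpenPartialHomeomorph M (CRModel n)}
    (he : e ∈ atlas (CRModel n) M) (hc : HasCompactSupport ψ) (hs : tsupport ψ ⊆ e.source) :
    ∫ x, (S.carre φ ψ x + ψ x * S.tension φ x) ∂S.vol = 0 := by
  have hcont : Continuous fun x ↦ S.carre φ ψ x + ψ x * S.tension φ x :=
    (S.continuous_carre hφ hψ).add (hψ.continuous.mul (S.continuous_tension hφ))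
  have hzero : ∀ x, x ∉ e.source → S.carre φ ψ x + ψ x * S.tension φ x = 0 := by
    intro x hx
    have hx' : x ∉ tsupport ψ := fun h ↦ hx (hs h)
    rw [S.carre_eq_zero_of_notMem_tsupport hφ hψ hx', image_eq_zero_of_notMem_tsupport hx']
    ring
  rw [← setIntegral_eq_integral_of_forall_compl_eq_zero hzero, S.setIntegral_source_vol he hcont]
  -- the test function in the chart, extended by zero
  set g : CRModel n → ℝ := e.target.indicator (ψ ∘ e.symm) with hgdef
  set K := e '' tsupport ψ with hK
  have hKc : IsCompact K := hc.isCompact.image_of_continuousOn (e.continuousOn.mono hs)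
  have hKt : K ⊆ e.target := by
    rintro _ ⟨x, hx, rfl⟩
    exact e.map_source (hs hx)
  have hgK : ∀ y, y ∉ K → g y = 0 := by
    intro y hy
    by_cases hyt : y ∈ e.target
    · rw [hgdef, Set.indicator_of_mem hyt, Function.comp_apply]
      refine image_eq_zero_of_notMem_tsupport fun h ↦ hy ⟨_, h, e.right_inv hyt⟩
    · rw [hgdef, Set.indicator_of_notMem hyt]
  have hgts : tsupport g ⊆ K := closure_minimal (fun y hy ↦ by
    by_contra h
    exact hy (hgK y h)) hKc.isClosed
  have hgE : ∀ y ∈ e.target, g =ᶠ[𝓝 y] ψ ∘ e.symm := fun y hy ↦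
    (e.open_target.eventually_mem hy).mono fun z hz ↦ Set.indicator_of_mem hz _
  have hgC : ContDiff ℝ 1 g := by
    rw [← contMDiff_iff_contDiff]
    refine contMDiff_of_tsupport fun y hy ↦ ContDiffAt.contMDiffAt ?_
    have hyt := hKt (hgts hy)
    exact ((contDiffAt_two_comp_symm hψ he hyt).of_le (by norm_num)).congr_of_eventuallyEq
      (hgE y hyt)
  have hF : ContDiffOn ℝ 1 (fun z ↦ S.coordDensity e z • S.coordGrad e φ z) e.target :=
    ((S.contDiffOn_coordDensity he).of_le ENat.LEInfty.out).smul (S.contDiffOn_coordGrad he hφ)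
  have hmain := integral_sum_mul_fderiv_add e.open_target hF hgC
    (HasCompactSupport.intro hKc hgK) (hgts.trans hKt)
  rw [← setIntegral_eq_integral_of_forall_compl_eq_zero (s := e.target)] at hmain
  · rw [integral_const_mul, mul_eq_zero]
    right
    rw [← hmain]
    refine setIntegral_congr_fun e.open_target.measurableSet fun y hy ↦ ?_
    simp only
    rw [S.divergence_coordGrad he hφ hy, (hgE y hy).fderiv_eq, S.carre_eq_fderiv_coordGrad he hy
      (mdifferentiableAt_of_two hφ _) (mdifferentiableAt_of_two hψ _), (hgE y hy).eq_of_nhds]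
    simp only [map_smul, smul_eq_mul, Function.comp_apply]
    ring
  · intro y hy
    have hyt : y ∉ tsupport g := fun h ↦ hy (hKt (hgts h))
    rw [(notMem_tsupport_iff_eventuallyEq.1 hyt).fderiv_eq, image_eq_zero_of_notMem_tsupport hyt]
    simp

/-- Integration by parts for the sub-Laplacian. -/
theorem integral_carre_add (hc : HasCompactSupport ψ) :
    ∫ x, (S.carre φ ψ x + ψ x * S.tension φ x) ∂S.vol = 0 := by
  have : LocallyCompactSpace M := ChartedSpace.locallyCompactSpace (CRModel n) M
  obtain ⟨ρ, hρ⟩ := SmoothPartitionOfUnity.exists_isSubordinate_chartAt_source_of_isClosed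
    𝓘(ℝ, CRModel n) (isClosed_tsupport ψ)
  -- only finitely many functions of the partition of unity meet the support of `ψ`
  have hfin := ρ.locallyFinite.finite_nonempty_inter_compact hc.isCompact
  set T := hfin.toFinset with hT
  have hρC : ∀ i, ContMDiff 𝓘(ℝ, CRModel n) 𝓘(ℝ, ℝ) 2 fun x ↦ ρ i x * ψ x := fun i ↦
    ((ρ i).contMDiff.of_le two_le_infty).mul hψ
  have hρc : ∀ i, HasCompactSupport fun x ↦ ρ i x * ψ x := fun i ↦ hc.mul_left
  have hρs : ∀ i, tsupport (fun x ↦ ρ i x * ψ x) ⊆ (chartAt (CRModel n) (i : M)).source := fun i ↦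
    tsupport_mul_subset_left.trans (hρ i)
  have hsum : ψ = fun x ↦ ∑ i ∈ T, ρ i x * ψ x := by
    ext x
    by_cases hx : x ∈ tsupport ψ
    · rw [← Finset.sum_mul]
      have h1 := ρ.sum_eq_one hx
      rw [finsum_eq_sum_of_support_subset (s := T)] at h1
      · rw [h1, one_mul]
      · intro i hi
        simp only [hT, Set.Finite.coe_toFinset]
        exact ⟨x, hi, hx⟩
    · simp [image_eq_zero_of_notMem_tsupport hx]
  classical
  have key : ∀ T : Finset (tsupport ψ),
      ContMDiff 𝓘(ℝ, CRModel n) 𝓘(ℝ, ℝ) 2 (fun x ↦ ∑ i ∈ T, ρ i x * ψ x) ∧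
      HasCompactSupport (fun x ↦ ∑ i ∈ T, ρ i x * ψ x) ∧
      ∫ x, (S.carre φ (fun x ↦ ∑ i ∈ T, ρ i x * ψ x) x
        + (∑ i ∈ T, ρ i x * ψ x) * S.tension φ x) ∂S.vol = 0 := by
    intro T
    induction T using Finset.induction_on with
    | empty =>
      refine ⟨by simpa using contMDiff_const, by simpa using! HasCompactSupport.zero, ?_⟩
      have : ∀ x, S.carre φ (fun _ ↦ 0) x = 0 := fun x ↦
        S.carre_eq_zero_of_notMem_tsupport hφ contMDiff_const (by simp [tsupport])
      simp [this]
    | insert i T hi ih =>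
      obtain ⟨h1, h2, h3⟩ := ih
      have hins : (fun x ↦ ∑ j ∈ insert i T, ρ j x * ψ x)
          = (fun x ↦ ρ i x * ψ x) + fun x ↦ ∑ j ∈ T, ρ j x * ψ x := by
        ext x
        simp [Finset.sum_insert hi]
      have hC : ContMDiff 𝓘(ℝ, CRModel n) 𝓘(ℝ, ℝ) 2
        ((fun x ↦ ρ i x * ψ x) + fun x ↦ ∑ j ∈ T, ρ j x * ψ x) := (hρC i).add h1
      have hadd : ∀ x, S.carre φ ((fun x ↦ ρ i x * ψ x) + fun x ↦ ∑ j ∈ T, ρ j x * ψ x) x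
          = S.carre φ (fun x ↦ ρ i x * ψ x) x + S.carre φ (fun x ↦ ∑ j ∈ T, ρ j x * ψ x) x := by
        intro x
        have h4 := S.carre_sub (mdifferentiableAt_of_two hC x) (mdifferentiableAt_of_two h1 x) φ
        rw [add_sub_cancel_right] at h4
        linarith
      have h5 := S.integral_carre_add_of_subset_source hφ (hρC i) (chart_mem_atlas _ (i : M))
        (hρc i) (hρs i)
      rw [hins]
      refine ⟨hC, (hρc i).add h2, ?_⟩
      have h6 := integral_add (S.integrable_carre_add hφ (hρC i) (hρc i))
        (S.integrable_carre_add hφ h1 h2)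
      rw [h3, h5, add_zero] at h6
      rw [← h6]
      congr 1
      ext x
      rw [hadd, Finset.sum_insert hi]
      ring
  have h := (key T).2.2
  rw [← hsum] at h
  rw [← h]
  congr 1
  ext x
  rw [← congrFun hsum x]

end Functions

end StrictlyPseudoconvexCR

/-! ### Weighted commutator inequality in a Hilbert space -/

/-- The trapezoidal rule overestimates the integral of the convex function `t ↦ t ^ (p - 1)`. -/
lemma rpow_sub_rpow_le_of_two_le {p x y : ℝ} (hp : 2 ≤ p) (hy : 0 < y) (hxy : y ≤ x) :
    x ^ p - y ^ p ≤ p / 2 * (x ^ (p - 1) + y ^ (p - 1)) * (x - y) := by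
  set g : ℝ → ℝ := fun t ↦ p / 2 * (t ^ (p - 1) + y ^ (p - 1)) * (t - y) - (t ^ p - y ^ p) with hg
  have hder : ∀ t, 0 < t → HasDerivAt g (p / 2 * ((p - 1) * t ^ (p - 1 - 1)) * (t - y)
      + p / 2 * (t ^ (p - 1) + y ^ (p - 1)) * 1 - p * t ^ (p - 1)) t := by
    intro t ht
    have h1 := (Real.hasDerivAt_rpow_const (x := t) (p := p - 1) (Or.inl ht.ne')).add_const
      (y ^ (p - 1))
    have h2 := (h1.const_mul (p / 2)).mul ((hasDerivAt_id t).sub_const y)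
    exact h2.sub ((Real.hasDerivAt_rpow_const (x := t) (p := p) (Or.inl ht.ne')).sub_const _)
  have hmono : MonotoneOn g (Set.Icc y x) := by
    refine monotoneOn_of_deriv_nonneg (convex_Icc y x) (fun t ht ↦ ?_) (fun t ht ↦ ?_)
      fun t ht ↦ ?_
    · exact (hder t (hy.trans_le ht.1)).continuousAt.continuousWithinAt
    · rw [interior_Icc] at ht
      exact (hder t (hy.trans ht.1)).differentiableAt.differentiableWithinAt
    · rw [interior_Icc] at ht
      have ht0 : 0 < t := hy.trans ht.1
      rw [(hder t ht0).deriv]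
      -- the tangent line to `s ↦ s ^ (p - 1)` at `t` lies below the graph at `y`
      have h1 := one_add_mul_self_le_rpow_one_add (s := y / t - 1) (p := p - 1)
        (by linarith [div_pos hy ht0]) (by linarith)
      rw [add_sub_cancel, Real.div_rpow hy.le ht0.le,
        le_div_iff₀ (Real.rpow_pos_of_pos ht0 _)] at h1
      have h2 : t ^ (p - 1) = t ^ (p - 1 - 1) * t := by
        rw [← Real.rpow_add_one ht0.ne']
        ring_nf
      have h3 : (1 + (p - 1) * (y / t - 1)) * t ^ (p - 1)
          = t ^ (p - 1) + (p - 1) * t ^ (p - 1 - 1) * (y - t) := by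
        rw [h2]
        field_simp
      rw [h3] at h1
      nlinarith
  have h0 : g y = 0 := by simp [hg]
  have h1 := hmono ⟨le_rfl, hxy⟩ ⟨hxy, le_rfl⟩ hxy
  rw [h0] at h1
  simp only [hg] at h1
  linarith

/-- For `p ≤ 2` the difference of the two sides is `x * y * (y ^ (p - 2) - x ^ (p - 2))`. -/
lemma rpow_sub_rpow_le_of_le_two {p x y : ℝ} (hp : p ≤ 2) (hy : 0 < y) (hxy : y ≤ x) :
    x ^ p - y ^ p ≤ (x ^ (p - 1) + y ^ (p - 1)) * (x - y) := by
  have hx := hy.trans_le hxy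
  have h1 : x ^ (p - 2) ≤ y ^ (p - 2) := Real.rpow_le_rpow_of_nonpos hy hxy (by linarith)
  have h2 : ∀ t : ℝ, 0 < t → t ^ (p - 1) = t ^ (p - 2) * t ∧ t ^ p = t ^ (p - 2) * t * t := by
    intro t ht
    have h3 : t ^ (p - 1) = t ^ (p - 2) * t := by
      rw [← Real.rpow_add_one ht.ne']
      ring_nf
    refine ⟨h3, ?_⟩
    rw [← h3, ← Real.rpow_add_one ht.ne']
    ring_nf
  rw [(h2 x hx).1, (h2 x hx).2, (h2 y hy).1, (h2 y hy).2]
  nlinarith [mul_nonneg (mul_pos hx hy).le (sub_nonneg.2 h1)]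

/-- The elementary inequality responsible for the constant `max 2 p`. -/
lemma rpow_sub_rpow_mul_sub_le (p : ℝ) {x y : ℝ} (hx : 0 < x) (hy : 0 < y) :
    (x ^ p - y ^ p) * (x - y)
      ≤ max 1 (p / 2) * (x ^ (p - 1) + y ^ (p - 1)) * (x - y) ^ 2 := by
  have key : ∀ a b : ℝ, 0 < b → b ≤ a →
      a ^ p - b ^ p ≤ max 1 (p / 2) * (a ^ (p - 1) + b ^ (p - 1)) * (a - b) := by
    intro a b hb hab
    have h0 : 0 ≤ (a ^ (p - 1) + b ^ (p - 1)) * (a - b) :=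
      mul_nonneg (add_nonneg (Real.rpow_nonneg (hb.le.trans hab) _) (Real.rpow_nonneg hb.le _))
        (sub_nonneg.2 hab)
    rw [mul_assoc]
    rcases le_total p 2 with hp | hp
    · exact (rpow_sub_rpow_le_of_le_two hp hb hab).trans
        (le_mul_of_one_le_left h0 (le_max_left _ _))
    · refine (rpow_sub_rpow_le_of_two_le hp hb hab).trans ?_
      rw [mul_assoc]
      exact mul_le_mul_of_nonneg_right (le_max_right _ _) h0
  rcases le_total y x with h | h
  · nlinarith [key x y hy h, sub_nonneg.2 h]
  · nlinarith [key y x hx h, sub_nonneg.2 h]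

section Hilbert

variable {H : Type*} [NormedAddCommGroup H] [InnerProductSpace ℝ H] [CompleteSpace H]

/-- Let `u j` be an orthonormal basis of eigenvectors of an operator, with nondecreasing eigenvalues
`lam j`, and let `F i`, `h i` stand for `G (u i)` and `[L, G] (u i)`, where `G` is symmetric. Then
`⟨h i, F i⟩ = ∑ j, (lam j - lam i) * ⟨F i, u j⟩ ^ 2` and the terms with `lam j ≥ lam k` are
controlled by `‖h i‖ ^ 2`, while the remaining ones cancel after weighting and symmetrization. -/
theorem sum_rpow_mul_inner_le (u : HilbertBasis ℕ ℝ H) {lam : ℕ → ℝ} (hmono : Monotone lam)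
    (F h : ℕ → H) (hF : ∀ i j, inner ℝ (F i) (u j) = inner ℝ (F j) (u i))
    (hh : ∀ i j, inner ℝ (h i) (u j) = (lam j - lam i) * inner ℝ (F i) (u j)) (k : ℕ) (p : ℝ) :
    ∑ i ∈ Finset.range k with lam i < lam k, (lam k - lam i) ^ p * inner ℝ (h i) (F i)
      ≤ max 1 (p / 2) *
        ∑ i ∈ Finset.range k with lam i < lam k, (lam k - lam i) ^ (p - 1) * ‖h i‖ ^ 2 := by
  set I := Finset.filter (fun i ↦ lam i < lam k) (Finset.range k) with hI
  set a : ℕ → ℕ → ℝ := fun i j ↦ inner ℝ (F i) (u j) with ha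
  set κ := max 1 (p / 2) with hκ
  have hκ1 : 1 ≤ κ := le_max_left _ _
  have hIlt : ∀ i ∈ I, lam i < lam k := fun i hi ↦ (Finset.mem_filter.1 hi).2
  have hInot : ∀ j, j ∉ I → lam k ≤ lam j := by
    intro j hj
    by_contra! hlt
    refine hj (Finset.mem_filter.2 ⟨Finset.mem_range.2 ?_, hlt⟩)
    by_contra! hkj
    exact (hmono hkj).not_gt hlt
  have hs1 : ∀ i, HasSum (fun j ↦ (lam j - lam i) * a i j ^ 2) (inner ℝ (h i) (F i)) := by
    intro i
    have h1 := u.hasSum_inner_mul_inner (h i) (F i)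
    refine h1.congr_fun fun j ↦ ?_
    rw [hh, real_inner_comm (F i) (u j)]
    ring
  have hs2 : ∀ i, HasSum (fun j ↦ (lam j - lam i) ^ 2 * a i j ^ 2) (‖h i‖ ^ 2) := by
    intro i
    have h1 := u.hasSum_inner_mul_inner (h i) (h i)
    rw [real_inner_self_eq_norm_sq] at h1
    refine h1.congr_fun fun j ↦ ?_
    rw [real_inner_comm (h i) (u j), hh]
    ring
  -- the contribution of the eigenvalues that are at least `lam k`
  have hi : ∀ i ∈ I, (lam k - lam i) * inner ℝ (h i) (F i) ≤ κ * ‖h i‖ ^ 2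
      + ∑ j ∈ I, ((lam k - lam i) * (lam j - lam i) - κ * (lam j - lam i) ^ 2) * a i j ^ 2 := by
    intro i hiI
    have hd := ((hs1 i).mul_left (lam k - lam i)).sub ((hs2 i).mul_left κ)
    have h3 := sum_le_hasSum I (f := fun j ↦
      -((lam k - lam i) * ((lam j - lam i) * a i j ^ 2) - κ * ((lam j - lam i) ^ 2 * a i j ^ 2)))
      (fun j hj ↦ ?_) hd.neg
    · rw [Finset.sum_neg_distrib] at h3
      have h4 : ∑ j ∈ I, ((lam k - lam i) * (lam j - lam i) - κ * (lam j - lam i) ^ 2) * a i j ^ 2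
          = ∑ j ∈ I, ((lam k - lam i) * ((lam j - lam i) * a i j ^ 2)
            - κ * ((lam j - lam i) ^ 2 * a i j ^ 2)) :=
        Finset.sum_congr rfl fun j _ ↦ by ring
      linarith
    · have h5 := hInot j hj
      have h6 := hIlt i hiI
      have h7 : (lam k - lam i) * (lam j - lam i) ≤ κ * (lam j - lam i) ^ 2 := by
        nlinarith [mul_nonneg (sub_nonneg.2 h6.le) (sub_nonneg.2 h5),
          mul_nonneg (sub_nonneg.2 hκ1) (sq_nonneg (lam j - lam i))]
      nlinarith [mul_nonneg (sub_nonneg.2 h7) (sq_nonneg (a i j))]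
  have hpow : ∀ i ∈ I, (lam k - lam i) ^ p = (lam k - lam i) ^ (p - 1) * (lam k - lam i) := by
    intro i hiI
    rw [← Real.rpow_add_one (sub_pos.2 (hIlt i hiI)).ne', sub_add_cancel]
  have hstep : ∑ i ∈ I, (lam k - lam i) ^ p * inner ℝ (h i) (F i)
      ≤ κ * ∑ i ∈ I, (lam k - lam i) ^ (p - 1) * ‖h i‖ ^ 2
        + ∑ i ∈ I, ∑ j ∈ I, (lam k - lam i) ^ (p - 1) *
          (((lam k - lam i) * (lam j - lam i) - κ * (lam j - lam i) ^ 2) * a i j ^ 2) := by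
    rw [Finset.mul_sum, ← Finset.sum_add_distrib]
    refine Finset.sum_le_sum fun i hiI ↦ ?_
    rw [hpow i hiI, mul_assoc, ← Finset.mul_sum]
    have h8 := mul_le_mul_of_nonneg_left (hi i hiI)
      (Real.rpow_nonneg (sub_pos.2 (hIlt i hiI)).le (p - 1))
    linarith
  -- the remaining double sum is nonpositive after symmetrization
  have hdouble : ∑ i ∈ I, ∑ j ∈ I, (lam k - lam i) ^ (p - 1) *
      (((lam k - lam i) * (lam j - lam i) - κ * (lam j - lam i) ^ 2) * a i j ^ 2) ≤ 0 := by
    set T : ℕ → ℕ → ℝ := fun i j ↦ (lam k - lam i) ^ (p - 1) *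
      (((lam k - lam i) * (lam j - lam i) - κ * (lam j - lam i) ^ 2) * a i j ^ 2) with hT
    have h9 : ∑ i ∈ I, ∑ j ∈ I, (T i j + T j i) ≤ 0 := by
      refine Finset.sum_nonpos fun i hiI ↦ Finset.sum_nonpos fun j hjI ↦ ?_
      have h10 := rpow_sub_rpow_mul_sub_le p (sub_pos.2 (hIlt i hiI)) (sub_pos.2 (hIlt j hjI))
      have h11 : T i j + T j i
          = (((lam k - lam i) ^ p - (lam k - lam j) ^ p) * ((lam k - lam i) - (lam k - lam j))
            - κ * ((lam k - lam i) ^ (p - 1) + (lam k - lam j) ^ (p - 1))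
              * ((lam k - lam i) - (lam k - lam j)) ^ 2) * a i j ^ 2 := by
        have h12 : a j i = a i j := hF j i
        simp only [hT, h12, hpow i hiI, hpow j hjI]
        ring
      rw [h11]
      exact mul_nonpos_of_nonpos_of_nonneg (by linarith) (sq_nonneg _)
    have h13 : ∑ i ∈ I, ∑ j ∈ I, T j i = ∑ i ∈ I, ∑ j ∈ I, T i j := Finset.sum_comm
    simp only [Finset.sum_add_distrib] at h9
    linarith
  linarith

end Hilbert

/-! ### Consequences for sequences of real numbers -/

section Riesz

variable {n : ℕ} {μ : ℕ → ℝ}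

/-- The Riesz mean `R(z) = ∑ (z - μ i) ^ 2` of the sequence grows at least like `z ^ (n + 2)`
between consecutive terms. -/
lemma riesz_mul_pow_le (hn : 1 ≤ n)
    (hineq : ∀ k : ℕ, ∑ i ∈ Finset.range k, (μ k - μ i) ^ 2
      ≤ 2 / n * ∑ i ∈ Finset.range k, (μ k - μ i) * μ i) (m : ℕ) {a b : ℝ} (ha : 0 < a)
    (hma : μ m ≤ a) (hab : a ≤ b) (hb : b ≤ μ (m + 1)) :
    (∑ i ∈ Finset.range (m + 1), (a - μ i) ^ 2) * b ^ (n + 2)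
      ≤ (∑ i ∈ Finset.range (m + 1), (b - μ i) ^ 2) * a ^ (n + 2) := by
  have hn0 : (0 : ℝ) < n := by exact_mod_cast hn
  set Q : ℝ → ℝ := fun z ↦ ∑ i ∈ Finset.range (m + 1), (z - μ i) ^ 2 with hQ
  -- `q` is a convex quadratic polynomial, and nonpositive at two consecutive terms
  set q : ℝ → ℝ := fun z ↦ ∑ i ∈ Finset.range (m + 1),
    ((z - μ i) ^ 2 - 2 / n * ((z - μ i) * μ i)) with hq
  have hq1 : q (μ (m + 1)) ≤ 0 := by
    have := hineq (m + 1)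
    rw [Finset.mul_sum] at this
    simp only [hq, Finset.sum_sub_distrib]
    linarith
  have hq0 : q (μ m) ≤ 0 := by
    have := hineq m
    rw [Finset.mul_sum] at this
    simp only [hq, Finset.sum_sub_distrib, Finset.sum_range_succ]
    simp only [sub_self]
    linarith
  have hconv : ConvexOn ℝ Set.univ q := by
    have h1 : ∀ i, ConvexOn ℝ Set.univ fun z : ℝ ↦ (z - μ i) ^ 2 - 2 / n * ((z - μ i) * μ i) := by
      intro i
      refine ⟨convex_univ, fun x _ y _ s t hs ht hst ↦ ?_⟩
      obtain rfl : t = 1 - s := by linarith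
      simp only [smul_eq_mul]
      nlinarith [mul_nonneg (mul_nonneg hs ht) (sq_nonneg (x - y))]
    refine ⟨convex_univ, fun x hx y hy s t hs ht hst ↦ ?_⟩
    simp only [hq, smul_eq_mul, Finset.mul_sum, ← Finset.sum_add_distrib]
    exact Finset.sum_le_sum fun i _ ↦ (h1 i).2 hx hy hs ht hst
  have hqz : ∀ z ∈ Set.Icc (μ m) (μ (m + 1)), q z ≤ 0 := by
    intro z hz
    have h1 := hconv.le_max_of_mem_Icc (Set.mem_univ _) (Set.mem_univ _) hz
    exact h1.trans (max_le hq0 hq1)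
  have hQd : ∀ z, HasDerivAt Q (∑ i ∈ Finset.range (m + 1), 2 * (z - μ i)) z := by
    intro z
    refine HasDerivAt.fun_sum fun i _ ↦ ?_
    simpa using! ((hasDerivAt_id z).sub_const (μ i)).pow 2
  -- the differential inequality for the Riesz mean
  have hdiff : ∀ z ∈ Set.Icc (μ m) (μ (m + 1)),
      (n + 2) * Q z ≤ z * ∑ i ∈ Finset.range (m + 1), 2 * (z - μ i) := by
    intro z hz
    have h1 := hqz z hz
    have h2 : n * q z = (n + 2) * Q z - z * ∑ i ∈ Finset.range (m + 1), 2 * (z - μ i) := by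
      simp only [hq, hQ, Finset.mul_sum, ← Finset.sum_sub_distrib]
      refine Finset.sum_congr rfl fun i _ ↦ ?_
      field_simp
      ring
    nlinarith
  have hder : ∀ z, 0 < z → HasDerivAt (fun z ↦ Q z * (z ^ (n + 2))⁻¹)
      ((∑ i ∈ Finset.range (m + 1), 2 * (z - μ i)) * (z ^ (n + 2))⁻¹
        + Q z * (-((n + 2 : ℕ) * z ^ (n + 1)) / (z ^ (n + 2)) ^ 2)) z := by
    intro z hz
    have h1 := (hasDerivAt_pow (n + 2) z).inv (pow_pos hz _).ne'
    exact (hQd z).mul h1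
  have hmono : MonotoneOn (fun z ↦ Q z * (z ^ (n + 2))⁻¹) (Set.Icc a b) := by
    refine monotoneOn_of_deriv_nonneg (convex_Icc a b) (fun z hz ↦ ?_) (fun z hz ↦ ?_) fun z hz ↦ ?_
    · exact (hder z (ha.trans_le hz.1)).continuousAt.continuousWithinAt
    · rw [interior_Icc] at hz
      exact (hder z (ha.trans hz.1)).differentiableAt.differentiableWithinAt
    · rw [interior_Icc] at hz
      have hz0 : 0 < z := ha.trans hz.1
      rw [(hder z hz0).deriv]
      have h1 := hdiff z ⟨hma.trans hz.1.le, hz.2.le.trans hb⟩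
      have h2 : (∑ i ∈ Finset.range (m + 1), 2 * (z - μ i)) * (z ^ (n + 2))⁻¹
          + Q z * (-((n + 2 : ℕ) * z ^ (n + 1)) / (z ^ (n + 2)) ^ 2)
          = (z * ∑ i ∈ Finset.range (m + 1), 2 * (z - μ i) - (n + 2) * Q z) / z ^ (n + 3) := by
        push_cast
        field_simp
        ring
      rw [h2]
      exact div_nonneg (by linarith) (pow_pos hz0 _).le
  have h3 := hmono ⟨le_rfl, hab⟩ ⟨hab, le_rfl⟩ hab
  simp only [← div_eq_mul_inv] at h3
  rwa [div_le_div_iff₀ (pow_pos ha _) (pow_pos (ha.trans_le hab) _)] at h3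

/-- Recursion formula: a sequence satisfying the quadratic inequality of Yang grows at most
like `k ^ (1 / n)`. -/
lemma le_rpow_mul_of_pos (hn : 1 ≤ n) (hμ : Monotone μ) (h0 : 0 < μ 0)
    (hineq : ∀ k : ℕ, ∑ i ∈ Finset.range k, (μ k - μ i) ^ 2
      ≤ 2 / n * ∑ i ∈ Finset.range k, (μ k - μ i) * μ i) {k : ℕ} (hk : 1 ≤ k) :
    μ k ≤ (1 + 2 / n) * (k : ℝ) ^ (1 / n : ℝ) * μ 0 := by
  have hn0 : (0 : ℝ) < n := by exact_mod_cast hn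
  have hk1 : (1 : ℝ) ≤ (k : ℝ) := by exact_mod_cast hk
  have hkr : (1 : ℝ) ≤ (k : ℝ) ^ (1 / n : ℝ) := Real.one_le_rpow hk1 (by positivity)
  -- the maximum point of `(z - μ 0) ^ 2 / z ^ (n + 2)`, the bound given by the first term alone
  set z₀ := (1 + 2 / n) * μ 0 with hz₀
  have hz₀pos : 0 < z₀ := by positivity
  have hz₀μ : μ 0 ≤ z₀ := by
    have : 0 ≤ 2 / n * μ 0 := by positivity
    rw [hz₀]
    linarith
  rcases le_or_gt (μ k) z₀ with hle | hlt
  · calc μ k ≤ z₀ * 1 := by rwa [mul_one]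
      _ ≤ z₀ * (k : ℝ) ^ (1 / n : ℝ) := by gcongr
      _ = _ := by rw [hz₀]; ring
  -- lower bound for the Riesz mean at the terms beyond `z₀`
  have hlow : ∀ m, z₀ ≤ μ (m + 1) → (z₀ - μ 0) ^ 2 * μ (m + 1) ^ (n + 2)
      ≤ (∑ i ∈ Finset.range (m + 1), (μ (m + 1) - μ i) ^ 2) * z₀ ^ (n + 2) := by
    have hstart : ∀ m, μ m ≤ z₀ → z₀ ≤ μ (m + 1) → (z₀ - μ 0) ^ 2 * μ (m + 1) ^ (n + 2)
        ≤ (∑ i ∈ Finset.range (m + 1), (μ (m + 1) - μ i) ^ 2) * z₀ ^ (n + 2) := by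
      intro m h1 h2
      refine le_trans ?_ (riesz_mul_pow_le hn hineq m hz₀pos h1 h2 le_rfl)
      refine mul_le_mul_of_nonneg_right ?_ (pow_pos (hz₀pos.trans_le h2) _).le
      exact Finset.single_le_sum (f := fun i ↦ (z₀ - μ i) ^ 2) (fun i _ ↦ sq_nonneg _)
        (Finset.mem_range.2 (Nat.succ_pos m))
    intro m
    induction m with
    | zero => exact hstart 0 hz₀μ
    | succ m ih =>
      intro h
      rcases le_total (μ (m + 1)) z₀ with h1 | h1
      · exact hstart _ h1 h
      · have hpos : 0 < μ (m + 1) := hz₀pos.trans_le h1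
        have h2 := ih h1
        have h3 := riesz_mul_pow_le hn hineq (m + 1) hpos le_rfl (hμ (Nat.le_succ _)) le_rfl
        rw [Finset.sum_range_succ _ (m + 1), sub_self, zero_pow two_ne_zero, add_zero] at h3
        set X := ∑ i ∈ Finset.range (m + 1), (μ (m + 1) - μ i) ^ 2
        set Y := ∑ i ∈ Finset.range (m + 1 + 1), (μ (m + 1 + 1) - μ i) ^ 2
        have hp1 : 0 < μ (m + 1) ^ (n + 2) := pow_pos hpos _
        have hp2 : 0 < μ (m + 1 + 1) ^ (n + 2) := pow_pos (hz₀pos.trans_le h) _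
        have hp3 : 0 < z₀ ^ (n + 2) := pow_pos hz₀pos _
        refine le_of_mul_le_mul_right ?_ hp1
        calc (z₀ - μ 0) ^ 2 * μ (m + 1 + 1) ^ (n + 2) * μ (m + 1) ^ (n + 2)
            = ((z₀ - μ 0) ^ 2 * μ (m + 1) ^ (n + 2)) * μ (m + 1 + 1) ^ (n + 2) := by ring
          _ ≤ (X * z₀ ^ (n + 2)) * μ (m + 1 + 1) ^ (n + 2) :=
            mul_le_mul_of_nonneg_right h2 hp2.le
          _ = (X * μ (m + 1 + 1) ^ (n + 2)) * z₀ ^ (n + 2) := by ring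
          _ ≤ (Y * μ (m + 1) ^ (n + 2)) * z₀ ^ (n + 2) := mul_le_mul_of_nonneg_right h3 hp3.le
          _ = _ := by ring
  obtain ⟨m, rfl⟩ : ∃ m, k = m + 1 := ⟨k - 1, by omega⟩
  set z := μ (m + 1) with hz
  have hzpos : 0 < z := hz₀pos.trans hlt
  have hl := hlow m hlt.le
  set R₂ := ∑ i ∈ Finset.range (m + 1), (z - μ i) ^ 2 with hR₂
  set R₁ := ∑ i ∈ Finset.range (m + 1), (z - μ i) with hR₁
  -- upper bound for the Riesz mean, by the Cauchy-Schwarz inequality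
  have hcs : R₁ ^ 2 ≤ ((m + 1 : ℕ) : ℝ) * R₂ := by
    have := sq_sum_le_card_mul_sum_sq (s := Finset.range (m + 1)) (f := fun i ↦ z - μ i)
    rwa [Finset.card_range] at this
  have hyang : (n + 2) * R₂ ≤ 2 * z * R₁ := by
    have h1 := hineq (m + 1)
    have h2 : ∑ i ∈ Finset.range (m + 1), (z - μ i) * μ i = z * R₁ - R₂ := by
      rw [hR₁, hR₂, Finset.mul_sum, ← Finset.sum_sub_distrib]
      exact Finset.sum_congr rfl fun i _ ↦ by ring
    rw [← hz, h2] at h1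
    have h3 := mul_le_mul_of_nonneg_left h1 hn0.le
    have h4 : (n : ℝ) * (2 / n * (z * R₁ - R₂)) = 2 * (z * R₁ - R₂) := by field_simp
    rw [h4] at h3
    linarith
  have hR₂pos : 0 < R₂ := by
    have h1 : 0 < z - μ 0 := by linarith
    have h2 := Finset.single_le_sum (f := fun i ↦ (z - μ i) ^ 2) (fun i _ ↦ sq_nonneg _)
      (Finset.mem_range.2 (Nat.succ_pos m))
    exact (pow_pos h1 2).trans_le h2
  have hup : (n + 2) ^ 2 * R₂ ≤ 4 * ((m + 1 : ℕ) : ℝ) * z ^ 2 := by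
    have h1 : ((n + 2) * R₂) ^ 2 ≤ (2 * z * R₁) ^ 2 :=
      pow_le_pow_left₀ (by positivity) hyang 2
    have h2 : (2 * z * R₁) ^ 2 ≤ 4 * z ^ 2 * (((m + 1 : ℕ) : ℝ) * R₂) := by
      have := mul_le_mul_of_nonneg_left hcs (by positivity : 0 ≤ 4 * z ^ 2)
      linarith
    refine le_of_mul_le_mul_right ?_ hR₂pos
    linarith
  have hzn : z ^ n ≤ ((m + 1 : ℕ) : ℝ) * z₀ ^ n := by
    have h1 : (n + 2) * (z₀ - μ 0) = 2 * z₀ := by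
      rw [hz₀]
      field_simp
      ring
    have h2 : (2 * z₀) ^ 2 * z ^ (n + 2) ≤ 4 * ((m + 1 : ℕ) : ℝ) * z ^ 2 * z₀ ^ (n + 2) := by
      calc (2 * z₀) ^ 2 * z ^ (n + 2) = (n + 2) ^ 2 * ((z₀ - μ 0) ^ 2 * z ^ (n + 2)) := by
            rw [← h1]
            ring
        _ ≤ (n + 2) ^ 2 * (R₂ * z₀ ^ (n + 2)) := by gcongr
        _ = ((n + 2) ^ 2 * R₂) * z₀ ^ (n + 2) := by ring
        _ ≤ _ := by gcongr
    have hp : 0 < 4 * z₀ ^ 2 * z ^ 2 := by positivity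
    refine le_of_mul_le_mul_left ?_ hp
    calc 4 * z₀ ^ 2 * z ^ 2 * z ^ n = (2 * z₀) ^ 2 * z ^ (n + 2) := by ring
      _ ≤ _ := h2
      _ = _ := by ring
  have hroot : z ≤ (((m + 1 : ℕ) : ℝ) * z₀ ^ n) ^ (1 / n : ℝ) := by
    have h1 := Real.rpow_le_rpow (pow_pos hzpos n).le hzn (by positivity : (0 : ℝ) ≤ 1 / n)
    rwa [← Real.rpow_natCast z n, ← Real.rpow_mul hzpos.le, mul_one_div_cancel hn0.ne',
      Real.rpow_one] at h1
  rw [Real.mul_rpow (by positivity) (by positivity), ← Real.rpow_natCast z₀ n,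
    ← Real.rpow_mul hz₀pos.le, mul_one_div_cancel hn0.ne', Real.rpow_one] at hroot
  calc z ≤ _ := hroot
    _ = _ := by rw [hz₀]; ring

/-- The case `μ 0 = 0` follows by adding a small positive constant to the sequence. -/
lemma le_rpow_mul_of_nonneg (hn : 1 ≤ n) (hμ : Monotone μ) (h0 : 0 ≤ μ 0)
    (hineq : ∀ k : ℕ, ∑ i ∈ Finset.range k, (μ k - μ i) ^ 2
      ≤ 2 / n * ∑ i ∈ Finset.range k, (μ k - μ i) * μ i) {k : ℕ} (hk : 1 ≤ k) :
    μ k ≤ (1 + 2 / n) * (k : ℝ) ^ (1 / n : ℝ) * μ 0 := by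
  set C := (1 + 2 / n) * (k : ℝ) ^ (1 / n : ℝ)
  have hε : ∀ ε > 0, μ k + ε ≤ C * (μ 0 + ε) := by
    intro ε hε
    refine le_rpow_mul_of_pos (μ := fun i ↦ μ i + ε) hn (fun i j hij ↦ by
      simpa using hμ hij) (by positivity) (fun k ↦ ?_) hk
    simp only [add_sub_add_right_eq_sub]
    refine (hineq k).trans (mul_le_mul_of_nonneg_left (Finset.sum_le_sum fun i hi ↦ ?_)
      (by positivity))
    have h1 := hμ (Finset.mem_range.1 hi).le
    nlinarith
  have h1 : Tendsto (fun ε : ℝ ↦ μ k + ε) (𝓝[>] 0) (𝓝 (μ k + 0)) :=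
    ((continuous_const.add continuous_id).tendsto 0).mono_left nhdsWithin_le_nhds
  have h2 : Tendsto (fun ε : ℝ ↦ C * (μ 0 + ε)) (𝓝[>] 0) (𝓝 (C * (μ 0 + 0))) :=
    ((continuous_const.mul (continuous_const.add continuous_id)).tendsto 0).mono_left
      nhdsWithin_le_nhds
  simpa using le_of_tendsto_of_tendsto h1 h2 (eventually_mem_nhdsWithin.mono fun ε h ↦ hε ε h)

end Riesz

/-! ### Limits in the mean -/

section MeanLimit

variable {X : Type*} [MeasurableSpace X] {μ : Measure X}

/-- Convergence in `L²(μ)` of a sequence of functions. -/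
structure TendstoMean (μ : Measure X) (ψ : ℕ → X → ℝ) (g : X → ℝ) : Prop where
  memLp : ∀ k, MemLp (ψ k) 2 μ
  memLp_lim : MemLp g 2 μ
  tendsto : Tendsto (fun k ↦ eLpNorm (ψ k - g) 2 μ) atTop (𝓝 0)

lemma eLpNorm_two_eq (h : X → ℝ) :
    eLpNorm h 2 μ = (∫⁻ x, ENNReal.ofReal (h x ^ 2) ∂μ) ^ (1 / 2 : ℝ) := by
  rw [eLpNorm_eq_lintegral_rpow_enorm_toReal (by norm_num) (by norm_num)]
  congr 1
  refine lintegral_congr fun x ↦ ?_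
  rw [Real.enorm_eq_ofReal_abs, ENNReal.toReal_ofNat, ENNReal.rpow_ofNat,
    ← ENNReal.ofReal_pow (abs_nonneg _), sq_abs]

lemma integrable_mul_of_memLp_two {g g' : X → ℝ} (hg : MemLp g 2 μ) (hg' : MemLp g' 2 μ) :
    Integrable (fun x ↦ g x * g' x) μ :=
  hg.integrable_mul hg'

namespace TendstoMean

variable {ψ ψ' : ℕ → X → ℝ} {g g' : X → ℝ}

lemma of_lintegral (hψ : ∀ k, MemLp (ψ k) 2 μ) (hg : AEStronglyMeasurable g μ)
    (h : Tendsto (fun k ↦ ∫⁻ x, ENNReal.ofReal ((ψ k x - g x) ^ 2) ∂μ) atTop (𝓝 0)) :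
    TendstoMean μ ψ g := by
  have h1 : Tendsto (fun k ↦ eLpNorm (ψ k - g) 2 μ) atTop (𝓝 0) := by
    simp only [eLpNorm_two_eq, Pi.sub_apply]
    have := h.ennrpow_const (1 / 2 : ℝ)
    simpa using this
  refine ⟨hψ, ?_, h1⟩
  obtain ⟨k, hk⟩ := (h1.eventually (gt_mem_nhds ENNReal.zero_lt_top)).exists
  have h2 : MemLp (ψ k - g) 2 μ := ⟨(hψ k).1.sub hg, hk⟩
  simpa using (hψ k).sub h2

lemma const (hg : MemLp g 2 μ) : TendstoMean μ (fun _ ↦ g) g :=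
  ⟨fun _ ↦ hg, hg, by simp⟩

lemma tendsto_toLp (h : TendstoMean μ ψ g) :
    Tendsto (fun k ↦ (h.memLp k).toLp (ψ k)) atTop (𝓝 (h.memLp_lim.toLp g)) :=
  (Lp.tendsto_Lp_iff_tendsto_eLpNorm'' ψ h.memLp g h.memLp_lim).2 h.tendsto

lemma inner_toLp (hg : MemLp g 2 μ) (hg' : MemLp g' 2 μ) :
    inner ℝ (hg.toLp g) (hg'.toLp g') = ∫ x, g x * g' x ∂μ := by
  rw [L2.inner_def]
  refine integral_congr_ae ?_
  filter_upwards [hg.coeFn_toLp, hg'.coeFn_toLp] with x hx hx'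
  rw [hx, hx']
  simp [mul_comm]

/-- Integrals of products converge. -/
lemma tendsto_integral_mul (h : TendstoMean μ ψ g) (h' : TendstoMean μ ψ' g') :
    Tendsto (fun k ↦ ∫ x, ψ k x * ψ' k x ∂μ) atTop (𝓝 (∫ x, g x * g' x ∂μ)) := by
  have h1 := h.tendsto_toLp.inner h'.tendsto_toLp (𝕜 := ℝ)
  simpa only [inner_toLp] using h1

lemma unique (h : TendstoMean μ ψ g) (h' : TendstoMean μ ψ g') : g =ᵐ[μ] g' := by
  have h1 := tendsto_nhds_unique h.tendsto_toLp h'.tendsto_toLp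
  exact (MemLp.toLp_eq_toLp_iff _ _).1 h1

lemma add (h : TendstoMean μ ψ g) (h' : TendstoMean μ ψ' g') :
    TendstoMean μ (fun k x ↦ ψ k x + ψ' k x) (fun x ↦ g x + g' x) := by
  refine ⟨fun k ↦ (h.memLp k).add (h'.memLp k), h.memLp_lim.add h'.memLp_lim, ?_⟩
  have h1 := h.tendsto.add h'.tendsto
  rw [add_zero] at h1
  refine tendsto_of_tendsto_of_tendsto_of_le_of_le tendsto_const_nhds h1 (fun _ ↦ zero_le)
    fun k ↦ ?_
  have h2 : (fun x ↦ ψ k x + ψ' k x) - (fun x ↦ g x + g' x) = (ψ k - g) + (ψ' k - g') := by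
    ext x
    simp only [Pi.sub_apply, Pi.add_apply]
    ring
  dsimp only
  rw [h2]
  exact eLpNorm_add_le ((h.memLp k).1.sub h.memLp_lim.1) ((h'.memLp k).1.sub h'.memLp_lim.1)
    (by norm_num)

lemma sum {ι : Type*} (T : Finset ι) {ψ : ι → ℕ → X → ℝ} {g : ι → X → ℝ}
    (h : ∀ i, TendstoMean μ (ψ i) (g i)) :
    TendstoMean μ (fun k x ↦ ∑ i ∈ T, ψ i k x) (fun x ↦ ∑ i ∈ T, g i x) := by
  classical
  induction T using Finset.induction_on with
  | empty => simpa using TendstoMean.const (MemLp.zero' (μ := μ) (p := 2) (ε := ℝ))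
  | insert i T hi ih => simpa only [Finset.sum_insert hi] using (h i).add ih

/-- Multiplication by a bounded function preserves convergence in the mean. -/
lemma bdd_mul (h : TendstoMean μ ψ g) {b : X → ℝ} (hb : AEStronglyMeasurable b μ) {C : ℝ}
    (hC : ∀ᵐ x ∂μ, |b x| ≤ C) :
    TendstoMean μ (fun k x ↦ b x * ψ k x) (fun x ↦ b x * g x) := by
  have hb' : MemLp b ⊤ μ := memLp_top_of_bound hb C hC
  have hmul : ∀ {w : X → ℝ}, MemLp w 2 μ → MemLp (fun x ↦ b x * w x) 2 μ := fun hw ↦ hw.mul hb'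
  refine ⟨fun k ↦ hmul (h.memLp k), hmul h.memLp_lim, ?_⟩
  have h1 := ENNReal.Tendsto.const_mul (a := ENNReal.ofReal C) h.tendsto
    (Or.inr ENNReal.ofReal_ne_top)
  rw [mul_zero] at h1
  refine tendsto_of_tendsto_of_tendsto_of_le_of_le tendsto_const_nhds h1 (fun _ ↦ zero_le)
    fun k ↦ ?_
  refine eLpNorm_le_mul_eLpNorm_of_ae_le_mul ?_ 2
  filter_upwards [hC] with x hx
  simp only [Pi.sub_apply, ← mul_sub, norm_mul, Real.norm_eq_abs]
  exact mul_le_mul_of_nonneg_right hx (abs_nonneg _)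

/-- A sequence that is Cauchy in the mean converges in the mean. -/
lemma exists_of_cauchy (hψ : ∀ k, MemLp (ψ k) 2 μ)
    (h : Tendsto (fun q : ℕ × ℕ ↦ eLpNorm (ψ q.1 - ψ q.2) 2 μ) atTop (𝓝 0)) :
    ∃ g, TendstoMean μ ψ g := by
  have hc : CauchySeq fun k ↦ (hψ k).toLp (ψ k) := by
    rw [cauchySeq_iff_tendsto_dist_atTop_0]
    have h1 := (ENNReal.tendsto_toReal ENNReal.zero_ne_top).comp h
    refine h1.congr fun q ↦ ?_
    rw [dist_eq_norm, ← MemLp.toLp_sub, Lp.norm_toLp]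
    rfl
  obtain ⟨G, hG⟩ := cauchySeq_tendsto_of_complete hc
  have hGm : MemLp (G : X → ℝ) 2 μ := Lp.memLp G
  refine ⟨G, hψ, hGm, ?_⟩
  rw [← Lp.tendsto_Lp_iff_tendsto_eLpNorm'' ψ hψ G hGm]
  rwa [Lp.toLp_coeFn]

end TendstoMean

end MeanLimit

namespace StrictlyPseudoconvexCR

variable {n : ℕ} {M : Type*} [TopologicalSpace M] [ChartedSpace (CRModel n) M]
  [IsManifold 𝓘(ℝ, CRModel n) ∞ M] [T2Space M] (S : StrictlyPseudoconvexCR n M)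

/-! ### The form domain -/

section Test

variable {Ω : Set M} {φ ψ : M → ℝ}

lemma IsTestFunction.mul (hφ : IsTestFunction n Ω φ)
    (hψ : ContMDiff 𝓘(ℝ, CRModel n) 𝓘(ℝ, ℝ) 2 ψ) : IsTestFunction n Ω (ψ * φ) :=
  ⟨hψ.mul hφ.1, hφ.2.1.mul_left, tsupport_mul_subset_right.trans hφ.2.2⟩

lemma IsTestFunction.exists_bound (hφ : IsTestFunction n Ω φ) : ∃ C, ∀ x, |φ x| ≤ C := by
  obtain ⟨C, hC⟩ := hφ.1.continuous.bounded_above_of_compact_support hφ.2.1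
  exact ⟨C, fun x ↦ hC x⟩

end Test

variable [MeasurableSpace M] [BorelSpace M] [SecondCountableTopology M] {m : ℕ}

/-- A sequence of test functions converging to `u` in the form norm, together with the limits `g α`
of the scalar products of the horizontal gradients with those of the components of `f`. For a
semi-isometric map, `(g α)` represents `df (∇^H u)` and so replaces the weak horizontal gradient
of `u`. The potential enters through `√|V| u`, which is square-integrable. -/
structure FormApprox (f : M → EuclideanSpace ℝ (Fin m)) (Ω : Set M) (V u : M → ℝ)
    (φ : ℕ → M → ℝ) (g : Fin m → M → ℝ) : Prop where
  test : ∀ k, IsTestFunction n Ω (φ k)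
  tendsto : TendstoMean (S.vol.restrict Ω) φ u
  tendsto_sqrt : TendstoMean (S.vol.restrict Ω) (fun k x ↦ √|V x| * φ k x) (fun x ↦ √|V x| * u x)
  tendsto_carre : ∀ α,
    TendstoMean (S.vol.restrict Ω) (fun k ↦ S.carre (component f α) (φ k)) (g α)

lemma isFiniteMeasure_restrict {Ω : Set M} (hΩc : IsCompact (closure Ω)) :
    IsFiniteMeasure (S.vol.restrict Ω) := by
  have := S.isLocallyFiniteMeasure_vol
  exact ⟨by
    rw [Measure.restrict_apply_univ]
    exact (measure_mono subset_closure).trans_lt hΩc.measure_lt_top⟩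

omit [SecondCountableTopology M] in
lemma exists_bound_ae {Ω : Set M} (hΩ : IsOpen Ω) (hΩc : IsCompact (closure Ω)) {b : M → ℝ}
    (hb : Continuous b) : ∃ C, ∀ᵐ x ∂S.vol.restrict Ω, |b x| ≤ C := by
  obtain ⟨C, hC⟩ := hΩc.exists_bound_of_continuousOn hb.continuousOn
  exact ⟨C, (ae_restrict_iff' hΩ.measurableSet).2 (Eventually.of_forall fun x hx ↦
    hC x (subset_closure hx))⟩

variable {f : M → EuclideanSpace ℝ (Fin m)}
  (hf : ContMDiff 𝓘(ℝ, CRModel n) 𝓘(ℝ, EuclideanSpace ℝ (Fin m)) 2 f)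
  (hfiso : S.IsSemiIsometric f)
  {Ω : Set M} (hΩc : IsCompact (closure Ω))
  {V : M → ℝ} (hV : LocallyIntegrableOn V Ω S.vol)

lemma memLp_sqrt_mul_test (hV : LocallyIntegrableOn V Ω S.vol) {φ : M → ℝ}
    (hφ : IsTestFunction n Ω φ) :
    MemLp (fun x ↦ √|V x| * φ x) 2 (S.vol.restrict Ω) := by
  have hVm : AEStronglyMeasurable V (S.vol.restrict Ω) := hV.aestronglyMeasurable
  have hsm : AEStronglyMeasurable (fun x ↦ √|V x| * φ x) (S.vol.restrict Ω) :=
    (Real.continuous_sqrt.comp continuous_abs).comp_aestronglyMeasurable hVm |>.mul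
      hφ.1.continuous.aestronglyMeasurable
  rw [memLp_two_iff_integrable_sq hsm]
  obtain ⟨C, hC⟩ := hφ.exists_bound
  have h1 : IntegrableOn V (tsupport φ) S.vol :=
    hV.integrableOn_compact_subset hφ.2.2 hφ.2.1.isCompact
  have h2 : IntegrableOn (fun x ↦ φ x ^ 2 * |V x|) (tsupport φ) S.vol := by
    refine h1.abs.bdd_mul (c := C ^ 2) (hφ.1.continuous.pow 2).aestronglyMeasurable
      (Eventually.of_forall fun x ↦ ?_)
    rw [Real.norm_eq_abs, abs_pow]
    exact pow_le_pow_left₀ (abs_nonneg _) (hC x) 2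
  have h3 : Integrable (fun x ↦ φ x ^ 2 * |V x|) S.vol := by
    rw [← integrableOn_iff_integrable_of_support_subset (s := tsupport φ)]
    · exact h2
    · intro x hx
      by_contra h
      exact hx (by simp [image_eq_zero_of_notMem_tsupport h])
  refine h3.restrict.congr (Eventually.of_forall fun x ↦ ?_)
  simp only [mul_pow, Real.sq_sqrt (abs_nonneg _)]
  ring

include hf hfiso hΩc hV

/-- Every function in the form domain has an approximating sequence. -/
lemma exists_formApprox {u : M → ℝ} (hu : MemLp u 2 (S.vol.restrict Ω))
    (hmem : S.MemFormDomain Ω V u) : ∃ φ g, S.FormApprox f Ω V u φ g := by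
  have := S.isFiniteMeasure_restrict hΩc
  obtain ⟨φ, htest, h1, h2, h3⟩ := hmem
  have hVm : AEStronglyMeasurable V (S.vol.restrict Ω) := hV.aestronglyMeasurable
  have hsm : AEStronglyMeasurable (fun x ↦ √|V x|) (S.vol.restrict Ω) :=
    (Real.continuous_sqrt.comp continuous_abs).comp_aestronglyMeasurable hVm
  have hcarre : ∀ k α, MemLp (S.carre (component f α) (φ k)) 2 (S.vol.restrict Ω) := fun k α ↦
    (S.continuous_carre (contMDiff_component hf α) (htest k).1).memLp_of_hasCompactSupport
      (S.hasCompactSupport_carre (contMDiff_component hf α) (htest k).1 (htest k).2.1)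
  have hlim : ∀ α, ∃ g, TendstoMean (S.vol.restrict Ω)
      (fun k ↦ S.carre (component f α) (φ k)) g := by
    intro α
    refine TendstoMean.exists_of_cauchy (fun k ↦ hcarre k α) ?_
    have h4 := h3.ennrpow_const (1 / 2 : ℝ)
    rw [ENNReal.zero_rpow_of_pos (by norm_num)] at h4
    refine tendsto_of_tendsto_of_tendsto_of_le_of_le tendsto_const_nhds h4 (fun _ ↦ zero_le)
      fun q ↦ ?_
    dsimp only
    rw [eLpNorm_two_eq]
    refine ENNReal.rpow_le_rpow (lintegral_mono fun x ↦ ENNReal.ofReal_le_ofReal ?_) (by norm_num)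
    rw [gradSq_eq_carre, ← S.sum_carre_component_mul hf hfiso, Pi.sub_apply,
      ← S.carre_sub (mdifferentiableAt_of_two (htest q.1).1 x)
        (mdifferentiableAt_of_two (htest q.2).1 x), sq]
    exact Finset.single_le_sum (f := fun α ↦ S.carre (component f α) (φ q.1 - φ q.2) x
      * S.carre (component f α) (φ q.1 - φ q.2) x) (fun _ _ ↦ mul_self_nonneg _)
      (Finset.mem_univ α)
  choose g hg using hlim
  refine ⟨φ, g, htest, .of_lintegral (fun k ↦ ?_) hu.1 h1, .of_lintegral (fun k ↦
    S.memLp_sqrt_mul_test hV (htest k)) (hsm.mul hu.1) ?_, hg⟩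
  · exact (htest k).1.continuous.memLp_of_hasCompactSupport (htest k).2.1
  · refine h2.congr fun k ↦ lintegral_congr fun x ↦ ?_
    congr 1
    rw [← mul_sub, mul_pow, Real.sq_sqrt (abs_nonneg _)]

end StrictlyPseudoconvexCR

/-! ### Weak identities for functions of the form domain -/

/-- The sign of a real number, with value `1` at `0`. -/
def absSign (t : ℝ) : ℝ := if 0 ≤ t then 1 else -1

lemma measurable_absSign : Measurable absSign :=
  Measurable.ite measurableSet_Ici measurable_const measurable_const

lemma abs_absSign_le (t : ℝ) : |absSign t| ≤ 1 := by
  unfold absSign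
  split_ifs <;> simp

lemma sqrt_abs_mul_absSign (t a b : ℝ) : √|t| * a * (absSign t * (√|t| * b)) = t * a * b := by
  have h1 : √|t| * √|t| = |t| := Real.mul_self_sqrt (abs_nonneg t)
  have h2 : absSign t * |t| = t := by
    unfold absSign
    split_ifs with h
    · rw [abs_of_nonneg h, one_mul]
    · rw [abs_of_neg (not_le.1 h)]
      ring
  calc √|t| * a * (absSign t * (√|t| * b)) = absSign t * (√|t| * √|t|) * a * b := by ring
    _ = t * a * b := by rw [h1, h2]

namespace StrictlyPseudoconvexCR

variable {n : ℕ} {M : Type*} [TopologicalSpace M] [ChartedSpace (CRModel n) M]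
  [IsManifold 𝓘(ℝ, CRModel n) ∞ M] [T2Space M] (S : StrictlyPseudoconvexCR n M)
  [MeasurableSpace M] [BorelSpace M] [SecondCountableTopology M] {m : ℕ}
  {f : M → EuclideanSpace ℝ (Fin m)} {Ω : Set M} {V : M → ℝ}

/-- Integration by parts on `Ω` against a test function. -/
lemma setIntegral_carre_add {φ ψ : M → ℝ} (hφ : ContMDiff 𝓘(ℝ, CRModel n) 𝓘(ℝ, ℝ) 2 φ)
    (hψ : IsTestFunction n Ω ψ) :
    ∫ x in Ω, S.carre φ ψ x ∂S.vol + ∫ x in Ω, ψ x * S.tension φ x ∂S.vol = 0 := by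
  have := S.isLocallyFiniteMeasure_vol
  have h1 : Integrable (S.carre φ ψ) S.vol :=
    (S.continuous_carre hφ hψ.1).integrable_of_hasCompactSupport
      (S.hasCompactSupport_carre hφ hψ.1 hψ.2.1)
  have h2 : Integrable (fun x ↦ ψ x * S.tension φ x) S.vol :=
    (hψ.1.continuous.mul (S.continuous_tension hφ)).integrable_of_hasCompactSupport
      hψ.2.1.mul_right
  rw [← integral_add h1.restrict h2.restrict, setIntegral_eq_integral_of_forall_compl_eq_zero,
    S.integral_carre_add hφ hψ.1 hψ.2.1]
  intro x hx
  have hx' : x ∉ tsupport ψ := fun h ↦ hx (hψ.2.2 h)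
  rw [S.carre_eq_zero_of_notMem_tsupport hφ hψ.1 hx', image_eq_zero_of_notMem_tsupport hx']
  ring

lemma memLp_of_continuous (hΩ : IsOpen Ω) (hΩc : IsCompact (closure Ω)) {b : M → ℝ}
    (hb : Continuous b) : MemLp b 2 (S.vol.restrict Ω) := by
  have := S.isFiniteMeasure_restrict hΩc
  obtain ⟨C, hC⟩ := S.exists_bound_ae hΩ hΩc hb
  exact MemLp.of_bound hb.aestronglyMeasurable C hC

lemma tendstoMean_continuous_mul (hΩ : IsOpen Ω) (hΩc : IsCompact (closure Ω)) {b : M → ℝ}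
    (hb : Continuous b) {ψ : ℕ → M → ℝ} {g : M → ℝ} (h : TendstoMean (S.vol.restrict Ω) ψ g) :
    TendstoMean (S.vol.restrict Ω) (fun k x ↦ b x * ψ k x) (fun x ↦ b x * g x) := by
  obtain ⟨C, hC⟩ := S.exists_bound_ae hΩ hΩc hb
  exact h.bdd_mul hb.aestronglyMeasurable hC

variable (hf : ContMDiff 𝓘(ℝ, CRModel n) 𝓘(ℝ, EuclideanSpace ℝ (Fin m)) 2 f)
  (hfiso : S.IsSemiIsometric f) (hΩ : IsOpen Ω) (hΩc : IsCompact (closure Ω))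
  (hV : LocallyIntegrableOn V Ω S.vol)

lemma continuous_component_carre (hf : ContMDiff 𝓘(ℝ, CRModel n) 𝓘(ℝ, EuclideanSpace ℝ (Fin m)) 2 f)
    (α β : Fin m) : Continuous (S.carre (component f α) (component f β)) :=
  S.continuous_carre (contMDiff_component hf α) (contMDiff_component hf β)

lemma continuous_component_tension
    (hf : ContMDiff 𝓘(ℝ, CRModel n) 𝓘(ℝ, EuclideanSpace ℝ (Fin m)) 2 f)
    (β : Fin m) : Continuous (S.tension (component f β)) :=
  S.continuous_tension (contMDiff_component hf β)

variable {u u' : M → ℝ} {φ φ' : ℕ → M → ℝ} {g g' : Fin m → M → ℝ} {l l' : ℝ}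

section

include hf hΩ hΩc

/-- The Leibniz rule for the approximations of `f β u`. -/
lemma FormApprox.tendsto_carre_mul (h : S.FormApprox f Ω V u φ g) (α β : Fin m) :
    TendstoMean (S.vol.restrict Ω) (fun k ↦ S.carre (component f α) (component f β * φ k))
      (fun x ↦ component f β x * g α x + S.carre (component f α) (component f β) x * u x) := by
  have h1 := (S.tendstoMean_continuous_mul hΩ hΩc (contMDiff_component hf β).continuous
    (h.tendsto_carre α)).add (S.tendstoMean_continuous_mul hΩ hΩc
      (S.continuous_component_carre hf α β) h.tendsto)
  convert h1 using 2 with k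
  ext x
  rw [S.carre_mul (mdifferentiableAt_of_two (contMDiff_component hf β) x)
    (mdifferentiableAt_of_two (h.test k).1 x)]
  ring

include hfiso

/-- The matrix `⟨∇^H f α, ∇^H f β⟩` is the orthogonal projection onto the image of the Levi
distribution, and fixes `(g β)`. -/
lemma FormApprox.sum_carre_mul (h : S.FormApprox f Ω V u φ g) (β : Fin m) :
    (fun x ↦ ∑ α, S.carre (component f α) (component f β) x * g α x)
      =ᵐ[S.vol.restrict Ω] g β := by
  have h1 := TendstoMean.sum Finset.univ fun α ↦ S.tendstoMean_continuous_mul hΩ hΩc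
    (S.continuous_component_carre hf α β) (h.tendsto_carre α)
  refine h1.unique ?_
  convert h.tendsto_carre β using 2 with k
  ext x
  exact S.sum_carre_component_mul hf hfiso (component f β) (φ k) x

/-- The tension is orthogonal to `(g β)`. -/
lemma FormApprox.sum_tension_mul (h : S.FormApprox f Ω V u φ g) :
    (fun x ↦ ∑ β, S.tension (component f β) x * g β x) =ᵐ[S.vol.restrict Ω] 0 := by
  have h1 := TendstoMean.sum Finset.univ fun β ↦ S.tendstoMean_continuous_mul hΩ hΩc
    (S.continuous_component_tension hf β) (h.tendsto_carre β)
  refine h1.unique ?_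
  convert TendstoMean.const (MemLp.zero (μ := S.vol.restrict Ω) (p := 2) (ε := ℝ)) using 2 with k
  ext x
  exact S.sum_tension_mul_carre hf hfiso (φ k) x

end

include hV in
lemma tendstoMean_absSign_mul {ψ : ℕ → M → ℝ} {w : M → ℝ}
    (h : TendstoMean (S.vol.restrict Ω) ψ w) :
    TendstoMean (S.vol.restrict Ω) (fun k x ↦ absSign (V x) * ψ k x)
      (fun x ↦ absSign (V x) * w x) := by
  have hVm : AEStronglyMeasurable V (S.vol.restrict Ω) := hV.aestronglyMeasurable
  exact h.bdd_mul (measurable_absSign.comp_aemeasurable hVm.aemeasurable).aestronglyMeasurable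
    (Eventually.of_forall fun x ↦ abs_absSign_le _)

/-- The weak equation, with the sub-Laplacian replaced by horizontal gradients. The term `V u ψ` is
split into the square-integrable factors `√|V| u` and `sign V √|V| ψ`, so that one may pass to the
limit in `ψ`. -/
def WeakEq (S : StrictlyPseudoconvexCR n M) (f : M → EuclideanSpace ℝ (Fin m)) (Ω : Set M)
    (V u : M → ℝ) (g : Fin m → M → ℝ) (l : ℝ) : Prop :=
  ∀ ψ, IsTestFunction n Ω ψ →
    ∑ α, ∫ x in Ω, g α x * S.carre (component f α) ψ x ∂S.vol
      + ∫ x in Ω, √|V x| * u x * (absSign (V x) * (√|V x| * ψ x)) ∂S.vol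
      = l * ∫ x in Ω, u x * ψ x ∂S.vol

include hf hfiso hΩ hΩc hV

/-- An eigenfunction solves the weak equation in gradient form. -/
lemma FormApprox.weakEq (h : S.FormApprox f Ω V u φ g) (hu : ∀ ψ : M → ℝ, IsTestFunction n Ω ψ →
      ∫ x in Ω, u x * (-S.subLaplacian ψ x + V x * ψ x) ∂S.vol = l * ∫ x in Ω, u x * ψ x ∂S.vol) :
    S.WeakEq f Ω V u g l := by
  intro ψ hψ
  have := S.isFiniteMeasure_restrict hΩc
  have htm : MemLp (S.tension ψ) 2 (S.vol.restrict Ω) :=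
    S.memLp_of_continuous hΩ hΩc (S.continuous_tension hψ.1)
  have hPm : ∀ α, MemLp (S.carre (component f α) ψ) 2 (S.vol.restrict Ω) := fun α ↦
    S.memLp_of_continuous hΩ hΩc (S.continuous_carre (contMDiff_component hf α) hψ.1)
  have h1 : ∫ x in Ω, u x * S.tension ψ x ∂S.vol
      = -∑ α, ∫ x in Ω, g α x * S.carre (component f α) ψ x ∂S.vol := by
    refine tendsto_nhds_unique (h.tendsto.tendsto_integral_mul (.const htm)) ?_
    have h2 := (tendsto_finsetSum Finset.univ fun α _ ↦
      (h.tendsto_carre α).tendsto_integral_mul (.const (hPm α))).neg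
    refine h2.congr fun k ↦ ?_
    have h3 := S.setIntegral_carre_add hψ.1 (h.test k)
    have h4 : ∫ x in Ω, S.carre ψ (φ k) x ∂S.vol
        = ∑ α, ∫ x in Ω, S.carre (component f α) (φ k) x * S.carre (component f α) ψ x ∂S.vol := by
      rw [← integral_finsetSum _ fun α _ ↦
        integrable_mul_of_memLp_two ((h.tendsto_carre α).memLp k) (hPm α)]
      congr 1
      ext x
      rw [S.sum_carre_component_mul hf hfiso, carre_comm]
    rw [← h4]
    linarith
  have hsu := h.tendsto_sqrt.memLp_lim
  have hsψ := (S.tendstoMean_absSign_mul hV (.const (S.memLp_sqrt_mul_test hV hψ))).memLp_lim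
  have h5 : ∫ x in Ω, u x * (-S.subLaplacian ψ x + V x * ψ x) ∂S.vol
      = -∫ x in Ω, u x * S.tension ψ x ∂S.vol
        + ∫ x in Ω, √|V x| * u x * (absSign (V x) * (√|V x| * ψ x)) ∂S.vol := by
    have h6 : Integrable (fun x ↦ u x * S.tension ψ x) (S.vol.restrict Ω) :=
      h.tendsto.memLp_lim.integrable_mul htm
    have h7 : Integrable (fun x ↦ -(u x * S.tension ψ x)) (S.vol.restrict Ω) := h6.neg
    rw [← integral_neg, ← integral_add h7 (integrable_mul_of_memLp_two hsu hsψ)]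
    congr 1
    ext x
    simp only [sqrt_abs_mul_absSign, subLaplacian]
    ring
  rw [← hu ψ hψ, h5, h1]
  ring

/-- The weak equation tested with `f β u'`. -/
lemma FormApprox.weakEq_mul (h : S.FormApprox f Ω V u φ g) (hu : S.WeakEq f Ω V u g l)
    (h' : S.FormApprox f Ω V u' φ' g') (β : Fin m) :
    ∑ α, ∫ x in Ω, g α x * (component f β x * g' α x) ∂S.vol + ∫ x in Ω, g β x * u' x ∂S.vol
      + ∫ x in Ω, √|V x| * u x * (absSign (V x) * (component f β x * (√|V x| * u' x))) ∂S.vol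
      = l * ∫ x in Ω, u x * (component f β x * u' x) ∂S.vol := by
  have hfβ := (contMDiff_component hf β).continuous
  have hfu := S.tendstoMean_continuous_mul hΩ hΩc hfβ h'.tendsto
  have hfs := S.tendstoMean_absSign_mul hV
    (S.tendstoMean_continuous_mul hΩ hΩc hfβ h'.tendsto_sqrt)
  have hl := (tendsto_finsetSum Finset.univ fun α _ ↦
    (TendstoMean.const (h.tendsto_carre α).memLp_lim).tendsto_integral_mul
      (h'.tendsto_carre_mul S hf hΩ hΩc α β)).add
    ((TendstoMean.const h.tendsto_sqrt.memLp_lim).tendsto_integral_mul hfs)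
  have hr := ((TendstoMean.const h.tendsto.memLp_lim).tendsto_integral_mul hfu).const_mul l
  have heq := tendsto_nhds_unique (hl.congr fun k ↦ ?_) hr
  · rw [← heq]
    congr 1
    have hi1 : ∀ α, Integrable (fun x ↦ g α x * (component f β x * g' α x)) (S.vol.restrict Ω) :=
      fun α ↦ (h.tendsto_carre α).memLp_lim.integrable_mul
        (S.tendstoMean_continuous_mul hΩ hΩc hfβ (h'.tendsto_carre α)).memLp_lim
    have hi2 : ∀ α, Integrable
        (fun x ↦ g α x * (S.carre (component f α) (component f β) x * u' x))
        (S.vol.restrict Ω) := fun α ↦ (h.tendsto_carre α).memLp_lim.integrable_mul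
      (S.tendstoMean_continuous_mul hΩ hΩc (S.continuous_component_carre hf α β)
        h'.tendsto).memLp_lim
    have h1 : ∫ x in Ω, g β x * u' x ∂S.vol
        = ∑ α, ∫ x in Ω, g α x * (S.carre (component f α) (component f β) x * u' x) ∂S.vol := by
      rw [← integral_finsetSum _ fun α _ ↦ hi2 α]
      refine integral_congr_ae ?_
      filter_upwards [h.sum_carre_mul S hf hfiso hΩ hΩc β] with x hx
      rw [← hx, Finset.sum_mul]
      exact Finset.sum_congr rfl fun α _ ↦ by ring
    rw [h1, ← Finset.sum_add_distrib]
    refine Finset.sum_congr rfl fun α _ ↦ ?_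
    rw [← integral_add (hi1 α) (hi2 α)]
    simp only [mul_add]
  · have h2 := hu _ ((h'.test k).mul (contMDiff_component hf β))
    rw [← sub_eq_zero] at h2 ⊢
    rw [← h2]
    congr 2
    congr 1
    ext x
    simp only [Pi.mul_apply]
    ring

/-- The matrix coefficients of the commutator of `-Δ_b + V` with the multiplication by `f β`. -/
lemma FormApprox.commutator (h : S.FormApprox f Ω V u φ g) (hu : S.WeakEq f Ω V u g l)
    (h' : S.FormApprox f Ω V u' φ' g') (hu' : S.WeakEq f Ω V u' g' l') (β : Fin m) :
    ∫ x in Ω, g β x * u' x ∂S.vol - ∫ x in Ω, g' β x * u x ∂S.vol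
      = (l - l') * ∫ x in Ω, u x * (component f β x * u' x) ∂S.vol := by
  have h1 := h.weakEq_mul S hf hfiso hΩ hΩc hV hu h' β
  have h2 := h'.weakEq_mul S hf hfiso hΩ hΩc hV hu' h β
  have h3 : ∀ α, ∫ x in Ω, g' α x * (component f β x * g α x) ∂S.vol
      = ∫ x in Ω, g α x * (component f β x * g' α x) ∂S.vol := fun α ↦ by
    congr 1
    ext x
    ring
  have h4 : ∫ x in Ω, √|V x| * u' x * (absSign (V x) * (component f β x * (√|V x| * u x))) ∂S.vol
      = ∫ x in Ω, √|V x| * u x * (absSign (V x) * (component f β x * (√|V x| * u' x))) ∂S.vol := by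
    congr 1
    ext x
    ring
  have h5 : ∫ x in Ω, u' x * (component f β x * u x) ∂S.vol
      = ∫ x in Ω, u x * (component f β x * u' x) ∂S.vol := by
    congr 1
    ext x
    ring
  simp only [h3] at h2
  rw [h4, h5] at h2
  linarith

omit hV hfiso

/-- Integration by parts of `f β` against the product of two functions of the form domain. -/
lemma FormApprox.integral_tension_mul (h : S.FormApprox f Ω V u φ g)
    (h' : S.FormApprox f Ω V u' φ' g') (β : Fin m) :
    ∫ x in Ω, g' β x * u x ∂S.vol + ∫ x in Ω, g β x * u' x ∂S.vol
      + ∫ x in Ω, u x * (S.tension (component f β) x * u' x) ∂S.vol = 0 := by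
  have := S.isFiniteMeasure_restrict hΩc
  have hl := (((h'.tendsto_carre β).tendsto_integral_mul h.tendsto).add
    ((h.tendsto_carre β).tendsto_integral_mul h'.tendsto)).add
    (h.tendsto.tendsto_integral_mul (S.tendstoMean_continuous_mul hΩ hΩc
      (S.continuous_component_tension hf β) h'.tendsto))
  refine tendsto_nhds_unique hl (tendsto_const_nhds.congr fun k ↦ ?_)
  have h1 := S.setIntegral_carre_add (contMDiff_component hf β)
    ((h'.test k).mul (h.test k).1)
  rw [← integral_add (integrable_mul_of_memLp_two ((h'.tendsto_carre β).memLp k)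
      (h.tendsto.memLp k))
    (integrable_mul_of_memLp_two ((h.tendsto_carre β).memLp k) (h'.tendsto.memLp k)), ← h1]
  congr 2 <;> ext x
  · rw [S.carre_mul (mdifferentiableAt_of_two (h.test k).1 x)
      (mdifferentiableAt_of_two (h'.test k).1 x)]
    ring
  · simp only [Pi.mul_apply]
    ring

/-- Integration by parts of `f β` against `f β u ^ 2`. -/
lemma FormApprox.integral_carre_mul_self (h : S.FormApprox f Ω V u φ g) (β : Fin m) :
    ∫ x in Ω, u x * (S.carre (component f β) (component f β) x * u x) ∂S.vol
      + 2 * ∫ x in Ω, g β x * (component f β x * u x) ∂S.vol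
      + ∫ x in Ω, u x * (S.tension (component f β) x * (component f β x * u x)) ∂S.vol = 0 := by
  have := S.isFiniteMeasure_restrict hΩc
  have hfβ := (contMDiff_component hf β).continuous
  have hfu := S.tendstoMean_continuous_mul hΩ hΩc hfβ h.tendsto
  have hc := S.tendstoMean_continuous_mul hΩ hΩc (S.continuous_component_carre hf β β) h.tendsto
  have hl := ((h.tendsto.tendsto_integral_mul hc).add
    (((h.tendsto_carre β).tendsto_integral_mul hfu).const_mul 2)).add
    (h.tendsto.tendsto_integral_mul (S.tendstoMean_continuous_mul hΩ hΩc
      (S.continuous_component_tension hf β) hfu))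
  refine tendsto_nhds_unique hl (tendsto_const_nhds.congr fun k ↦ ?_)
  have h1 := S.setIntegral_carre_add (contMDiff_component hf β)
    (((h.test k).mul (h.test k).1).mul (contMDiff_component hf β))
  rw [← integral_const_mul,
    ← integral_add (integrable_mul_of_memLp_two (h.tendsto.memLp k) (hc.memLp k))
    ((integrable_mul_of_memLp_two ((h.tendsto_carre β).memLp k) (hfu.memLp k)).const_mul 2), ← h1]
  congr 2 <;> ext x
  · have h2 := mdifferentiableAt_of_two (h.test k).1 x
    rw [S.carre_mul (mdifferentiableAt_of_two (contMDiff_component hf β) x)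
      (mdifferentiableAt_of_two ((h.test k).1.mul (h.test k).1) x), S.carre_mul h2 h2]
    simp only [Pi.mul_apply]
    ring
  · simp only [Pi.mul_apply]
    ring

include hV

/-- The weak equation tested with the function itself. -/
lemma FormApprox.weakEq_self (h : S.FormApprox f Ω V u φ g) (hu : S.WeakEq f Ω V u g l) :
    ∑ α, ∫ x in Ω, g α x * g α x ∂S.vol + ∫ x in Ω, V x * u x ^ 2 ∂S.vol
      = l * ∫ x in Ω, u x * u x ∂S.vol := by
  have hl := (tendsto_finsetSum Finset.univ fun α _ ↦
    (TendstoMean.const (h.tendsto_carre α).memLp_lim).tendsto_integral_mul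
      (h.tendsto_carre α)).add
    ((TendstoMean.const h.tendsto_sqrt.memLp_lim).tendsto_integral_mul
      (S.tendstoMean_absSign_mul hV h.tendsto_sqrt))
  have hr := ((TendstoMean.const h.tendsto.memLp_lim).tendsto_integral_mul h.tendsto).const_mul l
  have heq := tendsto_nhds_unique (hl.congr fun k ↦ hu _ (h.test k)) hr
  rw [← heq]
  congr 2
  ext x
  rw [sqrt_abs_mul_absSign]
  ring

omit hf hΩ hΩc

lemma FormApprox.integrable_mul_sq (h : S.FormApprox f Ω V u φ g) :
    Integrable (fun x ↦ V x * u x ^ 2) (S.vol.restrict Ω) := by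
  refine (h.tendsto_sqrt.memLp_lim.integrable_mul
    (S.tendstoMean_absSign_mul hV h.tendsto_sqrt).memLp_lim).congr (Eventually.of_forall fun x ↦ ?_)
  simp only [Pi.mul_apply, sqrt_abs_mul_absSign]
  ring

end StrictlyPseudoconvexCR

namespace StrictlyPseudoconvexCR

variable {n : ℕ} {M : Type*} [TopologicalSpace M] [ChartedSpace (CRModel n) M]
  [IsManifold 𝓘(ℝ, CRModel n) ∞ M] [T2Space M] (S : StrictlyPseudoconvexCR n M)
  [MeasurableSpace M] [BorelSpace M] [SecondCountableTopology M] {m : ℕ}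
  {f : M → EuclideanSpace ℝ (Fin m)} {Ω : Set M} {V : M → ℝ}

/-! ### The commutator with a component of the map -/

/-- The function `[-Δ_b + V, f β] u = -(u Δ_b f β + 2 ⟨∇^H f β, ∇^H u⟩)`. -/
def commutatorField (f : M → EuclideanSpace ℝ (Fin m)) (u : M → ℝ) (g : Fin m → M → ℝ) (β : Fin m)
    (x : M) : ℝ :=
  -(S.tension (component f β) x * u x + 2 * g β x)

lemma continuous_norm_tension_sq
    (hf : ContMDiff 𝓘(ℝ, CRModel n) 𝓘(ℝ, EuclideanSpace ℝ (Fin m)) 2 f) :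
    Continuous fun x ↦ ‖S.tension f x‖ ^ 2 := by
  simp only [S.norm_tension_sq hf]
  exact continuous_finsetSum _ fun β _ ↦ (S.continuous_component_tension hf β).pow 2

variable (hf : ContMDiff 𝓘(ℝ, CRModel n) 𝓘(ℝ, EuclideanSpace ℝ (Fin m)) 2 f)
  (hfiso : S.IsSemiIsometric f) (hΩ : IsOpen Ω) (hΩc : IsCompact (closure Ω))
  (hV : LocallyIntegrableOn V Ω S.vol)
  {u u' : M → ℝ} {φ φ' : ℕ → M → ℝ} {g g' : Fin m → M → ℝ} {l l' : ℝ}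

include hf hΩ hΩc

lemma FormApprox.memLp_commutatorField (h : S.FormApprox f Ω V u φ g) (β : Fin m) :
    MemLp (S.commutatorField f u g β) 2 (S.vol.restrict Ω) :=
  ((S.tendstoMean_continuous_mul hΩ hΩc (S.continuous_component_tension hf β)
    h.tendsto).memLp_lim.add ((h.tendsto_carre β).memLp_lim.const_mul 2)).neg

lemma FormApprox.memLp_component_mul (h : S.FormApprox f Ω V u φ g) (β : Fin m) :
    MemLp (fun x ↦ component f β x * u x) 2 (S.vol.restrict Ω) :=
  (S.tendstoMean_continuous_mul hΩ hΩc (contMDiff_component hf β).continuous h.tendsto).memLp_lim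

/-- `⟨[-Δ_b + V, f β] u, f β u⟩` is the integral of `|∇^H f β| ^ 2 u ^ 2`. -/
lemma FormApprox.integral_commutatorField_mul_self (h : S.FormApprox f Ω V u φ g) (β : Fin m) :
    ∫ x in Ω, S.commutatorField f u g β x * (component f β x * u x) ∂S.vol
      = ∫ x in Ω, u x * (S.carre (component f β) (component f β) x * u x) ∂S.vol := by
  have h1 := h.integral_carre_mul_self S hf hΩ hΩc β
  have hfu := h.memLp_component_mul S hf hΩ hΩc β
  have hi1 : Integrable (fun x ↦ g β x * (component f β x * u x)) (S.vol.restrict Ω) :=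
    integrable_mul_of_memLp_two (h.tendsto_carre β).memLp_lim hfu
  have hi2 : Integrable (fun x ↦ u x * (S.tension (component f β) x * (component f β x * u x)))
      (S.vol.restrict Ω) :=
    integrable_mul_of_memLp_two h.tendsto.memLp_lim (S.tendstoMean_continuous_mul hΩ hΩc
      (S.continuous_component_tension hf β) (.const hfu)).memLp_lim
  have h2 : ∫ x in Ω, S.commutatorField f u g β x * (component f β x * u x) ∂S.vol
      = ∫ x in Ω, (-2 * (g β x * (component f β x * u x))
        - u x * (S.tension (component f β) x * (component f β x * u x))) ∂S.vol := by
    congr 1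
    ext x
    rw [commutatorField]
    ring
  rw [h2, integral_sub (hi1.const_mul _) hi2, integral_const_mul]
  linarith

lemma FormApprox.integrable_norm_tension_sq_mul (h : S.FormApprox f Ω V u φ g) :
    Integrable (fun x ↦ ‖S.tension f x‖ ^ 2 * u x ^ 2) (S.vol.restrict Ω) := by
  refine (integrable_mul_of_memLp_two h.tendsto.memLp_lim (S.tendstoMean_continuous_mul hΩ hΩc
    (S.continuous_norm_tension_sq hf) h.tendsto).memLp_lim).congr (Eventually.of_forall fun x ↦ ?_)
  ring

include hV

lemma FormApprox.integrable_tension_sub_mul (h : S.FormApprox f Ω V u φ g) :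
    Integrable (fun x ↦ (‖S.tension f x‖ ^ 2 - 4 * V x) * u x ^ 2) (S.vol.restrict Ω) := by
  refine ((h.integrable_norm_tension_sq_mul S hf hΩ hΩc).sub
    ((h.integrable_mul_sq S hV).const_mul 4)).congr (Eventually.of_forall fun x ↦ ?_)
  simp only [Pi.sub_apply]
  ring

include hfiso

/-- The matrix coefficients of the commutator in a basis of eigenfunctions. -/
lemma FormApprox.integral_commutatorField_mul (h : S.FormApprox f Ω V u φ g)
    (hu : S.WeakEq f Ω V u g l) (h' : S.FormApprox f Ω V u' φ' g') (hu' : S.WeakEq f Ω V u' g' l')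
    (β : Fin m) :
    ∫ x in Ω, S.commutatorField f u g β x * u' x ∂S.vol
      = (l' - l) * ∫ x in Ω, component f β x * u x * u' x ∂S.vol := by
  have h1 := h.commutator S hf hfiso hΩ hΩc hV hu h' hu' β
  have h2 := h.integral_tension_mul S hf hΩ hΩc h' β
  have hi1 : Integrable (fun x ↦ g β x * u' x) (S.vol.restrict Ω) :=
    integrable_mul_of_memLp_two (h.tendsto_carre β).memLp_lim h'.tendsto.memLp_lim
  have hi2 : Integrable (fun x ↦ u x * (S.tension (component f β) x * u' x)) (S.vol.restrict Ω) :=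
    integrable_mul_of_memLp_two h.tendsto.memLp_lim (S.tendstoMean_continuous_mul hΩ hΩc
      (S.continuous_component_tension hf β) h'.tendsto).memLp_lim
  have h3 : ∫ x in Ω, S.commutatorField f u g β x * u' x ∂S.vol
      = ∫ x in Ω, (-2 * (g β x * u' x) - u x * (S.tension (component f β) x * u' x)) ∂S.vol := by
    congr 1
    ext x
    rw [commutatorField]
    ring
  have h4 : ∫ x in Ω, component f β x * u x * u' x ∂S.vol
      = ∫ x in Ω, u x * (component f β x * u' x) ∂S.vol := by
    congr 1
    ext x
    ring
  rw [h3, h4, integral_sub (hi1.const_mul _) hi2, integral_const_mul]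
  linarith

/-- The sum over the components of the squared norms of the commutators: the cross terms
`u Δ_b f β ⟨∇^H f β, ∇^H u⟩` add up to zero because the tension is orthogonal to the image of the
Levi distribution. -/
lemma FormApprox.sum_integral_commutatorField_sq (h : S.FormApprox f Ω V u φ g)
    (hu : S.WeakEq f Ω V u g l) (hnorm : ∫ x in Ω, u x * u x ∂S.vol = 1) :
    ∑ β, ∫ x in Ω, S.commutatorField f u g β x * S.commutatorField f u g β x ∂S.vol
      = 4 * l + ∫ x in Ω, (‖S.tension f x‖ ^ 2 - 4 * V x) * u x ^ 2 ∂S.vol := by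
  have hm := h.memLp_commutatorField S hf hΩ hΩc
  have hg : ∀ β, Integrable (fun x ↦ g β x * g β x) (S.vol.restrict Ω) := fun β ↦
    integrable_mul_of_memLp_two (h.tendsto_carre β).memLp_lim (h.tendsto_carre β).memLp_lim
  have h1 := h.weakEq_self S hf hΩ hΩc hV hu
  have hT := h.integrable_norm_tension_sq_mul S hf hΩ hΩc
  have hVu := h.integrable_mul_sq S hV
  have h2 : ∫ x in Ω, (‖S.tension f x‖ ^ 2 - 4 * V x) * u x ^ 2 ∂S.vol
      = ∫ x in Ω, ‖S.tension f x‖ ^ 2 * u x ^ 2 ∂S.vol - 4 * ∫ x in Ω, V x * u x ^ 2 ∂S.vol := by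
    rw [← integral_const_mul, ← integral_sub hT (hVu.const_mul 4)]
    congr 1
    ext x
    ring
  have h3 : ∑ β, ∫ x in Ω, S.commutatorField f u g β x * S.commutatorField f u g β x ∂S.vol
      = ∫ x in Ω, (‖S.tension f x‖ ^ 2 * u x ^ 2 + 4 * ∑ β, g β x * g β x) ∂S.vol := by
    rw [← integral_finsetSum _ fun β _ ↦ integrable_mul_of_memLp_two (hm β) (hm β)]
    refine integral_congr_ae ?_
    filter_upwards [h.sum_tension_mul S hf hfiso hΩ hΩc] with x hx
    have h4 : ∑ β, S.commutatorField f u g β x * S.commutatorField f u g β x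
        = ∑ β, (S.tension (component f β) x ^ 2 * u x ^ 2
          + 4 * u x * (S.tension (component f β) x * g β x) + 4 * (g β x * g β x)) :=
      Finset.sum_congr rfl fun β _ ↦ by
        rw [commutatorField]
        ring
    rw [h4, Finset.sum_add_distrib, Finset.sum_add_distrib, ← Finset.mul_sum, hx,
      S.norm_tension_sq hf, ← Finset.sum_mul, ← Finset.mul_sum]
    simp
  rw [h3, h2, integral_add hT ((integrable_finsetSum _ fun β _ ↦ hg β).const_mul 4),
    integral_const_mul, integral_finsetSum _ fun β _ ↦ hg β]
  rw [hnorm] at h1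
  linarith

end StrictlyPseudoconvexCR

namespace StrictlyPseudoconvexCR

variable {n : ℕ} {M : Type*} [TopologicalSpace M] [ChartedSpace (CRModel n) M]
  [IsManifold 𝓘(ℝ, CRModel n) ∞ M] [T2Space M] (S : StrictlyPseudoconvexCR n M)
  [MeasurableSpace M] [BorelSpace M] [SecondCountableTopology M] {m : ℕ}
  {f : M → EuclideanSpace ℝ (Fin m)} {Ω : Set M} {V : M → ℝ}

/-! ### Eigenvalue inequalities -/

lemma inner_eq_setIntegral (w w' : Lp ℝ 2 (S.vol.restrict Ω)) :
    inner ℝ w w' = ∫ x in Ω, (w : M → ℝ) x * (w' : M → ℝ) x ∂S.vol := by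
  have h := TendstoMean.inner_toLp (Lp.memLp w) (Lp.memLp w')
  rwa [Lp.toLp_coeFn, Lp.toLp_coeFn] at h

/-- The integrability of the potential terms, the weighted inequality, and the nonnegativity of
`4 λ_i + D_i`, which is the sum of the squared norms of the commutators. -/
theorem weighted_eigenvalue_inequality (hn : 1 ≤ n)
    (hf : ContMDiff 𝓘(ℝ, CRModel n) 𝓘(ℝ, EuclideanSpace ℝ (Fin m)) 2 f)
    (hfiso : S.IsSemiIsometric f) (hΩ : IsOpen Ω) (hΩc : IsCompact (closure Ω))
    (hV : LocallyIntegrableOn V Ω S.vol) {lam : ℕ → ℝ}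
    {u : HilbertBasis ℕ ℝ (Lp ℝ 2 (S.vol.restrict Ω))} (hspec : S.IsDirichletSpectrum Ω V lam u)
    {D : ℕ → ℝ}
    (hD : ∀ i, D i = ∫ x in Ω, (‖S.tension f x‖ ^ 2 - 4 * V x) * (u i : M → ℝ) x ^ 2 ∂S.vol) :
    (∀ i, IntegrableOn (fun x ↦ (‖S.tension f x‖ ^ 2 - 4 * V x) * (u i : M → ℝ) x ^ 2) Ω S.vol) ∧
    (∀ (k : ℕ) (p : ℝ),
      ∑ i ∈ Finset.range k with lam i < lam k, (lam k - lam i) ^ p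
        ≤ max 2 p / n *
          ∑ i ∈ Finset.range k with lam i < lam k,
            (lam k - lam i) ^ (p - 1) * (lam i + 1 / 4 * D i)) ∧
    ∀ i, 0 ≤ lam i + 1 / 4 * D i := by
  have hn0 : (0 : ℝ) < n := by exact_mod_cast hn
  have hap := fun i ↦ S.exists_formApprox hf hfiso hΩc hV (Lp.memLp (u i)) (hspec.eigen i).1
  choose φ g h using hap
  have hw : ∀ i, S.WeakEq f Ω V (u i : M → ℝ) (g i) (lam i) := fun i ↦
    (h i).weakEq S hf hfiso hΩ hΩc hV (hspec.eigen i).2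
  have hnorm : ∀ i, ∫ x in Ω, (u i : M → ℝ) x * (u i : M → ℝ) x ∂S.vol = 1 := by
    intro i
    rw [← S.inner_eq_setIntegral, real_inner_self_eq_norm_sq, u.orthonormal.norm_eq_one]
    norm_num
  -- the vectors `f β u_i` and `[-Δ_b + V, f β] u_i`
  let F : Fin m → ℕ → Lp ℝ 2 (S.vol.restrict Ω) := fun β i ↦
    ((h i).memLp_component_mul S hf hΩ hΩc β).toLp _
  let K : Fin m → ℕ → Lp ℝ 2 (S.vol.restrict Ω) := fun β i ↦
    ((h i).memLp_commutatorField S hf hΩ hΩc β).toLp _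
  have hFu : ∀ β i j, inner ℝ (F β i) (u j)
      = ∫ x in Ω, component f β x * (u i : M → ℝ) x * (u j : M → ℝ) x ∂S.vol := by
    intro β i j
    have h1 := TendstoMean.inner_toLp ((h i).memLp_component_mul S hf hΩ hΩc β) (Lp.memLp (u j))
    rwa [Lp.toLp_coeFn] at h1
  have hKu : ∀ β i j, inner ℝ (K β i) (u j)
      = ∫ x in Ω, S.commutatorField f (u i : M → ℝ) (g i) β x * (u j : M → ℝ) x ∂S.vol := by
    intro β i j
    have h1 := TendstoMean.inner_toLp ((h i).memLp_commutatorField S hf hΩ hΩc β) (Lp.memLp (u j))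
    rwa [Lp.toLp_coeFn] at h1
  have hKF : ∀ i, ∑ β, inner ℝ (K β i) (F β i) = 2 * n := by
    intro i
    have hi : ∀ β, Integrable (fun x ↦ (u i : M → ℝ) x *
        (S.carre (component f β) (component f β) x * (u i : M → ℝ) x)) (S.vol.restrict Ω) :=
      fun β ↦ integrable_mul_of_memLp_two (Lp.memLp (u i)) (S.tendstoMean_continuous_mul hΩ hΩc
        (S.continuous_component_carre hf β β) (h i).tendsto).memLp_lim
    have h1 : ∀ β, inner ℝ (K β i) (F β i) = ∫ x in Ω, (u i : M → ℝ) x *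
        (S.carre (component f β) (component f β) x * (u i : M → ℝ) x) ∂S.vol := fun β ↦
      (TendstoMean.inner_toLp _ _).trans ((h i).integral_commutatorField_mul_self S hf hΩ hΩc β)
    simp only [h1]
    rw [← integral_finsetSum _ fun β _ ↦ hi β, ← mul_one (2 * (n : ℝ)), ← hnorm i,
      ← integral_const_mul]
    congr 1
    ext x
    rw [← Finset.mul_sum, ← Finset.sum_mul, S.sum_carre_component_self hf hfiso]
    ring
  have hKK : ∀ i, ∑ β, ‖K β i‖ ^ 2 = 4 * (lam i + 1 / 4 * D i) := by
    intro i
    have h1 := (h i).sum_integral_commutatorField_sq S hf hfiso hΩ hΩc hV (hw i) (hnorm i)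
    rw [← hD] at h1
    rw [mul_add, ← mul_assoc, show (4 : ℝ) * (1 / 4) = 1 by norm_num, one_mul, ← h1]
    refine Finset.sum_congr rfl fun β _ ↦ ?_
    rw [← real_inner_self_eq_norm_sq]
    exact TendstoMean.inner_toLp _ _
  refine ⟨fun i ↦ (h i).integrable_tension_sub_mul S hf hΩ hΩc hV, fun k p ↦ ?_, fun i ↦ ?_⟩
  · have h1 := fun β ↦ sum_rpow_mul_inner_le u hspec.mono (F β) (K β)
      (fun i j ↦ by
        rw [hFu, hFu]
        congr 1
        ext x
        ring)
      (fun i j ↦ by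
        rw [hFu, hKu]
        exact (h i).integral_commutatorField_mul S hf hfiso hΩ hΩc hV (hw i) (h j) (hw j) β) k p
    have h2 := Finset.sum_le_sum fun β (_ : β ∈ Finset.univ) ↦ h1 β
    rw [← Finset.mul_sum, Finset.sum_comm, Finset.sum_comm (s := Finset.univ)] at h2
    simp only [← Finset.mul_sum, hKF, hKK] at h2
    rw [← Finset.sum_mul] at h2
    have h3 : ∑ i ∈ Finset.range k with lam i < lam k,
        (lam k - lam i) ^ (p - 1) * (4 * (lam i + 1 / 4 * D i))
        = 4 * ∑ i ∈ Finset.range k with lam i < lam k,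
          (lam k - lam i) ^ (p - 1) * (lam i + 1 / 4 * D i) := by
      rw [Finset.mul_sum]
      exact Finset.sum_congr rfl fun i _ ↦ by ring
    have h4 : max 2 p = 2 * max 1 (p / 2) := by
      rw [mul_max_of_nonneg _ _ (by norm_num)]
      congr 1 <;> ring
    rw [h3] at h2
    rw [h4, div_mul_eq_mul_div, le_div_iff₀ hn0]
    linarith
  · have h1 := hKK i
    have h2 : 0 ≤ ∑ β, ‖K β i‖ ^ 2 := Finset.sum_nonneg fun β _ ↦ sq_nonneg _
    linarith

end StrictlyPseudoconvexCR

section Bounds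

variable {n : ℕ} {lam D : ℕ → ℝ} {Dinf : ℝ}

/-- A sum restricted to the indices with `lam i < lam k`, when the omitted terms vanish. -/
lemma sum_filter_lt_eq (hmono : Monotone lam) (k : ℕ) {F : ℕ → ℝ}
    (hF : ∀ i, lam i = lam k → F i = 0) :
    ∑ i ∈ Finset.range k with lam i < lam k, F i = ∑ i ∈ Finset.range k, F i := by
  rw [Finset.sum_filter]
  refine Finset.sum_congr rfl fun i hi ↦ ?_
  split_ifs with h
  · rfl
  · exact (hF i (le_antisymm (hmono (Finset.mem_range.1 hi).le) (not_lt.1 h))).symm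

variable (hn : 1 ≤ n) (hmono : Monotone lam)
  (hineq : ∀ (k : ℕ) (p : ℝ), ∑ i ∈ Finset.range k with lam i < lam k, (lam k - lam i) ^ p
    ≤ max 2 p / n * ∑ i ∈ Finset.range k with lam i < lam k,
      (lam k - lam i) ^ (p - 1) * (lam i + 1 / 4 * D i))
  (hnonneg : ∀ i, 0 ≤ lam i + 1 / 4 * D i) (hD : ∀ i, D i ≤ Dinf)
include hn hmono hineq hnonneg hD

/-- The case `p = 1` of the weighted inequality. -/
lemma le_mean_add {k : ℕ} (hk : 1 ≤ k) :
    lam k ≤ (1 + 2 / n) * (1 / k * ∑ i ∈ Finset.range k, lam i) + 1 / (2 * n) * Dinf := by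
  have hn0 : (0 : ℝ) < n := by exact_mod_cast hn
  have hk0 : (0 : ℝ) < k := by exact_mod_cast hk
  have h1 := hineq k 1
  rw [max_eq_left (by norm_num)] at h1
  simp only [Real.rpow_one, sub_self, Real.rpow_zero, one_mul] at h1
  rw [sum_filter_lt_eq hmono k (F := fun i ↦ lam k - lam i) fun i h ↦ by simp [h]] at h1
  have h2 : ∑ i ∈ Finset.range k with lam i < lam k, (lam i + 1 / 4 * D i)
      ≤ ∑ i ∈ Finset.range k, (lam i + 1 / 4 * Dinf) :=
    (Finset.sum_le_sum_of_subset_of_nonneg (Finset.filter_subset _ _)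
      fun i _ _ ↦ hnonneg i).trans (Finset.sum_le_sum fun i _ ↦ by linarith [hD i])
  have h3 := h1.trans (mul_le_mul_of_nonneg_left h2 (by positivity))
  simp only [Finset.sum_sub_distrib, Finset.sum_add_distrib, Finset.sum_const, Finset.card_range,
    nsmul_eq_mul] at h3
  set X := ∑ i ∈ Finset.range k, lam i
  have h4 : (1 + 2 / n) * (1 / k * X) + 1 / (2 * n) * Dinf
      = (X + 2 / n * (X + k * (1 / 4 * Dinf))) / k := by
    field_simp
    ring
  rw [h4, le_div_iff₀ hk0]
  linarith

/-- The case `p = 2` of the weighted inequality, combined with the recursion formula. -/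
lemma le_rpow_mul_add {k : ℕ} (hk : 1 ≤ k) :
    lam k ≤ (1 + 2 / n) * (k : ℝ) ^ (1 / n : ℝ) * lam 0
      + 1 / 4 * ((1 + 2 / n) * (k : ℝ) ^ (1 / n : ℝ) - 1) * Dinf := by
  have hn0 : (0 : ℝ) < n := by exact_mod_cast hn
  have h1 := le_rpow_mul_of_nonneg (μ := fun i ↦ lam i + 1 / 4 * Dinf) hn
    (fun i j hij ↦ by simpa using hmono hij) (by linarith [hnonneg 0, hD 0]) (fun k ↦ ?_) hk
  · linarith
  · simp only [add_sub_add_right_eq_sub]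
    have h2 := hineq k 2
    rw [max_self] at h2
    simp only [show (2 : ℝ) - 1 = 1 by norm_num, Real.rpow_one, Real.rpow_two] at h2
    rw [sum_filter_lt_eq hmono k (F := fun i ↦ (lam k - lam i) ^ 2) fun i h ↦ by simp [h],
      sum_filter_lt_eq hmono k (F := fun i ↦ (lam k - lam i) * (lam i + 1 / 4 * D i))
        fun i h ↦ by simp [h]] at h2
    refine h2.trans (mul_le_mul_of_nonneg_left (Finset.sum_le_sum fun i hi ↦ ?_) (by positivity))
    exact mul_le_mul_of_nonneg_left (by linarith [hD i])
      (sub_nonneg.2 (hmono (Finset.mem_range.1 hi).le))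

end Bounds

/-- `lam j`, `u j` (`j ≥ 0`) stand for `λ_{j+1}`, `u_{j+1}`, and `D j` for `D_{j+1}`. -/
theorem theorem3p1 {n : ℕ} (hn : 1 ≤ n) {m : ℕ} {M : Type*} [TopologicalSpace M]
    [ChartedSpace (CRModel n) M] [IsManifold 𝓘(ℝ, CRModel n) ∞ M] [T2Space M]
    [SecondCountableTopology M] [MeasurableSpace M] [BorelSpace M]
    (S : StrictlyPseudoconvexCR n M)
    (f : M → EuclideanSpace ℝ (Fin m))
    (hf : ContMDiff 𝓘(ℝ, CRModel n) 𝓘(ℝ, EuclideanSpace ℝ (Fin m)) 2 f)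
    (hfiso : S.IsSemiIsometric f)
    (Ω : Set M) (hΩ : IsOpen Ω) (hΩc : IsCompact (closure Ω))
    (V : M → ℝ) (hV : LocallyIntegrableOn V Ω S.vol)
    (lam : ℕ → ℝ) (u : HilbertBasis ℕ ℝ (Lp ℝ 2 (S.vol.restrict Ω)))
    (hspec : S.IsDirichletSpectrum Ω V lam u)
    (D : ℕ → ℝ)
    (hD : ∀ i, D i = ∫ x in Ω, (‖S.tension f x‖ ^ 2 - 4 * V x) * (u i : M → ℝ) x ^ 2 ∂S.vol) :
    (∀ i, IntegrableOn (fun x ↦ (‖S.tension f x‖ ^ 2 - 4 * V x) * (u i : M → ℝ) x ^ 2) Ω S.vol) ∧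
    (∀ k : ℕ, 1 ≤ k → ∀ p : ℝ,
      ∑ i ∈ Finset.range k with lam i < lam k, (lam k - lam i) ^ p
        ≤ max 2 p / n *
          ∑ i ∈ Finset.range k with lam i < lam k,
            (lam k - lam i) ^ (p - 1) * (lam i + 1 / 4 * D i)) ∧
    (BddBelow (V '' Ω) →
      ∃ Dinf : ℝ, IsLUB ((fun x ↦ ‖S.tension f x‖ ^ 2 - 4 * V x) '' Ω) Dinf ∧
        ∀ k : ℕ, 1 ≤ k →
          lam k ≤ (1 + 2 / n) * (1 / k * ∑ i ∈ Finset.range k, lam i) + 1 / (2 * n) * Dinf ∧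
          lam k ≤ (1 + 2 / n) * (k : ℝ) ^ (1 / n : ℝ) * lam 0
            + 1 / 4 * ((1 + 2 / n) * (k : ℝ) ^ (1 / n : ℝ) - 1) * Dinf) := by
  obtain ⟨hint, hineq, hnonneg⟩ := S.weighted_eigenvalue_inequality hn hf hfiso hΩ hΩc hV hspec hD
  refine ⟨hint, fun k _ p ↦ hineq k p, fun hVb ↦ ?_⟩
  have hnorm : ∀ i, ∫ x in Ω, (u i : M → ℝ) x ^ 2 ∂S.vol = 1 := by
    intro i
    simp only [pow_two]
    rw [← S.inner_eq_setIntegral, real_inner_self_eq_norm_sq, u.orthonormal.norm_eq_one]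
    norm_num
  -- a unit vector of `L²(Ω)` excludes the empty set
  have hne : Ω.Nonempty := by
    by_contra h
    have h1 := hnorm 0
    rw [setIntegral_eq_zero_of_forall_eq_zero fun x hx ↦ (h ⟨x, hx⟩).elim] at h1
    exact zero_ne_one h1
  have hbdd : BddAbove ((fun x ↦ ‖S.tension f x‖ ^ 2 - 4 * V x) '' Ω) := by
    obtain ⟨c, hc⟩ := hVb
    obtain ⟨C, hC⟩ := hΩc.exists_bound_of_continuousOn
      (S.continuous_norm_tension_sq hf).continuousOn
    refine ⟨C - 4 * c, ?_⟩
    rintro _ ⟨x, hx, rfl⟩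
    have h1 := (le_abs_self _).trans (hC x (subset_closure hx))
    have h2 := hc (Set.mem_image_of_mem V hx)
    dsimp only
    linarith
  have hlub := isLUB_csSup (hne.image _) hbdd
  refine ⟨_, hlub, ?_⟩
  generalize sSup ((fun x ↦ ‖S.tension f x‖ ^ 2 - 4 * V x) '' Ω) = Dinf at hlub
  have hDinf : ∀ i, D i ≤ Dinf := by
    intro i
    have h1 : ∫ x in Ω, Dinf * (u i : M → ℝ) x ^ 2 ∂S.vol = Dinf := by
      rw [integral_const_mul, hnorm, mul_one]
    rw [hD, ← h1]
    exact setIntegral_mono_on (hint i) ((Lp.memLp (u i)).integrable_sq.const_mul _)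
      hΩ.measurableSet fun x hx ↦
        mul_le_mul_of_nonneg_right (hlub.1 (Set.mem_image_of_mem _ hx)) (sq_nonneg _)
  exact fun k hk ↦ ⟨le_mean_add hn hspec.mono hineq hnonneg hDinf hk,
    le_rpow_mul_add hn hspec.mono hineq hnonneg hDinf hk⟩
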